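/- **Proposition (the string form and the string class are natural).** Let $G$ be a compact connected Lie group with Lie algebra $\mathfrak g$, let $S^1=\mathbb R/2\pi\mathbb Z$, let $\Omega G$ be the group of smooth maps $\gamma:S^1\to G$ with $\gamma(0)=1$, and let $\Omega\mathfrak g$ be its Lie algebra of smooth maps $S^1\to\mathfrak g$ vanishing at $0$. Manifolds are smooth, finite-dimensional, without boundary, Hausdorff and $\sigma$-compact. Let $M$ be a manifold and $P\to M$ a smooth principal $\Omega G$-bundle. A *connection* on $P$ is an $\Omega\mathfrak g$-valued one-form $A$ on $P$ with $R_\gamma^*A=\mathrm{ad}(\gamma^{-1})A$ for $\gamma\in\Omega G$ and $A(V_\zeta)=\zeta$ for the vertical vector $V_\zeta$ generated by $\zeta\in\Omega\mathfrak g$. A *Higgs field* on $P$ is a smooth map $\Phi:P\to C^\infty(S^1,\mathfrak g)$ with $\Phi(p\gamma)=\mathrm{ad}(\gamma^{-1})\Phi(p)+\gamma^{-1}\partial\gamma$, where $\partial=d/d\theta$. The *caloron transform* of $P$ is the principal $G$-bundle $\widetilde P=(P\times G\times S^1)/\Omega G\to M\times S^1$, where $(p,g,\theta)\gamma=(p\gamma,\gamma(\theta)^{-1}g,\theta)$,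 with action $[p,g,\theta]h=[p,gh,\theta]$ and projection $[p,g,\theta]\mapsto(\pi(p),\theta)$. Let $f$ be an $\mathrm{ad}$-invariant symmetric $k$-linear form on $\mathfrak g$, $k\ge1$. Then: 1. For every connection $A$ and Higgs field $\Phi$ on $P$, the one-form $\mathrm{ad}(g^{-1})A(\theta)+\Theta+\mathrm{ad}(g^{-1})\Phi\,d\theta$ on $P\times G\times S^1$, where $\Theta$ is the Maurer–Cartan form of $G$, descends to a connection $\widetilde A$ on $\widetilde P$. With $\widetilde F=d\widetilde A+\tfrac12[\widetilde A,\widetilde A]$, the form $f(\widetilde F,\dots,\widetilde F)$ descends to a smooth form $cw_f(\widetilde A)\in\Omega^{2k}(M\times S^1)$, and the *string form* $s_f(A,\Phi)=\int_{S^1}cw_f(\widetilde A)\in\Omega^{2k-1}(M)$ is smooth and closed. 2. Connections and Higgs fields on $P$ exist, and the class $s_f(P)=[s_f(A,\Phi)]\in H^{2k-1}(M)$ (de Rham cohomology), the *string class*, does not depend on the choice of $A$ and $\Phi$. 3. The string form is natural: for every manifold $N$, every smooth map $\psi:N\to M$ and all $A,\Phi$ on $P$, $$\psi^*s_f(A,\Phi)=s_f(\psi^*A,\psi^*\Phi),$$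 where $\psi^*A$ and $\psi^*\Phi$ are the induced connection and Higgs field on $\psi^*P\to N$. 4. The string class is a characteristic class of $\Omega G$-bundles: $\psi^*s_f(P)=s_f(\psi^*P)$ for every smooth map $\psi:N\to M$; more generally $\psi^*s_f(P)=s_f(Q)$ for every principal $\Omega G$-bundle $Q\to N$ with a smooth $\Omega G$-equivariant map $Q\to P$ covering $\psi$. In particular $s_f(P)$ depends only on the isomorphism class of $P$. -/

import Mathlib

open scoped Manifold ContDiff
noncomputable section
open Set Filter Topology
namespace Caloron
set_option linter.unusedSectionVars false

section
variable {V E F : Type*} [NormedAddCommGroup V] [NormedSpace ℝ V]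
  [NormedAddCommGroup E] [NormedSpace ℝ E] [NormedAddCommGroup F] [NormedSpace ℝ F]

/-- Alternatization of continuous multilinear maps as a continuous linear map. -/
def alternatizationL (q : ℕ) :
    ContinuousMultilinearMap ℝ (fun _ : Fin q => E) ℝ →L[ℝ] E [⋀^Fin q]→L[ℝ] ℝ :=
  LinearMap.mkContinuous
    { toFun := fun f => ContinuousMultilinearMap.alternatization f
      map_add' := fun f g => map_add _ f g
      map_smul' := fun c f => by
        ext v
        simp [ContinuousMultilinearMap.alternatization_apply_apply, Finset.mul_sum,
          Units.smul_def, mul_left_comm] }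
    (q.factorial : ℝ) fun f => by
      refine ContinuousAlternatingMap.opNorm_le_bound _ (by positivity) fun v => ?_
      simp only [LinearMap.coe_mk, AddHom.coe_mk,
        ContinuousMultilinearMap.alternatization_apply_apply]
      refine (norm_sum_le _ _).trans ?_
      calc _ ≤ ∑ _σ : Equiv.Perm (Fin q), ‖f‖ * ∏ i, ‖v i‖ := by
            refine Finset.sum_le_sum fun σ _ => ?_
            have h := f.le_opNorm (v ∘ σ)
            rw [show ∏ i, ‖(v ∘ σ) i‖ = ∏ i, ‖v i‖ from
              Equiv.prod_comp σ (fun i => ‖v i‖)] at h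
            rcases Int.units_eq_one_or (Equiv.Perm.sign σ) with h' | h' <;> simpa [h'] using h
        _ = _ := by simp [Fintype.card_perm, mul_assoc]

lemma contDiffAt_of_toContinuousMultilinearMap {q : ℕ} {r : WithTop ℕ∞}
    {f : V → E [⋀^Fin q]→L[ℝ] ℝ} {x : V}
    (h : ContDiffAt ℝ r (fun y => (f y).toContinuousMultilinearMap) x) : ContDiffAt ℝ r f x := by
  have h2 := ((alternatizationL (E := E) q).contDiff.contDiffAt.comp x h).const_smul
    ((q.factorial : ℝ)⁻¹)
  refine h2.congr_of_eventuallyEq (Eventually.of_forall fun y => ?_)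
  ext v
  have : ∀ σ : Equiv.Perm (Fin q), Equiv.Perm.sign σ • f y (v ∘ σ) = f y v := fun σ => by
    have := (f y).toAlternatingMap.map_perm v σ
    change f y (v ∘ σ) = _ • f y v at this
    rw [this, smul_smul, Int.units_mul_self, one_smul]
  have h3 : alternatizationL q (f y).toContinuousMultilinearMap v = (q.factorial : ℝ) * f y v := by
    change ContinuousMultilinearMap.alternatization _ v = _
    rw [ContinuousMultilinearMap.alternatization_apply_apply]
    refine (Finset.sum_congr rfl fun σ _ => this σ).trans ?_
    simp [Fintype.card_perm]
  simp only [Function.comp, ContinuousAlternatingMap.smul_apply, smul_eq_mul]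
  rw [h3, inv_mul_cancel_left₀ (by positivity)]

lemma contDiffAt_compContinuousLinearMap {q : ℕ} {r : WithTop ℕ∞} {f : V → F [⋀^Fin q]→L[ℝ] ℝ}
    {g : V → E →L[ℝ] F} {x : V} (hf : ContDiffAt ℝ r f x) (hg : ContDiffAt ℝ r g x) :
    ContDiffAt ℝ r (fun y => (f y).compContinuousLinearMap (g y)) x := by
  apply contDiffAt_of_toContinuousMultilinearMap
  have h1 : ContDiffAt ℝ r (fun y =>
      ContinuousMultilinearMap.compContinuousLinearMapContinuousMultilinear ℝ
        (fun _ : Fin q => E) (fun _ => F) ℝ (fun _ => g y)) x :=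
    (ContinuousMultilinearMap.contDiff _).contDiffAt.comp x (contDiffAt_pi.2 fun _ => hg)
  have h2 : ContDiffAt ℝ r (fun y => (f y).toContinuousMultilinearMap) x :=
    (ContinuousAlternatingMap.toContinuousMultilinearMapCLM ℝ :
      (F [⋀^Fin q]→L[ℝ] ℝ) →L[ℝ] _).contDiff.contDiffAt.comp x hf
  exact h1.clm_apply h2
end
section Forms
variable {E : Type*} [NormedAddCommGroup E] [NormedSpace ℝ E]
  {H : Type*} [TopologicalSpace H] (I : ModelWithCorners ℝ E H)
  {M : Type*} [TopologicalSpace M] [ChartedSpace H M]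
  {E' : Type*} [NormedAddCommGroup E'] [NormedSpace ℝ E']
  {H' : Type*} [TopologicalSpace H'] (J : ModelWithCorners ℝ E' H')
  {N : Type*} [TopologicalSpace N] [ChartedSpace H' N]

/-- A (not necessarily smooth) real `q`-form on a manifold modelled on `E`: an alternating form on
each tangent space. Recall that `TangentSpace I x` is by definition the model space `E`. -/
def MForm (E : Type*) [NormedAddCommGroup E] [NormedSpace ℝ E] (M : Type*) (q : ℕ) : Type _ :=
  M → E [⋀^Fin q]→L[ℝ] ℝ

instance (E : Type*) [NormedAddCommGroup E] [NormedSpace ℝ E] (M : Type*) (q : ℕ) :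
    AddCommGroup (MForm E M q) := inferInstanceAs (AddCommGroup (M → E [⋀^Fin q]→L[ℝ] ℝ))

instance (E : Type*) [NormedAddCommGroup E] [NormedSpace ℝ E] (M : Type*) (q : ℕ) :
    Module ℝ (MForm E M q) := inferInstanceAs (Module ℝ (M → E [⋀^Fin q]→L[ℝ] ℝ))

/-- The pullback `ψ^* α` of a form along `ψ : N → M`. -/
def formPullback {q : ℕ} (ψ : N → M) (α : MForm E M q) : MForm E' N q := fun x =>
  (α (ψ x)).compContinuousLinearMap (mfderiv J I ψ x : E' →L[ℝ] E)

/-- The representative of a form in the preferred chart at `x₀`, a form on an open subset of `E`. -/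
def formInChart {q : ℕ} (α : MForm E M q) (x₀ : M) : E → E [⋀^Fin q]→L[ℝ] ℝ :=
  formPullback I 𝓘(ℝ, E) (extChartAt I x₀).symm α

/-- A form is smooth if it is smooth in every preferred chart. -/
def IsSmoothForm {q : ℕ} (α : MForm E M q) : Prop :=
  ∀ x₀ : M, ContDiffOn ℝ ∞ (formInChart I α x₀) (extChartAt I x₀).target

/-- The exterior derivative of a form, computed in the preferred chart at each point. -/
def formD {q : ℕ} (α : MForm E M q) : MForm E M (q + 1) := fun x =>
  (extDeriv (formInChart I α x) (extChartAt I x x)).compContinuousLinearMap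
    (mfderiv I 𝓘(ℝ, E) (extChartAt I x) x : E →L[ℝ] E)

variable {I J}

lemma formInChart_add {q : ℕ} (α β : MForm E M q) (x₀ : M) :
    formInChart I (α + β) x₀ = formInChart I α x₀ + formInChart I β x₀ := rfl

lemma formInChart_smul {q : ℕ} (c : ℝ) (α : MForm E M q) (x₀ : M) :
    formInChart I (c • α) x₀ = c • formInChart I α x₀ := rfl

lemma isSmoothForm_zero {q : ℕ} : IsSmoothForm I (0 : MForm E M q) := fun _ =>
  contDiffOn_const (c := (0 : E [⋀^Fin q]→L[ℝ] ℝ))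

lemma IsSmoothForm.add {q : ℕ} {α β : MForm E M q} (h : IsSmoothForm I α) (h' : IsSmoothForm I β) :
    IsSmoothForm I (α + β) := fun x => (h x).add (h' x)

lemma IsSmoothForm.smul {q : ℕ} (c : ℝ) {α : MForm E M q} (h : IsSmoothForm I α) :
    IsSmoothForm I (c • α) := fun x => (h x).const_smul c

lemma formD_smul {q : ℕ} (c : ℝ) (α : MForm E M q) : formD I (c • α) = c • formD I α := by
  funext x
  simp only [formD, formInChart_smul, extDeriv_smul]
  rfl

variable [I.Boundaryless] [J.Boundaryless]

lemma IsSmoothForm.contDiffAt {q : ℕ} {α : MForm E M q} (h : IsSmoothForm I α) (x : M) {y : E}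
    (hy : y ∈ (extChartAt I x).target) : ContDiffAt ℝ ∞ (formInChart I α x) y :=
  (h x).contDiffAt ((isOpen_extChartAt_target x).mem_nhds hy)

lemma formD_add {q : ℕ} {α β : MForm E M q} (h : IsSmoothForm I α) (h' : IsSmoothForm I β) :
    formD I (α + β) = formD I α + formD I β := by
  funext x
  have hx := mem_extChartAt_target (I := I) x
  simp only [formD, formInChart_add]
  rw [extDeriv_add ((h.contDiffAt x hx).differentiableAt (by simp))
    ((h'.contDiffAt x hx).differentiableAt (by simp))]
  rfl

lemma formD_zero {q : ℕ} : formD I (0 : MForm E M q) = 0 := by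
  simpa using formD_smul (I := I) 0 (0 : MForm E M q)

lemma mdifferentiableAt_extChartAt_symm [IsManifold I ∞ M] {z : M} {y : E}
    (hy : y ∈ (extChartAt I z).target) :
    MDifferentiableAt 𝓘(ℝ, E) I (extChartAt I z).symm y :=
  (((contMDiffOn_extChartAt_symm (n := ∞) z).contMDiffAt
    ((isOpen_extChartAt_target z).mem_nhds hy)).mdifferentiableAt (by simp))

lemma formPullback_comp {E'' : Type*} [NormedAddCommGroup E''] [NormedSpace ℝ E'']
    {H'' : Type*} [TopologicalSpace H''] {K : ModelWithCorners ℝ E'' H''}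
    {L : Type*} [TopologicalSpace L] [ChartedSpace H'' L] {q : ℕ}
    (α : MForm E M q) {ψ : N → M} {χ : L → N} {y : L}
    (hψ : MDifferentiableAt J I ψ (χ y)) (hχ : MDifferentiableAt K J χ y) :
    formPullback I K (fun w => ψ (χ w)) α y =
      formPullback J K χ (formPullback I J ψ α) y := by
  have h : (mfderiv K I (fun w => ψ (χ w)) y : E'' →L[ℝ] E) =
      (mfderiv J I ψ (χ y) : E' →L[ℝ] E).comp (mfderiv K J χ y : E'' →L[ℝ] E') :=
    mfderiv_comp (I := K) (I' := J) (I'' := I) y hψ hχ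
  simp only [formPullback]
  rw [h]
  rfl

lemma formPullback_congr {q : ℕ} (α : MForm E M q) {ψ ψ' : N → M} {y : N}
    (h : ψ =ᶠ[𝓝 y] ψ') : formPullback I J ψ α y = formPullback I J ψ' α y := by
  have h1 : (mfderiv J I ψ y : E' →L[ℝ] E) = mfderiv J I ψ' y := h.mfderiv_eq
  have h2 := h.eq_of_nhds
  simp only [formPullback]
  rw [h1, h2]

lemma formPullback_eq_inChart [IsManifold I ∞ M] {q : ℕ}
    (α : MForm E M q) {ψ : E' → M} {y : E'} (z : M)
    (hψ : MDifferentiableAt 𝓘(ℝ, E') I ψ y) (hz : ψ y ∈ (extChartAt I z).source) :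
    formPullback I 𝓘(ℝ, E') ψ α y =
      (formInChart I α z (extChartAt I z (ψ y))).compContinuousLinearMap
        (fderiv ℝ (fun w => extChartAt I z (ψ w)) y) := by
  have h1 : ψ =ᶠ[𝓝 y] fun w => (extChartAt I z).symm (extChartAt I z (ψ w)) := by
    filter_upwards [hψ.continuousAt.preimage_mem_nhds
      ((isOpen_extChartAt_source z).mem_nhds hz)] with w hw
    exact ((extChartAt I z).left_inv hw).symm
  have h2 : MDifferentiableAt 𝓘(ℝ, E') 𝓘(ℝ, E) (fun w => extChartAt I z (ψ w)) y :=
    (mdifferentiableAt_extChartAt (by simpa using hz)).comp y hψ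
  rw [formPullback_congr α h1,
    formPullback_comp (J := 𝓘(ℝ, E)) (ψ := (extChartAt I z).symm)
      (χ := fun w => extChartAt I z (ψ w)) α
      (mdifferentiableAt_extChartAt_symm ((extChartAt I z).map_source hz)) h2]
  simp only [formPullback, formInChart, mfderiv_eq_fderiv]

/-- local expression for the pullback -/
lemma formInChart_pullback [IsManifold I ∞ M] [IsManifold J ∞ N] {q : ℕ}
    (α : MForm E M q) {ψ : N → M} (hψ : ContMDiff J I ∞ ψ) (x : N) {y : E'}
    (hy : y ∈ (extChartAt J x).target) (z : M)
    (hz : ψ ((extChartAt J x).symm y) ∈ (extChartAt I z).source) :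
    formInChart J (formPullback I J ψ α) x y =
      (formInChart I α z (extChartAt I z (ψ ((extChartAt J x).symm y)))).compContinuousLinearMap
        (fderiv ℝ (fun w => extChartAt I z (ψ ((extChartAt J x).symm w))) y) := by
  have hs := mdifferentiableAt_extChartAt_symm (I := J) hy
  have h1 : MDifferentiableAt J I ψ ((extChartAt J x).symm y) :=
    hψ.mdifferentiableAt (by simp)
  rw [formInChart, ← formPullback_comp (ψ := ψ) α h1 hs]
  exact formPullback_eq_inChart α z (h1.comp y hs) hz

lemma contDiffAt_chart_expr [IsManifold I ∞ M] [IsManifold J ∞ N]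
    {ψ : N → M} (hψ : ContMDiff J I ∞ ψ) (x : N) {y : E'}
    (hy : y ∈ (extChartAt J x).target) (z : M)
    (hz : ψ ((extChartAt J x).symm y) ∈ (extChartAt I z).source) :
    ContDiffAt ℝ ∞ (fun w => extChartAt I z (ψ ((extChartAt J x).symm w))) y := by
  rw [← contMDiffAt_iff_contDiffAt]
  have h1 : ContMDiffAt 𝓘(ℝ, E') J ∞ (extChartAt J x).symm y :=
    (contMDiffOn_extChartAt_symm (n := ∞) x).contMDiffAt
      ((isOpen_extChartAt_target x).mem_nhds hy)
  exact ContMDiffAt.comp y (contMDiffAt_extChartAt' (by simpa using hz))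
    ((hψ _).comp y h1)

lemma formInChart_pullback_eventually [IsManifold I ∞ M] [IsManifold J ∞ N] {q : ℕ}
    (α : MForm E M q) {ψ : N → M} (hψ : ContMDiff J I ∞ ψ) (x : N) {y : E'}
    (hy : y ∈ (extChartAt J x).target) (z : M)
    (hz : ψ ((extChartAt J x).symm y) ∈ (extChartAt I z).source) :
    formInChart J (formPullback I J ψ α) x =ᶠ[𝓝 y] fun y =>
      (formInChart I α z (extChartAt I z (ψ ((extChartAt J x).symm y)))).compContinuousLinearMap
        (fderiv ℝ (fun w => extChartAt I z (ψ ((extChartAt J x).symm w))) y) := by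
  have hc : ContinuousAt (fun w => ψ ((extChartAt J x).symm w)) y :=
    (hψ.continuous.continuousAt).comp (continuousAt_extChartAt_symm'' hy)
  filter_upwards [(isOpen_extChartAt_target x).mem_nhds hy,
    hc.preimage_mem_nhds ((isOpen_extChartAt_source z).mem_nhds hz)] with w hw hw'
  exact formInChart_pullback α hψ x hw z hw'

lemma IsSmoothForm.pullback [IsManifold I ∞ M] [IsManifold J ∞ N] {q : ℕ}
    {α : MForm E M q} (hα : IsSmoothForm I α) {ψ : N → M} (hψ : ContMDiff J I ∞ ψ) :
    IsSmoothForm J (formPullback I J ψ α) := by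
  intro x y hy
  set z := ψ ((extChartAt J x).symm y) with hzdef
  have hz : ψ ((extChartAt J x).symm y) ∈ (extChartAt I z).source := mem_extChartAt_source z
  have hF := contDiffAt_chart_expr hψ x hy z hz
  have h1 := (hα.contDiffAt z ((extChartAt I z).map_source hz)).comp y hF
  have h2 : ContDiffAt ℝ ∞
      (fderiv ℝ (fun w => extChartAt I z (ψ ((extChartAt J x).symm w)))) y :=
    hF.fderiv_right (by simp)
  refine ContDiffAt.contDiffWithinAt ?_
  refine ContDiffAt.congr_of_eventuallyEq ?_
    (formInChart_pullback_eventually α hψ x hy z hz)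
  exact contDiffAt_compContinuousLinearMap h1 h2

lemma formD_pullback [IsManifold I ∞ M] [IsManifold J ∞ N] {q : ℕ}
    {α : MForm E M q} (hα : IsSmoothForm I α) {ψ : N → M} (hψ : ContMDiff J I ∞ ψ) :
    formD J (formPullback I J ψ α) = formPullback I J ψ (formD I α) := by
  funext x
  have hx := mem_extChartAt_target (I := J) x
  have hsx : (extChartAt J x).symm (extChartAt J x x) = x := extChartAt_to_inv x
  have hz : ψ ((extChartAt J x).symm (extChartAt J x x)) ∈ (extChartAt I (ψ x)).source := by
    rw [hsx]; exact mem_extChartAt_source _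
  have hF := contDiffAt_chart_expr hψ x hx (ψ x) hz
  have hd := (hα.contDiffAt (ψ x) ((extChartAt I (ψ x)).map_source hz)).differentiableAt
    (by simp)
  simp only [formD]
  rw [(formInChart_pullback_eventually α hψ x hx (ψ x) hz).extDeriv_eq]
  have key := extDeriv_pullback (r := ∞)
    (f := fun w => extChartAt I (ψ x) (ψ ((extChartAt J x).symm w))) hd hF (by rw [minSmoothness_of_isRCLikeNormedField]; exact WithTop.coe_le_coe.mpr (le_top : (2 : ℕ∞) ≤ ⊤))
  refine (congrArg (fun a : E' [⋀^Fin (q + 1)]→L[ℝ] ℝ => a.compContinuousLinearMap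
    (mfderiv J 𝓘(ℝ, E') (extChartAt J x) x : E' →L[ℝ] E')) key).trans ?_
  have hψx : (fun w => extChartAt I (ψ x) (ψ ((extChartAt J x).symm (extChartAt J x w))))
      =ᶠ[𝓝 x] fun w => extChartAt I (ψ x) (ψ w) := by
    filter_upwards [(isOpen_extChartAt_source x).mem_nhds (mem_extChartAt_source (I := J) x)]
      with w hw
    rw [(extChartAt J x).left_inv hw]
  have h1 : (mfderiv J 𝓘(ℝ, E) (fun w => extChartAt I (ψ x)
        (ψ ((extChartAt J x).symm (extChartAt J x w)))) x : E' →L[ℝ] E) =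
      (fderiv ℝ (fun w => extChartAt I (ψ x) (ψ ((extChartAt J x).symm w)))
        (extChartAt J x x)).comp (mfderiv J 𝓘(ℝ, E') (extChartAt J x) x : E' →L[ℝ] E') := by
    have := mfderiv_comp (I := J) (I' := 𝓘(ℝ, E')) (I'' := 𝓘(ℝ, E)) x
      (g := fun w => extChartAt I (ψ x) (ψ ((extChartAt J x).symm w)))
      (f := extChartAt J x) (hF.differentiableAt (by simp)).mdifferentiableAt
      (mdifferentiableAt_extChartAt (mem_chart_source _ x))
    rw [mfderiv_eq_fderiv] at this
    exact this
  have h2 : (mfderiv J 𝓘(ℝ, E) (fun w => extChartAt I (ψ x) (ψ w)) x : E' →L[ℝ] E) =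
      (mfderiv I 𝓘(ℝ, E) (extChartAt I (ψ x)) (ψ x) : E →L[ℝ] E).comp
        (mfderiv J I ψ x : E' →L[ℝ] E) :=
    mfderiv_comp (I := J) (I' := I) (I'' := 𝓘(ℝ, E)) x
      (mdifferentiableAt_extChartAt (mem_chart_source _ (ψ x)))
      (hψ.mdifferentiableAt (by simp))
  have h3 : (mfderiv J 𝓘(ℝ, E) (fun w => extChartAt I (ψ x)
        (ψ ((extChartAt J x).symm (extChartAt J x w)))) x : E' →L[ℝ] E) =
      mfderiv J 𝓘(ℝ, E) (fun w => extChartAt I (ψ x) (ψ w)) x := hψx.mfderiv_eq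
  have h4 := h1.symm.trans (h3.trans h2)
  simp only [formPullback, hsx]
  exact congrArg (fun l : E' →L[ℝ] E => (extDeriv (formInChart I α (ψ x))
    (extChartAt I (ψ x) (ψ x))).compContinuousLinearMap l) h4

variable (I M)

/-- The space of closed smooth `q`-forms. -/
def closedForms (q : ℕ) : Submodule ℝ (MForm E M q) where
  carrier := {α | IsSmoothForm I α ∧ formD I α = 0}
  zero_mem' := ⟨isSmoothForm_zero, formD_zero⟩
  add_mem' := fun h h' => ⟨h.1.add h'.1, by rw [formD_add h.1 h'.1, h.2, h'.2, add_zero]⟩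
  smul_mem' := fun c _ h => ⟨h.1.smul c, by rw [formD_smul, h.2, smul_zero]⟩

/-- The space of exact `q`-forms, i.e. exterior derivatives of smooth `(q-1)`-forms. -/
def exactForms : (q : ℕ) → Submodule ℝ (MForm E M q)
  | 0 => ⊥
  | q + 1 =>
    { carrier := {α | ∃ β : MForm E M q, IsSmoothForm I β ∧ formD I β = α}
      zero_mem' := ⟨0, isSmoothForm_zero, formD_zero⟩
      add_mem' := by
        rintro _ _ ⟨β, h, rfl⟩ ⟨β', h', rfl⟩
        exact ⟨β + β', h.add h', formD_add h h'⟩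
      smul_mem' := by
        rintro c _ ⟨β, h, rfl⟩
        exact ⟨c • β, h.smul c, formD_smul c β⟩ }

/-- The de Rham cohomology `H^q(M)`: closed forms modulo exact forms. -/
abbrev DeRham (q : ℕ) : Type _ :=
  closedForms I M q ⧸ (exactForms I M q).submoduleOf (closedForms I M q)

variable {M}

open Classical in
/-- The de Rham class of a closed form (with value `0` on forms which are not closed). -/
def deRhamClass {q : ℕ} (α : MForm E M q) : DeRham I M q :=
  if h : α ∈ closedForms I M q then Submodule.Quotient.mk ⟨α, h⟩ else 0

variable (J) [IsManifold I ∞ M] [IsManifold J ∞ N]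

/-- Pullback of closed forms along a smooth map. -/
def closedPullback (ψ : N → M) (hψ : ContMDiff J I ∞ ψ) (q : ℕ) :
    closedForms I M q →ₗ[ℝ] closedForms J N q where
  toFun α := ⟨formPullback I J ψ α.1, α.2.1.pullback hψ, by
    rw [formD_pullback α.2.1 hψ, α.2.2]; rfl⟩
  map_add' _ _ := rfl
  map_smul' _ _ := rfl

/-- The map `ψ^* : H^q(M) → H^q(N)` induced by a smooth map `ψ : N → M`. -/
def deRhamPullback (ψ : N → M) (hψ : ContMDiff J I ∞ ψ) (q : ℕ) :
    DeRham I M q →ₗ[ℝ] DeRham J N q :=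
  Submodule.mapQ _ _ (closedPullback I J ψ hψ q) (by
    rintro ⟨α, hα⟩ h
    cases q with
    | zero =>
      have h0 : α = 0 := h
      subst h0
      exact (exactForms J N 0).zero_mem
    | succ q =>
      obtain ⟨β, hβ, rfl⟩ : ∃ β : MForm E M q, IsSmoothForm I β ∧ formD I β = α := h
      exact ⟨formPullback I J ψ β, hβ.pullback hψ, formD_pullback hβ hψ⟩)

end Forms
notation "𝔼" n:max => EuclideanSpace ℝ (Fin n)

section LieGroup

/-- The Lie algebra `𝔤 = T₁G` of a `d`-dimensional Lie group `G`. By definition of `TangentSpace` in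
Mathlib, `T₁G` is the model space; its bracket is given by `lieB`. -/
abbrev LieAlg (d : ℕ) : Type := 𝔼 d

variable (d : ℕ) {G : Type*} [TopologicalSpace G] [ChartedSpace (𝔼 d) G] [Group G]

/-- The adjoint action `ad(g) : 𝔤 → 𝔤`, the derivative at `1` of conjugation by `g`. -/
def Ad (g : G) : LieAlg d →L[ℝ] LieAlg d :=
  (mfderiv (𝓡 d) (𝓡 d) (fun h : G => g * h * g⁻¹) 1 : LieAlg d →L[ℝ] LieAlg d)

/-- The pullback `g^*Θ = g⁻¹dg` of the left-invariant Maurer-Cartan form along `g : ℝⁿ → G`: the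
derivative at `u` of `w ↦ g(u)⁻¹ g(w)`, with values in `T₁G = 𝔤`. -/
def maurerCartan {n : ℕ} (g : 𝔼 n → G) (u : 𝔼 n) : 𝔼 n →L[ℝ] LieAlg d :=
  (mfderiv (𝓡 n) (𝓡 d) (fun w => (g u)⁻¹ * g w) u : 𝔼 n →L[ℝ] LieAlg d)

variable (G) [LieGroup (𝓡 d) ∞ G]

/-- The Lie bracket `[X, Y]` of `𝔤` (defined through left-invariant vector fields). -/
def lieB (X Y : LieAlg d) : LieAlg d :=
  @Bracket.bracket (GroupLieAlgebra (𝓡 d) G) (GroupLieAlgebra (𝓡 d) G) _ X Y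

lemma lieGroup_minSmoothness : LieGroup (𝓡 d) (minSmoothness ℝ 3) G :=
  LieGroup.of_le (n := ∞) (by
    rw [minSmoothness_of_isRCLikeNormedField]
    exact WithTop.coe_le_coe.mpr (le_top : (3 : ℕ∞) ≤ ⊤))

/-- The Lie bracket of `𝔤`, as a bilinear map. -/
def lieBLinear : LieAlg d →ₗ[ℝ] LieAlg d →ₗ[ℝ] LieAlg d :=
  have := lieGroup_minSmoothness d G
  LinearMap.mk₂ ℝ (lieB d G)
    (fun X Y Z => @add_lie (GroupLieAlgebra (𝓡 d) G) (GroupLieAlgebra (𝓡 d) G) _ _ _ X Y Z)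
    (fun c X Y => @smul_lie ℝ (GroupLieAlgebra (𝓡 d) G) (GroupLieAlgebra (𝓡 d) G)
      _ _ _ _ _ _ _ c X Y)
    (fun X Y Z => @lie_add (GroupLieAlgebra (𝓡 d) G) (GroupLieAlgebra (𝓡 d) G) _ _ _ X Y Z)
    (fun c X Y => @lie_smul ℝ (GroupLieAlgebra (𝓡 d) G) (GroupLieAlgebra (𝓡 d) G)
      _ _ _ _ _ _ _ c X Y)

/-- The Lie bracket of `𝔤`, as a continuous multilinear map in two variables. -/
def lieBMultilinear : ContinuousMultilinearMap ℝ (fun _ : Fin 2 => LieAlg d) (LieAlg d) where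
  toFun v := lieB d G (v 0) (v 1)
  map_update_add' := by
    intro inst v i x y
    rw [Subsingleton.elim inst (instDecidableEqFin 2)]
    fin_cases i
    · exact LinearMap.map_add₂ (lieBLinear d G) x y (v 1)
    · exact map_add (lieBLinear d G (v 0)) x y
  map_update_smul' := by
    intro inst v i c x
    rw [Subsingleton.elim inst (instDecidableEqFin 2)]
    fin_cases i
    · exact LinearMap.map_smul₂ (lieBLinear d G) c x (v 1)
    · exact map_smul (lieBLinear d G (v 0)) c x
  cont := by
    have h : Continuous fun v : Fin 2 → LieAlg d =>
        LinearMap.toContinuousLinearMap (lieBLinear d G (v 0)) (v 1) :=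
      ((LinearMap.continuous_of_finiteDimensional
        (LinearMap.toContinuousLinearMap.toLinearMap ∘ₗ lieBLinear d G)).comp
          (continuous_apply 0)).clm_apply (continuous_apply 1)
    exact h

/-- The `𝔤`-valued two-form `[A, A]` of a `𝔤`-valued one-form `A`, i.e.
`[A, A](v, w) = [A v, A w] - [A w, A v]`. -/
def bracketForm {n : ℕ} (A : 𝔼 n →L[ℝ] LieAlg d) : 𝔼 n [⋀^Fin 2]→L[ℝ] LieAlg d :=
  ContinuousMultilinearMap.alternatization
    ((lieBMultilinear d G).compContinuousLinearMap fun _ => A)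

/-- An invariant polynomial of degree `k` on `𝔤`, an element of `I^k(𝔤)`: a multilinear, symmetric,
`ad`-invariant function (continuity is automatic as `𝔤` is finite-dimensional). -/
structure InvariantPolynomial (k : ℕ) where
  toMap : ContinuousMultilinearMap ℝ (fun _ : Fin k => LieAlg d) ℝ
  symm : ∀ (σ : Equiv.Perm (Fin k)) (v : Fin k → LieAlg d), toMap (fun i => v (σ i)) = toMap v
  invariant : ∀ (g : G) (v : Fin k → LieAlg d), toMap (fun i => Ad d g (v i)) = toMap v

variable {d G}

/-- The multilinear map `(v₀, …, v₂ₖ₋₁) ↦ f(F(v₀, v₁), …, F(v₂ₖ₋₂, v₂ₖ₋₁))`. -/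
def polyMultilinear {k n : ℕ} (f : ContinuousMultilinearMap ℝ (fun _ : Fin k => LieAlg d) ℝ)
    (F : 𝔼 n [⋀^Fin 2]→L[ℝ] LieAlg d) : ContinuousMultilinearMap ℝ (fun _ : Fin (2 * k) => 𝔼 n) ℝ :=
  let e : Fin k × Fin 2 ≃ Fin (2 * k) := finProdFinEquiv.trans (finCongr (Nat.mul_comm k 2))
  have key (v : Fin (2 * k) → 𝔼 n) (a : Fin (2 * k)) (z : 𝔼 n) :
      (fun i => F fun j => Function.update v a z (e (i, j))) =
        Function.update (fun i => F fun j => v (e (i, j))) (e.symm a).1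
          (F (Function.update (fun j => v (e ((e.symm a).1, j))) (e.symm a).2 z)) := by
    funext i
    by_cases h : i = (e.symm a).1
    · subst h
      rw [Function.update_self]
      congr 1
      funext j
      by_cases hj : j = (e.symm a).2
      · subst hj
        simp
      · have : e ((e.symm a).1, j) ≠ a := fun h' => hj (by rw [← h']; simp)
        simp [this, hj]
    · rw [Function.update_of_ne h]
      congr 1
      funext j
      have : e (i, j) ≠ a := fun h' => h (by rw [← h']; simp)
      simp [this]
  { toFun := fun v => f fun i => F fun j => v (e (i, j))
    map_update_add' := by
      intro inst v a x y
      rw [Subsingleton.elim inst (instDecidableEqFin _), key, key, key,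
        F.map_update_add, f.map_update_add]
    map_update_smul' := by
      intro inst v a c x
      rw [Subsingleton.elim inst (instDecidableEqFin _), key, key,
        F.map_update_smul, f.map_update_smul]
    cont := by fun_prop }

/-- The `2k`-form `f(F, …, F)` of a `𝔤`-valued two-form `F`:
`f(F, …, F)(v₀, …) = 2⁻ᵏ ∑_σ sgn(σ) f(F(v_{σ 0}, v_{σ 1}), …, F(v_{σ(2k-2)}, v_{σ(2k-1)}))`. -/
def polyForm {k n : ℕ} (f : InvariantPolynomial d G k) (F : 𝔼 n [⋀^Fin 2]→L[ℝ] LieAlg d) :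
    𝔼 n [⋀^Fin (2 * k)]→L[ℝ] ℝ :=
  ((2 : ℝ) ^ k)⁻¹ • ContinuousMultilinearMap.alternatization (polyMultilinear f.toMap F)

end LieGroup

section Diffeology

lemma exists_smooth_retract {n : ℕ} {u : Set (𝔼 n)} (hu : IsOpen u) {x : 𝔼 n} (hx : x ∈ u) :
    ∃ f : 𝔼 n → 𝔼 n, ContDiff ℝ ∞ f ∧ (∀ y, f y ∈ u) ∧ ∀ᶠ y in 𝓝 x, f y = y := by
  obtain ⟨ε, hε, hεu⟩ := Metric.isOpen_iff.1 hu x hx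
  let χ : ContDiffBump x := ⟨ε / 2, ε, by positivity, by linarith⟩
  refine ⟨fun y => x + χ y • (y - x), ?_, fun y => hεu ?_, ?_⟩
  · exact contDiff_const.add (χ.contDiff.smul (contDiff_id.sub contDiff_const))
  · rw [Metric.mem_ball, dist_eq_norm, add_sub_cancel_left, norm_smul, Real.norm_eq_abs,
      abs_of_nonneg χ.nonneg]
    by_cases hy : dist y x < ε
    · rw [dist_eq_norm] at hy
      exact (mul_le_of_le_one_left (norm_nonneg _) χ.le_one).trans_lt hy
    · rw [χ.zero_of_le_dist (not_lt.1 hy), zero_mul]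
      exact hε
  · filter_upwards [χ.eventuallyEq_one] with y hy
    rw [hy]
    simp

lemma locality_contMDiff {E : Type*} [NormedAddCommGroup E] [NormedSpace ℝ E]
    {H : Type*} [TopologicalSpace H] {I : ModelWithCorners ℝ E H}
    {X : Type*} [TopologicalSpace X] [ChartedSpace H X]
    {E' : Type*} [NormedAddCommGroup E'] [NormedSpace ℝ E']
    {H' : Type*} [TopologicalSpace H'] {J : ModelWithCorners ℝ E' H'}
    {Y : Type*} [TopologicalSpace Y] [ChartedSpace H' Y] {n : ℕ} {p : 𝔼 n × Y → X}
    (hp : ∀ x : 𝔼 n, ∃ u : Set (𝔼 n), IsOpen u ∧ x ∈ u ∧ ∀ {m : ℕ} {f : 𝔼 m → 𝔼 n},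
      (∀ x, f x ∈ u) → ContDiff ℝ ∞ f →
        ContMDiff ((𝓡 m).prod J) I ∞ (fun y : 𝔼 m × Y => p (f y.1, y.2))) :
    ContMDiff ((𝓡 n).prod J) I ∞ p := by
  rintro ⟨x, y⟩
  obtain ⟨u, hu, hxu, h⟩ := hp x
  obtain ⟨f, hf, hfu, hfx⟩ := exists_smooth_retract hu hxu
  refine (h hfu hf (x, y)).congr_of_eventuallyEq ?_
  have : ∀ᶠ z : 𝔼 n × Y in 𝓝 (x, y), f z.1 = z.1 := (continuous_fst.tendsto (x, y)).eventually hfx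
  filter_upwards [this] with z hz
  rw [hz]

/-- The standard diffeology of a manifold: the plots are the smooth maps `ℝⁿ → X`. -/
@[reducible]
def manifoldDiffeology {E : Type*} [NormedAddCommGroup E] [NormedSpace ℝ E]
    {H : Type*} [TopologicalSpace H] (I : ModelWithCorners ℝ E H)
    (X : Type*) [TopologicalSpace X] [ChartedSpace H X] : DiffeologicalSpace X where
  plots n := {p | ContMDiff (𝓡 n) I ∞ p}
  constant_plots _ := contMDiff_const
  plot_reparam hp hf := hp.comp hf.contMDiff
  locality {n p} hp := by
    intro x
    obtain ⟨u, hu, hxu, h⟩ := hp x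
    obtain ⟨f, hf, hfu, hfx⟩ := exists_smooth_retract hu hxu
    refine (h hfu hf x).congr_of_eventuallyEq ?_
    filter_upwards [hfx] with y hy
    simp [hy]

variable (d : ℕ) (G : Type*) [TopologicalSpace G] [ChartedSpace (𝔼 d) G] [Group G]
  [LieGroup (𝓡 d) ∞ G]

/-- The based loop group `ΩG`: smooth maps `S¹ → G` with value `1` at the base point. The circle
`S¹ = ℝ/2πℤ` is `Circle`, with angular coordinate `Circle.exp` and base point `1 = Circle.exp 0`. -/
def loopSubgroup : Subgroup C^∞⟮𝓡 1, Circle; 𝓡 d, G⟯ where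
  carrier := {γ | γ 1 = 1}
  one_mem' := rfl
  mul_mem' {a b} ha hb := by
    change a 1 * b 1 = 1
    rw [show a 1 = 1 from ha, show b 1 = 1 from hb, one_mul]
  inv_mem' {a} ha := by
    change (a 1)⁻¹ = 1
    rw [show a 1 = 1 from ha, inv_one]

/-- The based loop group `ΩG` as a type. -/
abbrev LoopGroup : Type _ := loopSubgroup d G

variable {d G} in
/-- Evaluation of a loop at a point of the circle. -/
def LoopGroup.eval (γ : LoopGroup d G) (θ : Circle) : G := γ.1 θ

/-- The smooth structure of `ΩG`: a map `p : ℝⁿ → ΩG` is smooth iff `(u, θ) ↦ p(u)(θ)` is a smooth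
map `ℝⁿ × S¹ → G`. -/
@[reducible]
def loopDiffeology : DiffeologicalSpace (LoopGroup d G) where
  plots n := {p | ContMDiff ((𝓡 n).prod (𝓡 1)) (𝓡 d) ∞ fun x : 𝔼 n × Circle => (p x.1).eval x.2}
  constant_plots γ := γ.1.contMDiff.comp contMDiff_snd
  plot_reparam hp hf :=
    hp.comp ((hf.contMDiff.comp contMDiff_fst).prodMk contMDiff_snd)
  locality {n p} hp :=
    locality_contMDiff (p := fun x : 𝔼 n × Circle => (p x.1).eval x.2) hp

/-- The Lie algebra `Ω𝔤` of `ΩG`: smooth maps `S¹ → 𝔤` with value `0` at the base point. -/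
def loopAlgSubmodule : Submodule ℝ C^∞⟮𝓡 1, Circle; 𝓡 d, LieAlg d⟯ where
  carrier := {X | X 1 = 0}
  zero_mem' := rfl
  add_mem' {a b} ha hb := by
    change a 1 + b 1 = 0
    rw [show a 1 = 0 from ha, show b 1 = 0 from hb, add_zero]
  smul_mem' c a ha := by
    change c • a 1 = 0
    rw [show a 1 = 0 from ha, smul_zero]

/-- The Lie algebra `Ω𝔤` as a type. -/
abbrev LoopAlg : Type := loopAlgSubmodule d

end Diffeology

section Bundles

/-- A smooth principal `H`-bundle over `X`, for `H` and `X` with given smooth structures (in the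
sense of smooth maps from Euclidean spaces into them, i.e. diffeologies): a space `Total` with a
smooth right action of `H` and a smooth invariant projection to `X`, which is locally on `X`
equivariantly diffeomorphic to `U × H`. The local diffeomorphism is `(y, h) ↦ s(y)h`, with inverse
`q ↦ (π(q), τ(q))`. -/
structure PrincipalBundle.{u, v, w} (H : Type u) [Group H] (dH : DiffeologicalSpace H)
    (X : Type v) [TopologicalSpace X] (dX : DiffeologicalSpace X) where
  Total : Type w
  diffeology : DiffeologicalSpace Total
  proj : Total → X
  act : Total → H → Total
  act_one : ∀ q, act q 1 = q
  act_mul : ∀ q a b, act q (a * b) = act (act q a) b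
  proj_act : ∀ q a, proj (act q a) = proj q
  proj_smooth : ∀ {n : ℕ} {p : 𝔼 n → Total}, p ∈ diffeology.plots n →
    (fun u => proj (p u)) ∈ dX.plots n
  act_smooth : ∀ {n : ℕ} {p : 𝔼 n → Total} {a : 𝔼 n → H}, p ∈ diffeology.plots n →
    a ∈ dH.plots n → (fun u => act (p u) (a u)) ∈ diffeology.plots n
  locally_trivial : ∀ x : X, ∃ (U : Set X) (s : X → Total) (τ : Total → H), IsOpen U ∧ x ∈ U ∧
    (∀ y ∈ U, proj (s y) = y) ∧
    (∀ q, proj q ∈ U → act (s (proj q)) (τ q) = q) ∧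
    (∀ y ∈ U, ∀ a, τ (act (s y) a) = a) ∧
    (∀ {n : ℕ} {p : 𝔼 n → X}, p ∈ dX.plots n → (∀ u, p u ∈ U) →
      (fun u => s (p u)) ∈ diffeology.plots n) ∧
    (∀ {n : ℕ} {p : 𝔼 n → Total}, p ∈ diffeology.plots n → (∀ u, proj (p u) ∈ U) →
      (fun u => τ (p u)) ∈ dH.plots n)

section Pullback

variable {H : Type*} [Group H] {dH : DiffeologicalSpace H}
  {X : Type*} [TopologicalSpace X] {dX : DiffeologicalSpace X}
  {Y : Type*} [TopologicalSpace Y] {dY : DiffeologicalSpace Y}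

/-- A map of principal `H`-bundles `Q → P` covering `ψ : Y → X`. -/
structure BundleMap (Q : PrincipalBundle H dH Y dY) (P : PrincipalBundle H dH X dX) (ψ : Y → X) where
  toFun : Q.Total → P.Total
  smooth : ∀ {n : ℕ} {p : 𝔼 n → Q.Total}, p ∈ Q.diffeology.plots n →
    (fun u => toFun (p u)) ∈ P.diffeology.plots n
  equivariant : ∀ q a, toFun (Q.act q a) = P.act (toFun q) a
  covers : ∀ q, P.proj (toFun q) = ψ (Q.proj q)

/-- The pullback bundle `ψ^*P = {(y, q) | ψ(y) = π(q)}`. -/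
def PrincipalBundle.pullback (P : PrincipalBundle H dH X dX) (ψ : Y → X) (hψ : Continuous ψ)
    (hψ' : ∀ {n : ℕ} {p : 𝔼 n → Y}, p ∈ dY.plots n → (fun u => ψ (p u)) ∈ dX.plots n) :
    PrincipalBundle H dH Y dY where
  Total := {z : Y × P.Total // ψ z.1 = P.proj z.2}
  diffeology :=
    { plots := fun n => {p | (fun u => (p u).1.1) ∈ dY.plots n ∧
        (fun u => (p u).1.2) ∈ P.diffeology.plots n}
      constant_plots := fun z => ⟨dY.constant_plots _, P.diffeology.constant_plots _⟩
      plot_reparam := fun hp hf => ⟨dY.plot_reparam hp.1 hf, P.diffeology.plot_reparam hp.2 hf⟩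
      locality := fun hp => ⟨dY.locality fun x => by
          obtain ⟨u, hu, hx, h⟩ := hp x
          exact ⟨u, hu, hx, fun h1 h2 => (h h1 h2).1⟩,
        P.diffeology.locality fun x => by
          obtain ⟨u, hu, hx, h⟩ := hp x
          exact ⟨u, hu, hx, fun h1 h2 => (h h1 h2).2⟩⟩ }
  proj z := z.1.1
  act z a := ⟨(z.1.1, P.act z.1.2 a), by rw [P.proj_act]; exact z.2⟩
  act_one z := Subtype.ext (Prod.ext rfl (P.act_one _))
  act_mul z a b := Subtype.ext (Prod.ext rfl (P.act_mul _ a b))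
  proj_act _ _ := rfl
  proj_smooth hp := hp.1
  act_smooth hp ha := ⟨hp.1, P.act_smooth hp.2 ha⟩
  locally_trivial y₀ := by
    classical
    obtain ⟨U, s, τ, hU, hy, h1, h2, h3, h4, h5⟩ := P.locally_trivial (ψ y₀)
    refine ⟨ψ ⁻¹' U, fun y => if h : ψ y ∈ U then ⟨(y, s (ψ y)), (h1 _ h).symm⟩ else
      ⟨(y₀, s (ψ y₀)), (h1 _ hy).symm⟩, fun z => τ z.1.2, hU.preimage hψ, hy, ?_, ?_, ?_, ?_, ?_⟩
    · intro y hy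
      simp [show ψ y ∈ U from hy]
    · rintro ⟨⟨y, q⟩, hz⟩ hy
      have hz' : ψ y = P.proj q := hz
      have hy' : ψ y ∈ U := hy
      have h6 := h2 q (hz' ▸ hy')
      apply Subtype.ext
      simp only [hy', dif_pos]
      rw [hz', h6]
    · intro y hy a
      have hy' : ψ y ∈ U := hy
      simp only [hy', dif_pos]
      exact h3 _ hy' a
    · intro n p hp hpU
      have hpU' : ∀ u, ψ (p u) ∈ U := hpU
      simp only [hpU', dif_pos]
      exact ⟨hp, h4 (hψ' hp) hpU'⟩
    · intro n p hp hpU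
      exact h5 hp.2 fun u => by rw [← (p u).2]; exact hpU u

/-- The canonical bundle map `ψ^*P → P`. -/
def PrincipalBundle.pullbackMap (P : PrincipalBundle H dH X dX) (ψ : Y → X) (hψ : Continuous ψ)
    (hψ' : ∀ {n : ℕ} {p : 𝔼 n → Y}, p ∈ dY.plots n → (fun u => ψ (p u)) ∈ dX.plots n) :
    BundleMap (P.pullback ψ hψ hψ') P ψ where
  toFun z := z.1.2
  smooth hp := hp.2
  equivariant _ _ := rfl
  covers z := z.2.symm

end Pullback

end Bundles

section Caloron

variable {d : ℕ} {G : Type*} [TopologicalSpace G] [ChartedSpace (𝔼 d) G] [Group G]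
  [LieGroup (𝓡 d) ∞ G]

/-- Smooth principal `G`-bundles over a manifold `X`. -/
abbrev GBundle (d : ℕ) (G : Type*) [TopologicalSpace G] [ChartedSpace (𝔼 d) G] [Group G]
    {E : Type*} [NormedAddCommGroup E] [NormedSpace ℝ E] {H : Type*} [TopologicalSpace H]
    (I : ModelWithCorners ℝ E H) (X : Type*) [TopologicalSpace X] [ChartedSpace H X] :=
  PrincipalBundle G (manifoldDiffeology (𝓡 d) G) X (manifoldDiffeology I X)

/-- Smooth principal `ΩG`-bundles over an `m`-dimensional manifold `M`. -/
abbrev LoopBundle (d : ℕ) (G : Type*) [TopologicalSpace G] [ChartedSpace (𝔼 d) G] [Group G]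
    [LieGroup (𝓡 d) ∞ G] (m : ℕ) (M : Type*) [TopologicalSpace M] [ChartedSpace (𝔼 m) M] :=
  PrincipalBundle (LoopGroup d G) (loopDiffeology d G) M (manifoldDiffeology (𝓡 m) M)

variable {m : ℕ} {M : Type*} [TopologicalSpace M] [ChartedSpace (𝔼 m) M]

lemma PrincipalBundle.tau_act {H : Type*} [Group H] {dH : DiffeologicalSpace H}
    {X : Type*} [TopologicalSpace X] {dX : DiffeologicalSpace X} (P : PrincipalBundle H dH X dX)
    {U : Set X} {s : X → P.Total} {τ : P.Total → H}
    (h2 : ∀ q, P.proj q ∈ U → P.act (s (P.proj q)) (τ q) = q)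
    (h3 : ∀ y ∈ U, ∀ a, τ (P.act (s y) a) = a) {q : P.Total} (hq : P.proj q ∈ U) (a : H) :
    τ (P.act q a) = τ q * a := by
  conv_lhs => rw [← h2 q hq, ← P.act_mul]
  exact h3 _ hq _

/-- The relation `(p, g, θ) ∼ (pγ, γ(θ)⁻¹g, θ)`, `γ ∈ ΩG`, on `P × G × S¹`. -/
def caloronSetoid (P : LoopBundle d G m M) : Setoid (P.Total × G × Circle) where
  r x y := ∃ γ : LoopGroup d G, y = (P.act x.1 γ, (γ.eval x.2.2)⁻¹ * x.2.1, x.2.2)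
  iseqv :=
    { refl := fun x => ⟨1, by
        rw [P.act_one, show (1 : LoopGroup d G).eval x.2.2 = 1 from rfl, inv_one, one_mul]⟩
      symm := by
        rintro x _ ⟨γ, rfl⟩
        refine ⟨γ⁻¹, ?_⟩
        rw [← P.act_mul, mul_inv_cancel, P.act_one,
          show (γ⁻¹).eval x.2.2 = (γ.eval x.2.2)⁻¹ from rfl, inv_inv, mul_inv_cancel_left]
      trans := by
        rintro x _ _ ⟨γ, rfl⟩ ⟨δ, rfl⟩
        refine ⟨γ * δ, ?_⟩
        rw [P.act_mul, show (γ * δ).eval x.2.2 = γ.eval x.2.2 * δ.eval x.2.2 from rfl,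
          mul_inv_rev, mul_assoc] }

/-- The total space `(P × G × S¹)/ΩG` of the caloron transform. -/
def CaloronTotal (P : LoopBundle d G m M) := Quotient (caloronSetoid P)

/-- The class `[p, g, θ]`. -/
def CaloronTotal.mk (P : LoopBundle d G m M) (p : P.Total) (g : G) (θ : Circle) :
    CaloronTotal P := Quotient.mk (caloronSetoid P) (p, g, θ)

lemma CaloronTotal.mk_act (P : LoopBundle d G m M) (p : P.Total) (g : G) (θ : Circle)
    (γ : LoopGroup d G) :
    CaloronTotal.mk P (P.act p γ) g θ = CaloronTotal.mk P p (γ.eval θ * g) θ :=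
  (Quotient.sound (s := caloronSetoid P) ⟨γ, by simp⟩ :
    Quotient.mk (caloronSetoid P) (p, γ.eval θ * g, θ) =
      Quotient.mk (caloronSetoid P) (P.act p γ, g, θ)).symm

/-- The quotient diffeology: a map into `(P × G × S¹)/ΩG` is smooth iff it locally lifts to a
smooth map into `P × G × S¹`. -/
@[reducible]
def caloronDiffeology (P : LoopBundle d G m M) : DiffeologicalSpace (CaloronTotal P) where
  plots n := {p | ∀ x, ∃ a ∈ P.diffeology.plots n, ∃ g : 𝔼 n → G, ∃ θ : 𝔼 n → Circle,
    ContMDiff (𝓡 n) (𝓡 d) ∞ g ∧ ContMDiff (𝓡 n) (𝓡 1) ∞ θ ∧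
      ∀ᶠ y in 𝓝 x, p y = CaloronTotal.mk P (a y) (g y) (θ y)}
  constant_plots {n} z := by
    obtain ⟨⟨p, g, θ⟩, rfl⟩ := Quotient.exists_rep z
    exact fun x => ⟨fun _ => p, P.diffeology.constant_plots p, fun _ => g, fun _ => θ,
      contMDiff_const, contMDiff_const, Eventually.of_forall fun _ => rfl⟩
  plot_reparam {n k p f} hp hf := fun x => by
    obtain ⟨a, ha, g, θ, hg, hθ, h⟩ := hp (f x)
    exact ⟨a ∘ f, P.diffeology.plot_reparam ha hf, g ∘ f, θ ∘ f, hg.comp hf.contMDiff,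
      hθ.comp hf.contMDiff, hf.continuous.continuousAt.eventually h⟩
  locality {n p} hp := fun x => by
    obtain ⟨u, hu, hxu, h⟩ := hp x
    obtain ⟨f, hf, hfu, hfx⟩ := exists_smooth_retract hu hxu
    obtain ⟨a, ha, g, θ, hg, hθ, h'⟩ := h hfu hf x
    refine ⟨a, ha, g, θ, hg, hθ, ?_⟩
    filter_upwards [hfx, h'] with y hy hy'
    rw [← hy', Function.comp_apply, hy]

lemma contMDiff_eval {n : ℕ} {γ : 𝔼 n → LoopGroup d G} (hγ : γ ∈ (loopDiffeology d G).plots n)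
    {θ : 𝔼 n → Circle} (hθ : ContMDiff (𝓡 n) (𝓡 1) ∞ θ) :
    ContMDiff (𝓡 n) (𝓡 d) ∞ fun u => (γ u).eval (θ u) :=
  ContMDiff.comp (show ContMDiff ((𝓡 n).prod (𝓡 1)) (𝓡 d) ∞
    fun x : 𝔼 n × Circle => (γ x.1).eval x.2 from hγ) (contMDiff_id.prodMk hθ)

/-- The caloron transform `𝒞(P) = (P × G × S¹)/ΩG` of an `ΩG`-bundle `P → M`: the principal
`G`-bundle over `M × S¹` with action `[p, g, θ]h = [p, gh, θ]` and projection
`[p, g, θ] ↦ (π(p), θ)`. -/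
def caloronBundle (P : LoopBundle d G m M) :
    GBundle d G ((𝓡 m).prod (𝓡 1)) (M × Circle) where
  Total := CaloronTotal P
  diffeology := caloronDiffeology P
  proj := Quotient.lift (fun x => (P.proj x.1, x.2.2)) (by
    rintro x _ ⟨γ, rfl⟩
    rw [P.proj_act])
  act z h := Quotient.map' (s₁ := caloronSetoid P) (s₂ := caloronSetoid P)
    (fun x => (x.1, x.2.1 * h, x.2.2)) (by
      rintro x _ ⟨γ, rfl⟩
      exact ⟨γ, by simp [mul_assoc]⟩) z
  act_one z := by
    obtain ⟨⟨p, g, θ⟩, rfl⟩ := Quotient.exists_rep z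
    exact congrArg (fun g => CaloronTotal.mk P p g θ) (mul_one g)
  act_mul z a b := by
    obtain ⟨⟨p, g, θ⟩, rfl⟩ := Quotient.exists_rep z
    exact congrArg (fun g => CaloronTotal.mk P p g θ) (mul_assoc g a b).symm
  proj_act z a := by
    obtain ⟨⟨p, g, θ⟩, rfl⟩ := Quotient.exists_rep z
    rfl
  proj_smooth {n p} hp := fun x => by
    obtain ⟨a, ha, g, θ, hg, hθ, h⟩ := hp x
    have h1 : ContMDiff (𝓡 n) (𝓡 m) ∞ (fun u => P.proj (a u)) := P.proj_smooth ha
    refine ((h1.prodMk hθ) x).congr_of_eventuallyEq ?_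
    filter_upwards [h] with y hy
    rw [hy]
    rfl
  act_smooth {n p b} hp hb := fun x => by
    obtain ⟨a, ha, g, θ, hg, hθ, h⟩ := hp x
    refine ⟨a, ha, fun u => g u * b u, θ, hg.mul hb, hθ, ?_⟩
    filter_upwards [h] with y hy
    rw [hy]
    rfl
  locally_trivial := by
    rintro ⟨x, θ₀⟩
    obtain ⟨U, s, τ, hU, hx, h1, h2, h3, h4, h5⟩ := P.locally_trivial x
    have hτ (p : P.Total) (g : G) (θ : Circle) (hp : P.proj p ∈ U) :
        (τ (Quotient.out (CaloronTotal.mk P p g θ)).1).eval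
            (Quotient.out (CaloronTotal.mk P p g θ)).2.2 *
          (Quotient.out (CaloronTotal.mk P p g θ)).2.1 = (τ p).eval θ * g := by
      obtain ⟨γ, hγ⟩ : ∃ γ : LoopGroup d G, Quotient.out (CaloronTotal.mk P p g θ) =
          (P.act p γ, (γ.eval θ)⁻¹ * g, θ) :=
        (caloronSetoid P).symm (Quotient.exact (Quotient.out_eq (CaloronTotal.mk P p g θ)))
      rw [hγ]
      simp only [P.tau_act h2 h3 hp]
      rw [show (τ p * γ).eval θ = (τ p).eval θ * γ.eval θ from rfl, mul_assoc,
        mul_inv_cancel_left]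
    refine ⟨U ×ˢ univ, fun y => CaloronTotal.mk P (s y.1) 1 y.2,
      fun z => (τ (Quotient.out z).1).eval (Quotient.out z).2.2 * (Quotient.out z).2.1,
      hU.prod isOpen_univ, ⟨hx, mem_univ _⟩, ?_, ?_, ?_, ?_, ?_⟩
    · rintro ⟨y, θ⟩ hy
      exact Prod.ext (h1 y hy.1) rfl
    · intro z hz
      obtain ⟨⟨p, g, θ⟩, rfl⟩ := Quotient.exists_rep z
      have hp : P.proj p ∈ U := hz.1
      refine Eq.trans ?_ (congrArg (fun q => CaloronTotal.mk P q g θ) (h2 p hp))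
      rw [CaloronTotal.mk_act]
      refine congrArg (fun g => CaloronTotal.mk P (s (P.proj p)) g θ) ?_
      exact (one_mul _).trans (hτ p g θ hp)
    · rintro ⟨y, θ⟩ hy a
      have hy1 := h1 y hy.1
      have h6 := hτ (s y) (1 * a) θ (by rw [hy1]; exact hy.1)
      refine h6.trans ?_
      have h7 : τ (s y) = 1 := by
        have := h3 y hy.1 1
        rwa [P.act_one] at this
      rw [h7, one_mul]
      exact one_mul a
    · intro n p hp hpU
      have hp1 : ContMDiff (𝓡 n) ((𝓡 m).prod (𝓡 1)) ∞ p := hp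
      have hp2 : ContMDiff (𝓡 n) (𝓡 m) ∞ (fun u => (p u).1) := contMDiff_fst.comp hp1
      exact fun x => ⟨fun u => s (p u).1, h4 (p := fun u => (p u).1) hp2 fun u => (hpU u).1,
        fun _ => 1, fun u => (p u).2, contMDiff_const, contMDiff_snd.comp hp1,
        Eventually.of_forall fun _ => rfl⟩
    · intro n p hp hpU x
      obtain ⟨a, ha, g, θ, hg, hθ, h⟩ := hp x
      have hc : ContMDiff (𝓡 n) (𝓡 m) ∞ (fun u => P.proj (a u)) := P.proj_smooth ha
      have hax : P.proj (a x) ∈ U := by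
        have := (hpU x).1
        rw [h.self_of_nhds] at this
        exact this
      obtain ⟨f, hf, hfu, hfx⟩ := exists_smooth_retract (hU.preimage hc.continuous) hax
      have h6 := h5 (P.diffeology.plot_reparam ha hf) hfu
      refine (((contMDiff_eval h6 hθ).mul hg) x).congr_of_eventuallyEq ?_
      filter_upwards [h, hfx] with y hy hy'
      have hyU : P.proj (a y) ∈ U := by
        have := hfu y
        rwa [hy'] at this
      rw [hy, hτ _ _ _ hyU]
      simp only [Pi.mul_apply, Function.comp_apply, hy']

end Caloron

section Connections

variable {d : ℕ} {G : Type*} [TopologicalSpace G] [ChartedSpace (𝔼 d) G] [Group G]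
  [LieGroup (𝓡 d) ∞ G]

/-- A smooth `V`-valued one-form on a diffeological space `X`: a compatible family of pullbacks
`p^*A` to `ℝⁿ` along the smooth maps `p : ℝⁿ → X` (values at maps which are not smooth are junk). -/
structure OneForm (X : Type*) (dX : DiffeologicalSpace X) (V : Type*) [NormedAddCommGroup V]
    [NormedSpace ℝ V] where
  toFun : ∀ {n : ℕ}, (𝔼 n → X) → 𝔼 n → 𝔼 n →L[ℝ] V
  smooth : ∀ {n : ℕ} {p : 𝔼 n → X}, p ∈ dX.plots n → ContDiff ℝ ∞ (toFun p)
  natural : ∀ {n k : ℕ} {p : 𝔼 n → X} {f : 𝔼 k → 𝔼 n}, p ∈ dX.plots n → ContDiff ℝ ∞ f →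
    ∀ u, toFun (p ∘ f) u = (toFun p (f u)).comp (fderiv ℝ f u)

variable {E : Type*} [NormedAddCommGroup E] [NormedSpace ℝ E] {H : Type*} [TopologicalSpace H]
  {I : ModelWithCorners ℝ E H} {X : Type*} [TopologicalSpace X] [ChartedSpace H X]

/-- A `𝔤`-valued one-form `A` on a principal `G`-bundle is a connection if `R_h^*A = ad(h⁻¹)A` for
`h ∈ G` and `A(V_ζ) = ζ` for the vertical vectors `V_ζ = d/dt q c(t)`, where `c` is a curve (or more
generally a map from `ℝⁿ`) in `G` through `1` with velocity `ζ`. -/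
structure IsConnection (Q : GBundle d G I X)
    (A : OneForm Q.Total Q.diffeology (LieAlg d)) : Prop where
  equivariant : ∀ {n : ℕ} {p : 𝔼 n → Q.Total}, p ∈ Q.diffeology.plots n → ∀ (h : G) (u v : 𝔼 n),
    A.toFun (fun w => Q.act (p w) h) u v = Ad d h⁻¹ (A.toFun p u v)
  vertical : ∀ (q : Q.Total) {n : ℕ} {c : 𝔼 n → G}, ContMDiff (𝓡 n) (𝓡 d) ∞ c →
    ∀ u : 𝔼 n, c u = 1 → ∀ v : 𝔼 n,
      A.toFun (fun w => Q.act q (c w)) u v = (mfderiv (𝓡 n) (𝓡 d) c u : 𝔼 n →L[ℝ] LieAlg d) v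

/-- The curvature `F = dA + ½[A, A]`, pulled back along `p : ℝⁿ → Q`. -/
def curvature (Q : GBundle d G I X) (A : OneForm Q.Total Q.diffeology (LieAlg d)) {n : ℕ}
    (p : 𝔼 n → Q.Total) (u : 𝔼 n) : 𝔼 n [⋀^Fin 2]→L[ℝ] LieAlg d :=
  extDeriv (fun w => ContinuousAlternatingMap.ofSubsingleton ℝ (𝔼 n) (LieAlg d) (0 : Fin 1)
    (A.toFun p w)) u + (2 : ℝ)⁻¹ • bracketForm d G (A.toFun p u)

/-- `β` is the Chern-Weil form `cw_f(A)`: the smooth `2k`-form on the base to which the form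
`f(F, …, F)` on the total space descends, i.e. whose pullback to the total space is `f(F, …, F)`. -/
def IsChernWeilForm {k : ℕ} (f : InvariantPolynomial d G k) (Q : GBundle d G I X)
    (A : OneForm Q.Total Q.diffeology (LieAlg d)) (β : MForm E X (2 * k)) : Prop :=
  IsSmoothForm I β ∧ ∀ {n : ℕ} {p : 𝔼 n → Q.Total}, p ∈ Q.diffeology.plots n → ∀ u : 𝔼 n,
    formPullback I (𝓡 n) (fun w => Q.proj (p w)) β u = polyForm f (curvature Q A p u)

open Classical in
/-- The Chern-Weil form `cw_f(A)` (with value `0` if `f(F, …, F)` does not descend). -/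
def chernWeilForm {k : ℕ} (f : InvariantPolynomial d G k) (Q : GBundle d G I X)
    (A : OneForm Q.Total Q.diffeology (LieAlg d)) : MForm E X (2 * k) :=
  if h : ∃ β, IsChernWeilForm f Q A β then h.choose else 0

end Connections

section LoopConnections

variable {d : ℕ} {G : Type*} [TopologicalSpace G] [ChartedSpace (𝔼 d) G] [Group G]
  [LieGroup (𝓡 d) ∞ G]
  {m : ℕ} {M : Type*} [TopologicalSpace M] [ChartedSpace (𝔼 m) M]
  {l : ℕ} {N : Type*} [TopologicalSpace N] [ChartedSpace (𝔼 l) N]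

/-- A connection `A` on an `ΩG`-bundle `P`: a smooth `Ω𝔤`-valued one-form on `P` (given by its
pullbacks to `ℝⁿ` along smooth maps `p : ℝⁿ → P`) with `R_γ^*A = ad(γ⁻¹)A` for `γ ∈ ΩG` and
`A(V_ζ) = ζ` for the vertical vectors `V_ζ = d/dt q c(t)`, where `c` is a curve (or more generally a
map from `ℝⁿ`) in `ΩG` through `1` with velocity `ζ ∈ Ω𝔤`. -/
structure LoopConnection (P : LoopBundle d G m M) where
  toFun : ∀ {n : ℕ}, (𝔼 n → P.Total) → 𝔼 n → 𝔼 n →ₗ[ℝ] LoopAlg d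
  smooth : ∀ {n : ℕ} {p : 𝔼 n → P.Total}, p ∈ P.diffeology.plots n → ∀ v : 𝔼 n,
    ContMDiff ((𝓡 n).prod (𝓡 1)) (𝓡 d) ∞ fun x : 𝔼 n × Circle => (toFun p x.1 v).1 x.2
  natural : ∀ {n k : ℕ} {p : 𝔼 n → P.Total} {f : 𝔼 k → 𝔼 n}, p ∈ P.diffeology.plots n →
    ContDiff ℝ ∞ f → ∀ u v, toFun (p ∘ f) u v = toFun p (f u) (fderiv ℝ f u v)
  equivariant : ∀ {n : ℕ} {p : 𝔼 n → P.Total}, p ∈ P.diffeology.plots n →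
    ∀ (γ : LoopGroup d G) (u v : 𝔼 n) (θ : Circle),
      (toFun (fun w => P.act (p w) γ) u v).1 θ = Ad d (γ.eval θ)⁻¹ ((toFun p u v).1 θ)
  vertical : ∀ (q : P.Total) {n : ℕ} {c : 𝔼 n → LoopGroup d G},
    c ∈ (loopDiffeology d G).plots n → ∀ u : 𝔼 n, c u = 1 → ∀ (v : 𝔼 n) (θ : Circle),
      (toFun (fun w => P.act q (c w)) u v).1 θ =
        (mfderiv (𝓡 n) (𝓡 d) (fun w => (c w).eval θ) u : 𝔼 n →L[ℝ] LieAlg d) v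

/-- The loop `γ⁻¹∂γ : S¹ → 𝔤`, where `∂` is differentiation with respect to the angle. -/
def logDeriv (γ : LoopGroup d G) (θ : Circle) : LieAlg d :=
  (mfderiv 𝓘(ℝ, ℝ) (𝓡 d) (fun t : ℝ => (γ.eval θ)⁻¹ * γ.eval (θ * Circle.exp t)) 0 :
    ℝ →L[ℝ] LieAlg d) 1

/-- A Higgs field on an `ΩG`-bundle `P`: a smooth map `Φ` from `P` to the smooth maps `S¹ → 𝔤` with
`Φ(pγ) = ad(γ⁻¹)Φ(p) + γ⁻¹∂γ`. -/
structure HiggsField (P : LoopBundle d G m M) where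
  toFun : P.Total → C^∞⟮𝓡 1, Circle; 𝓡 d, LieAlg d⟯
  smooth : ∀ {n : ℕ} {p : 𝔼 n → P.Total}, p ∈ P.diffeology.plots n →
    ContMDiff ((𝓡 n).prod (𝓡 1)) (𝓡 d) ∞ fun x : 𝔼 n × Circle => toFun (p x.1) x.2
  equivariant : ∀ (q : P.Total) (γ : LoopGroup d G) (θ : Circle),
    toFun (P.act q γ) θ = Ad d (γ.eval θ)⁻¹ (toFun q θ) + logDeriv γ θ

/-- The pullback of a connection along a bundle map. -/
def LoopConnection.pullback {P : LoopBundle d G m M} {Q : LoopBundle d G l N} {ψ : N → M}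
    (A : LoopConnection P) (F : BundleMap Q P ψ) : LoopConnection Q where
  toFun p := A.toFun (F.toFun ∘ p)
  smooth hp := A.smooth (F.smooth hp)
  natural hp hf := A.natural (F.smooth hp) hf
  equivariant {n p} hp γ u v θ := by
    have : (F.toFun ∘ fun w => Q.act (p w) γ) = fun w => P.act (F.toFun (p w)) γ :=
      funext fun w => F.equivariant _ _
    rw [this]
    exact A.equivariant (F.smooth hp) γ u v θ
  vertical q n c hc u hu v θ := by
    have : (F.toFun ∘ fun w => Q.act q (c w)) = fun w => P.act (F.toFun q) (c w) :=
      funext fun w => F.equivariant _ _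
    rw [this]
    exact A.vertical (F.toFun q) hc u hu v θ

/-- The pullback of a Higgs field along a bundle map. -/
def HiggsField.pullback {P : LoopBundle d G m M} {Q : LoopBundle d G l N} {ψ : N → M}
    (Φ : HiggsField P) (F : BundleMap Q P ψ) : HiggsField Q where
  toFun q := Φ.toFun (F.toFun q)
  smooth hp := Φ.smooth (F.smooth hp)
  equivariant q γ θ := by rw [F.equivariant]; exact Φ.equivariant _ γ θ

/-- The pullback `θ^*dθ` of the angular form of the circle along `θ : ℝⁿ → S¹`: if locally
`θ = exp(i a)` then this is `da`. -/
def angularForm {n : ℕ} (θ : 𝔼 n → Circle) (u v : 𝔼 n) : ℝ :=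
  ((starRingEnd ℂ) (θ u : ℂ) * fderiv ℝ (fun w => (θ w : ℂ)) u v).im

/-- `B` is the caloron transform `Ã` of `(A, Φ)`: the one-form on `𝒞(P) = (P × G × S¹)/ΩG` to which
`ad(g⁻¹)A(θ) + Θ + ad(g⁻¹)Φ dθ` descends from `P × G × S¹`. -/
def IsCaloronForm {P : LoopBundle d G m M} (A : LoopConnection P) (Φ : HiggsField P)
    (B : OneForm (caloronBundle P).Total (caloronBundle P).diffeology (LieAlg d)) : Prop :=
  ∀ {n : ℕ} {p : 𝔼 n → P.Total} {g : 𝔼 n → G} {θ : 𝔼 n → Circle}, p ∈ P.diffeology.plots n →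
    ContMDiff (𝓡 n) (𝓡 d) ∞ g → ContMDiff (𝓡 n) (𝓡 1) ∞ θ → ∀ u v : 𝔼 n,
      B.toFun (fun w => CaloronTotal.mk P (p w) (g w) (θ w)) u v =
        Ad d (g u)⁻¹ ((A.toFun p u v).1 (θ u)) + maurerCartan d g u v +
          angularForm θ u v • Ad d (g u)⁻¹ (Φ.toFun (p u) (θ u))

open Classical in
/-- The caloron transform connection `Ã` of `(A, Φ)` (with value `0` if it does not exist). -/
def caloronForm {P : LoopBundle d G m M} (A : LoopConnection P) (Φ : HiggsField P) :
    OneForm (caloronBundle P).Total (caloronBundle P).diffeology (LieAlg d) :=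
  if h : ∃ B, IsCaloronForm A Φ B then h.choose else
    { toFun := fun _ _ => 0
      smooth := fun _ => contDiff_const
      natural := fun _ _ _ => rfl }

/-- The contraction of a form on `M × S¹` with `∂_θ` at `(x, exp(it))`, restricted to `T_xM`. The
vector `∂_θ` is inserted in the last slot, which is `(-1)^q` times its insertion in the first. -/
def fiberContraction {q : ℕ} (β : MForm (𝔼 m × 𝔼 1) (M × Circle) (q + 1)) (x : M) (t : ℝ) :
    𝔼 m [⋀^Fin q]→L[ℝ] ℝ :=
  (-1 : ℝ) ^ q • ((β (x, Circle.exp t)).curryLeft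
      ((mfderiv 𝓘(ℝ, ℝ) ((𝓡 m).prod (𝓡 1)) (fun s : ℝ => (x, Circle.exp s)) t :
        ℝ →L[ℝ] 𝔼 m × 𝔼 1) 1)).compContinuousLinearMap
    (mfderiv (𝓡 m) ((𝓡 m).prod (𝓡 1)) (fun y : M => (y, Circle.exp t)) x :
      𝔼 m →L[ℝ] 𝔼 m × 𝔼 1)

/-- Integration over the fibre `∫_{S¹} : Ω^{q+1}(M × S¹) → Ω^q(M)`, normalised by
`∫_{S¹} α ∧ c dθ = α ∫_{S¹} c dθ`. -/
def fiberIntegral {q : ℕ} (β : MForm (𝔼 m × 𝔼 1) (M × Circle) (q + 1)) : MForm (𝔼 m) M q :=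
  fun x => ∫ t in (0 : ℝ)..(2 * Real.pi), fiberContraction β x t

/-- The string form `s_f(A, Φ) = ∫_{S¹} cw_f(Ã) ∈ Ω^{2k+1}(M)`, for `f ∈ I^{k+1}(𝔤)`. -/
def stringForm {k : ℕ} (f : InvariantPolynomial d G (k + 1)) {P : LoopBundle d G m M}
    (A : LoopConnection P) (Φ : HiggsField P) : MForm (𝔼 m) M (2 * k + 1) :=
  fiberIntegral (chernWeilForm f (caloronBundle P) (caloronForm A Φ))

open Classical in
/-- The string class `s_f(P) ∈ H^{2k+1}(M)`, for `f ∈ I^{k+1}(𝔤)`: the de Rham class of `s_f(A, Φ)`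
for a choice of connection `A` and Higgs field `Φ` (with value `0` if there are none). -/
def stringClass [IsManifold (𝓡 m) ∞ M] {k : ℕ} (f : InvariantPolynomial d G (k + 1))
    (P : LoopBundle d G m M) : DeRham (𝓡 m) M (2 * k + 1) :=
  if h : Nonempty (LoopConnection P × HiggsField P) then
    deRhamClass (𝓡 m) (stringForm f h.some.1 h.some.2) else 0

/-- The pullback `ψ^*P` of an `ΩG`-bundle along a smooth map `ψ : N → M`. -/
def LoopBundle.pullback (P : LoopBundle d G m M) (ψ : C^∞⟮𝓡 l, N; 𝓡 m, M⟯) :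
    LoopBundle d G l N :=
  PrincipalBundle.pullback P ψ ψ.contMDiff.continuous fun hp => ψ.contMDiff.comp hp

/-- The canonical bundle map `ψ^*P → P`. -/
def LoopBundle.pullbackMap (P : LoopBundle d G m M) (ψ : C^∞⟮𝓡 l, N; 𝓡 m, M⟯) :
    BundleMap (LoopBundle.pullback P ψ) P ψ :=
  PrincipalBundle.pullbackMap P ψ ψ.contMDiff.continuous fun hp => ψ.contMDiff.comp hp

end LoopConnections

end Caloron

end

open Caloron

/-! All smooth structures are tested on maps from Euclidean spaces, so a form on `P`, on `P × G ×
S¹` or on the caloron transform is a compatible family of forms on the spaces `𝔼 n`. Every identity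
thereby becomes calculus on `𝔼 n` with the pulled back Maurer–Cartan form `mc d g = g⁻¹dg`. Two
facts about `G` carry this calculus: the product rule `mc_mul` and the structure equation
`fderiv_mc_sub`. The latter, applied to a product of two maps, also yields the derivative of the
adjoint action (`fderiv_Ad_inv`).

Descent. Under `(p, g, θ) ↦ (pγ, γ(θ)⁻¹g, θ)` the connection contributes the differential of `γ` at
fixed angle, the Higgs field contributes `γ⁻¹∂γ dθ`, and the Maurer–Cartan term contributes minus
the differential of `γ(θ)`, which is exactly the sum of these two (`mc_eval`). So the form is
invariant (`calForm_gauge`). Two lifts of a map into the quotient differ by a smooth family of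
loops, hence the form descends (`calForm_eq_of_mk_eq`).

Chern–Weil theory. A gauge transformation changes the curvature by the adjoint action, so `f(F, …,
F)` does not see it and can be computed through local sections
(`IsConnection.exists_isChernWeilForm`). For closedness a gauge is chosen in which the connection
vanishes at the given point. There the Bianchi identity is the symmetry of second derivatives, and
antisymmetrization kills every term of the Leibniz rule (`extDeriv_polyForm_eq_zero`). Closedness
passes to the base since pullback to the total space is injective on forms (`form_ext`).

Fibre integration. The form is pulled back to `M × ℝ` and integrated over `[0, 2π]`. In the homotopy
formula `integralT_formD` the two boundary terms agree because the angles `0` and `2π` are the same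
point of the circle, so fibre integration commutes with `d` (`fiberIntegral_formD`) and the string
form is closed.

Independence and existence. The line segment joining two caloron connections is a connection on the
pullback of the bundle to the product of its base with `ℝ`. The homotopy formula over `[0, 1]` makes
the difference of the Chern–Weil forms exact (`exists_formD_eq_sub`), and integration over the
circle transfers this to string forms. Connections and Higgs fields obey affine laws, so local flat
ones can be averaged with a partition of unity (`TrivializingPartition`).

Naturality. A bundle map `F` induces `[q, g, θ] ↦ [F(q), g, θ]`, and the caloron form of the pulled
back data is the pullback of the caloron form. Uniqueness of the descended form then identifies the
Chern–Weil forms (`isChernWeilForm_pullback`), and fibre integration commutes with `ψ × id`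
(`fiberIntegral_pullback`). -/

noncomputable section
open Set Filter Topology
namespace Caloron
set_option linter.unusedSectionVars false

/-! ### Derivatives of maps into `G`, the Maurer–Cartan form and the adjoint action -/

section MaurerCartan

variable {d : ℕ} {G : Type*} [TopologicalSpace G] [ChartedSpace (𝔼 d) G] [Group G]
  {E F : Type*} [NormedAddCommGroup E] [NormedSpace ℝ E]
  [NormedAddCommGroup F] [NormedSpace ℝ F]

/-- The derivative of a map of manifolds, as a linear map between the model spaces. -/
def mder {E₁ H₁ E₂ H₂ : Type*}
    [NormedAddCommGroup E₁] [NormedSpace ℝ E₁] [TopologicalSpace H₁]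
    [NormedAddCommGroup E₂] [NormedSpace ℝ E₂] [TopologicalSpace H₂]
    (I₁ : ModelWithCorners ℝ E₁ H₁) (I₂ : ModelWithCorners ℝ E₂ H₂)
    {M₁ M₂ : Type*} [TopologicalSpace M₁] [ChartedSpace H₁ M₁] [TopologicalSpace M₂]
    [ChartedSpace H₂ M₂] (f : M₁ → M₂) (x : M₁) : E₁ →L[ℝ] E₂ := mfderiv I₁ I₂ f x

section mder

variable {E₁ H₁ E₂ H₂ E₃ H₃ : Type*}
  [NormedAddCommGroup E₁] [NormedSpace ℝ E₁] [TopologicalSpace H₁]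
  [NormedAddCommGroup E₂] [NormedSpace ℝ E₂] [TopologicalSpace H₂]
  [NormedAddCommGroup E₃] [NormedSpace ℝ E₃] [TopologicalSpace H₃]
  {I₁ : ModelWithCorners ℝ E₁ H₁} {I₂ : ModelWithCorners ℝ E₂ H₂}
  {I₃ : ModelWithCorners ℝ E₃ H₃} {M₁ M₂ M₃ : Type*}
  [TopologicalSpace M₁] [ChartedSpace H₁ M₁] [TopologicalSpace M₂] [ChartedSpace H₂ M₂]
  [TopologicalSpace M₃] [ChartedSpace H₃ M₃]

lemma mder_comp {g : M₂ → M₃} {f : M₁ → M₂} {x : M₁} {y : M₂}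
    (hy : f x = y) (hg : MDifferentiableAt I₂ I₃ g y) (hf : MDifferentiableAt I₁ I₂ f x) :
    mder I₁ I₃ (fun z => g (f z)) x = (mder I₂ I₃ g y).comp (mder I₁ I₂ f x) := by
  subst hy
  exact mfderiv_comp x hg hf

lemma mder_congr {f f' : M₁ → M₂} {x : M₁} (h : f =ᶠ[𝓝 x] f') :
    mder I₁ I₂ f x = mder I₁ I₂ f' x := h.mfderiv_eq

lemma mder_const (y : M₂) (x : M₁) : mder I₁ I₂ (fun _ => y) x = 0 := mfderiv_const

lemma mder_id (x : M₁) : mder I₁ I₁ (fun z => z) x = ContinuousLinearMap.id ℝ E₁ := mfderiv_id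

lemma mder_eq_fderiv (f : E₁ → E₂) (x : E₁) : mder 𝓘(ℝ, E₁) 𝓘(ℝ, E₂) f x = fderiv ℝ f x :=
  mfderiv_eq_fderiv

lemma mder_prodMk {f : M₁ → M₂} {g : M₁ → M₃} {x : M₁} (hf : MDifferentiableAt I₁ I₂ f x)
    (hg : MDifferentiableAt I₁ I₃ g x) :
    mder I₁ (I₂.prod I₃) (fun z => (f z, g z)) x = (mder I₁ I₂ f x).prod (mder I₁ I₃ g x) :=
  mfderiv_prodMk hf hg

lemma mder_prod_apply {f : M₁ × M₂ → M₃} {p : M₁ × M₂}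
    (hf : MDifferentiableAt (I₁.prod I₂) I₃ f p) (v : E₁) (w : E₂) :
    mder (I₁.prod I₂) I₃ f p (v, w) =
      mder I₁ I₃ (fun z => f (z, p.2)) p.1 v + mder I₂ I₃ (fun z => f (p.1, z)) p.2 w :=
  mfderiv_prod_eq_add_apply (v := (v, w)) hf

/-- The tangent space at `y` is identified with the model space through the preferred chart at `y`,
so the chart must be the one at the value `f u`. -/
lemma mder_eq_fderiv_chart {y : M₂} {f : E₁ → M₂} {u : E₁} (hu : f u = y)
    (hf : MDifferentiableAt 𝓘(ℝ, E₁) I₂ f u) :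
    mder 𝓘(ℝ, E₁) I₂ f u = fderiv ℝ (fun w => extChartAt I₂ y (f w)) u := by
  subst hu
  rw [mder, hf.mfderiv]
  simp only [writtenInExtChartAt, modelWithCornersSelf_coe, range_id, fderivWithin_univ,
    extChartAt_model_space_eq_id]
  rfl

end mder

/-- The pullback `g⁻¹dg` of the Maurer-Cartan form along a map `g` from a normed space. -/
def mc (d : ℕ) {G : Type*} [TopologicalSpace G] [ChartedSpace (𝔼 d) G] [Group G] (g : E → G)
    (u : E) : E →L[ℝ] LieAlg d := mder 𝓘(ℝ, E) (𝓡 d) (fun w => (g u)⁻¹ * g w) u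

lemma Ad_eq_mder (g : G) : Ad d g = mder (𝓡 d) (𝓡 d) (fun h : G => g * h * g⁻¹) 1 := rfl

variable [LieGroup (𝓡 d) ∞ G]

lemma mdifferentiableAt_mc {g : E → G} {u : E} (hg : MDifferentiableAt 𝓘(ℝ, E) (𝓡 d) g u) :
    MDifferentiableAt 𝓘(ℝ, E) (𝓡 d) (fun w => (g u)⁻¹ * g w) u :=
  MDifferentiableAt.comp u (((contMDiff_mul_left (I := 𝓡 d) (n := ∞) (a := (g u)⁻¹)) _).mdifferentiableAt
    (by simp)) hg

/-- Left translation brings every value to `1`, so a single chart serves for all base points `u`.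
This is what makes the dependence on `u` accessible. -/
lemma mc_eq_fderiv {g : E → G} {u : E} (hg : MDifferentiableAt 𝓘(ℝ, E) (𝓡 d) g u) :
    mc d g u = fderiv ℝ (fun w => extChartAt (𝓡 d) (1 : G) ((g u)⁻¹ * g w)) u :=
  mder_eq_fderiv_chart (by simp) (mdifferentiableAt_mc hg)

lemma mc_congr {g g' : E → G} {u : E} (h : g =ᶠ[𝓝 u] g') : mc d g u = mc d g' u := by
  have h1 : (fun w => (g u)⁻¹ * g w) =ᶠ[𝓝 u] fun w => (g' u)⁻¹ * g' w := by
    filter_upwards [h] with w hw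
    rw [hw, h.self_of_nhds]
  exact h1.mfderiv_eq

lemma mc_const (g : G) (u : E) : mc d (fun _ : E => g) u = 0 := mfderiv_const

lemma mc_mul_left (h : G) (g : E → G) (u : E) : mc d (fun w => h * g w) u = mc d g u := by
  have e : (fun w => (h * g u)⁻¹ * (h * g w)) = fun w => (g u)⁻¹ * g w := by funext w; group
  simp only [mc]
  rw [e]

lemma mc_comp {g : E → G} {f : F → E} {u : F} (hg : MDifferentiableAt 𝓘(ℝ, E) (𝓡 d) g (f u))
    (hf : DifferentiableAt ℝ f u) :
    mc d (fun w => g (f w)) u = (mc d g (f u)).comp (fderiv ℝ f u) := by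
  rw [← mder_eq_fderiv]
  exact mder_comp (g := fun w => (g (f u))⁻¹ * g w) rfl (mdifferentiableAt_mc hg)
    hf.mdifferentiableAt

lemma mdifferentiableAt_conj (g x : G) :
    MDifferentiableAt (𝓡 d) (𝓡 d) (fun h : G => g * h * g⁻¹) x :=
  ((((contMDiff_mul_left (I := 𝓡 d) (n := ∞) (a := g)).mul
    (contMDiff_const (c := g⁻¹)))) x).mdifferentiableAt (by simp)

lemma Ad_one : Ad d (1 : G) = ContinuousLinearMap.id ℝ _ := by
  have h : (fun h : G => 1 * h * 1⁻¹) = id := by funext h; simp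
  rw [Ad_eq_mder, h]
  exact mder_id _

lemma Ad_mul (g h : G) : Ad d (g * h) = (Ad d g).comp (Ad d h) := by
  have := mder_comp (I₁ := 𝓡 d) (I₂ := 𝓡 d) (I₃ := 𝓡 d)
    (g := fun x : G => g * x * g⁻¹) (f := fun x : G => h * x * h⁻¹) (x := 1) (y := 1) (by simp)
    (mdifferentiableAt_conj g 1) (mdifferentiableAt_conj h 1)
  rw [show (fun z => g * (h * z * h⁻¹) * g⁻¹) = fun z => g * h * z * (g * h)⁻¹ by
    funext z; simp [mul_assoc]] at this
  exact this

lemma Ad_Ad_inv (g : G) (X : LieAlg d) : Ad d g (Ad d g⁻¹ X) = X := by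
  rw [← ContinuousLinearMap.comp_apply, ← Ad_mul, mul_inv_cancel, Ad_one]; rfl

/-- The differential of multiplication at `(1, 1)` is addition. -/
lemma mder_mul_of_eq_one {f₁ f₂ : E → G} {u : E} (h₁ : f₁ u = 1) (h₂ : f₂ u = 1)
    (hf₁ : MDifferentiableAt 𝓘(ℝ, E) (𝓡 d) f₁ u) (hf₂ : MDifferentiableAt 𝓘(ℝ, E) (𝓡 d) f₂ u) :
    mder 𝓘(ℝ, E) (𝓡 d) (fun w => f₁ w * f₂ w) u =
      mder 𝓘(ℝ, E) (𝓡 d) f₁ u + mder 𝓘(ℝ, E) (𝓡 d) f₂ u := by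
  have hm : MDifferentiableAt ((𝓡 d).prod (𝓡 d)) (𝓡 d) (fun p : G × G => p.1 * p.2) (1, 1) :=
    (contMDiff_mul (𝓡 d) ∞ (1, 1)).mdifferentiableAt (by simp)
  rw [mder_comp (x := u) (f := fun w => (f₁ w, f₂ w)) (Prod.ext h₁ h₂) hm (hf₁.prodMk hf₂),
    mder_prodMk hf₁ hf₂]
  ext1 v
  refine (mder_prod_apply hm _ _).trans ?_
  simp only [mul_one, one_mul, mder_id]
  rfl

lemma mc_mul {g₁ g₂ : E → G} {u : E} (h₁ : MDifferentiableAt 𝓘(ℝ, E) (𝓡 d) g₁ u)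
    (h₂ : MDifferentiableAt 𝓘(ℝ, E) (𝓡 d) g₂ u) :
    mc d (fun w => g₁ w * g₂ w) u = (Ad d (g₂ u)⁻¹).comp (mc d g₁ u) + mc d g₂ u := by
  -- Regrouped as a product of two factors, each equal to `1` at `w = u`; the first is a conjugate
  -- by `(g₂ u)⁻¹`, whence the adjoint action.
  have e : (fun w => (g₁ u * g₂ u)⁻¹ * (g₁ w * g₂ w)) = fun w =>
      ((g₂ u)⁻¹ * ((g₁ u)⁻¹ * g₁ w) * (g₂ u)⁻¹⁻¹) * ((g₂ u)⁻¹ * g₂ w) := by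
    funext w; group
  simp only [mc]
  rw [e]
  have hc := mder_comp (x := u) (y := 1) (f := fun w => (g₁ u)⁻¹ * g₁ w) (by simp)
    (mdifferentiableAt_conj (d := d) (g₂ u)⁻¹ 1) (mdifferentiableAt_mc h₁)
  refine (mder_mul_of_eq_one (by simp) (by simp) ?_ (mdifferentiableAt_mc h₂)).trans ?_
  · exact MDifferentiableAt.comp u (mdifferentiableAt_conj (d := d) (g₂ u)⁻¹ _)
      (mdifferentiableAt_mc h₁)
  · rw [hc]; rfl

lemma mc_inv {g : E → G} {u : E} (h : MDifferentiableAt 𝓘(ℝ, E) (𝓡 d) g u) :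
    mc d (fun w => (g w)⁻¹) u = -(Ad d (g u)).comp (mc d g u) := by
  have hi : MDifferentiableAt 𝓘(ℝ, E) (𝓡 d) (fun w => (g w)⁻¹) u :=
    MDifferentiableAt.comp u ((contMDiff_inv (𝓡 d) ∞ (g u)).mdifferentiableAt (by simp)) h
  have := mc_mul h hi
  rw [show (fun w => g w * (g w)⁻¹) = fun _ => 1 by funext w; simp, mc_const, inv_inv] at this
  exact (neg_eq_of_add_eq_zero_right this.symm).symm

lemma contDiffAt_extChartAt_one {f : E → G} {u : E} (hu : f u ∈ (chartAt (𝔼 d) (1 : G)).source)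
    (hf : ContMDiffAt 𝓘(ℝ, E) (𝓡 d) ∞ f u) :
    ContDiffAt ℝ ∞ (fun w => extChartAt (𝓡 d) (1 : G) (f w)) u := by
  have : IsManifold (𝓡 d) ∞ G := inferInstance
  rw [← contMDiffAt_iff_contDiffAt]
  exact (contMDiffAt_extChartAt' hu).comp u hf

/-- The map `(u, w) ↦ g(u)⁻¹g(w)`, read in the chart at `1`, is jointly smooth near the diagonal, so
its `w`-derivative on the diagonal is smooth in `u`. -/
lemma contDiff_mc {g : E → G} (hg : ContMDiff 𝓘(ℝ, E) (𝓡 d) ∞ g) : ContDiff ℝ ∞ (mc d g) := by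
  have e : mc d g = fun u => fderiv ℝ (fun w => extChartAt (𝓡 d) (1 : G) ((g u)⁻¹ * g w)) u := by
    funext u; exact mc_eq_fderiv ((hg u).mdifferentiableAt (by simp))
  rw [e, contDiff_iff_contDiffAt]
  intro u
  have h : ContDiffAt ℝ ∞ (Function.uncurry fun u w =>
      extChartAt (𝓡 d) (1 : G) ((g u)⁻¹ * g w)) (u, u) := by
    refine contDiffAt_extChartAt_one (f := fun p : E × E => (g p.1)⁻¹ * g p.2) (by simp) ?_
    -- The smooth structure of `E × E` as a vector space is exchanged for the product structure.
    rw [modelWithCornersSelf_prod, ← chartedSpaceSelf_prod]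
    exact ((hg.comp contMDiff_fst).inv.mul (hg.comp contMDiff_snd)) (u, u)
  exact ContDiffAt.fderiv (n := ∞) h contDiffAt_id (by simp)

/-- In the chart at `1`, conjugation by `g(u)` is jointly smooth in `u` and the point it acts on,
and `Ad` is its derivative in the second variable. -/
lemma contDiff_Ad {g : E → G} (hg : ContMDiff 𝓘(ℝ, E) (𝓡 d) ∞ g) :
    ContDiff ℝ ∞ fun u => Ad d (g u) := by
  have : IsManifold (𝓡 d) ∞ G := inferInstance
  set φ := extChartAt (𝓡 d) (1 : G) with hφ
  have hs : MDifferentiableAt 𝓘(ℝ, 𝔼 d) (𝓡 d) φ.symm (φ 1) :=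
    mdifferentiableAt_extChartAt_symm (mem_extChartAt_target 1)
  have hs1 : φ.symm (φ 1) = 1 := extChartAt_to_inv 1
  have hid : mder 𝓘(ℝ, 𝔼 d) (𝓡 d) φ.symm (φ 1) =
      ContinuousLinearMap.id ℝ _ := by
    rw [mder_eq_fderiv_chart hs1 hs]
    have : (fun w => φ (φ.symm w)) =ᶠ[𝓝 (φ 1)] id := by
      filter_upwards [(isOpen_extChartAt_target (I := 𝓡 d) (1 : G)).mem_nhds
        (mem_extChartAt_target 1)] with w hw
      exact φ.right_inv hw
    rw [this.fderiv_eq, fderiv_id]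
  have e : (fun u => Ad d (g u)) = fun u =>
      fderiv ℝ (fun y => φ (g u * φ.symm y * (g u)⁻¹)) (φ 1) := by
    funext u
    have h1 := mder_comp (x := φ 1) (y := 1) (f := φ.symm) hs1
      (mdifferentiableAt_conj (d := d) (g u) 1) hs
    rw [hid, ContinuousLinearMap.comp_id] at h1
    refine h1.symm.trans (mder_eq_fderiv_chart (by simp [hs1]) ?_)
    exact MDifferentiableAt.comp (φ 1) (mdifferentiableAt_conj (d := d) (g u) _) hs
  rw [e, contDiff_iff_contDiffAt]
  intro u
  have h : ContDiffAt ℝ ∞ (Function.uncurry fun u y => φ (g u * φ.symm y * (g u)⁻¹)) (u, φ 1) := by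
    refine contDiffAt_extChartAt_one (f := fun p : E × 𝔼 d => g p.1 * φ.symm p.2 * (g p.1)⁻¹)
      (by simp [hs1]) ?_
    rw [modelWithCornersSelf_prod, ← chartedSpaceSelf_prod]
    have h2 : ContMDiffAt (𝓘(ℝ, E).prod 𝓘(ℝ, 𝔼 d)) (𝓡 d) ∞ (fun p : E × 𝔼 d => φ.symm p.2)
        (u, φ 1) :=
      ContMDiffAt.comp (u, φ 1) (g := φ.symm) (f := Prod.snd)
        ((contMDiffOn_extChartAt_symm (n := ∞) (1 : G)).contMDiffAt
        ((isOpen_extChartAt_target (1 : G)).mem_nhds (mem_extChartAt_target 1))) contMDiffAt_snd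
    have h3 : ContMDiffAt (𝓘(ℝ, E).prod 𝓘(ℝ, 𝔼 d)) (𝓡 d) ∞ (fun p : E × 𝔼 d => g p.1)
        (u, φ 1) := (hg.comp contMDiff_fst) _
    exact (h3.mul h2).mul h3.inv
  exact ContDiffAt.fderiv (n := ∞) h contDiffAt_const (by simp)

end MaurerCartan

/-! ### The Maurer–Cartan structure equation and the derivative of `Ad` -/

section StructureEquation

variable {d : ℕ} {G : Type*} [TopologicalSpace G] [ChartedSpace (𝔼 d) G] [Group G]
  {E F : Type*} [NormedAddCommGroup E] [NormedSpace ℝ E]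
  [NormedAddCommGroup F] [NormedSpace ℝ F] [LieGroup (𝓡 d) ∞ G]

/-- The preferred chart at `x` is itself the identification of the tangent space at `x` with the
model space. -/
lemma mder_extChartAt_symm {X : Type*} [TopologicalSpace X] [ChartedSpace (𝔼 d) X]
    [IsManifold (𝓡 d) ∞ X] (x : X) :
    mder 𝓘(ℝ, 𝔼 d) (𝓡 d) (extChartAt (𝓡 d) x).symm (extChartAt (𝓡 d) x x) =
      ContinuousLinearMap.id ℝ _ := by
  have hs := mdifferentiableAt_extChartAt_symm (I := 𝓡 d) (mem_extChartAt_target (I := 𝓡 d) x)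
  rw [mder_eq_fderiv_chart (extChartAt_to_inv x) hs]
  have : (fun w => extChartAt (𝓡 d) x ((extChartAt (𝓡 d) x).symm w))
      =ᶠ[𝓝 (extChartAt (𝓡 d) x x)] id := by
    filter_upwards [(isOpen_extChartAt_target (I := 𝓡 d) x).mem_nhds
      (mem_extChartAt_target x)] with w hw
    exact (extChartAt (𝓡 d) x).right_inv hw
  rw [this.fderiv_eq, fderiv_id]

lemma mder_extChartAt {X : Type*} [TopologicalSpace X] [ChartedSpace (𝔼 d) X]
    [IsManifold (𝓡 d) ∞ X] (x : X) :
    mder (𝓡 d) 𝓘(ℝ, 𝔼 d) (extChartAt (𝓡 d) x) x =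
      ContinuousLinearMap.id ℝ _ := by
  have hs := mdifferentiableAt_extChartAt_symm (I := 𝓡 d) (mem_extChartAt_target (I := 𝓡 d) x)
  have h := mder_comp (g := (extChartAt (𝓡 d) x).symm) (f := extChartAt (𝓡 d) x) rfl hs
    (mdifferentiableAt_extChartAt (mem_chart_source _ x))
  have h2 : (fun z => (extChartAt (𝓡 d) x).symm (extChartAt (𝓡 d) x z)) =ᶠ[𝓝 x] fun z => z := by
    filter_upwards [(isOpen_extChartAt_source (I := 𝓡 d) x).mem_nhds
      (mem_extChartAt_source x)] with w hw
    exact (extChartAt (𝓡 d) x).left_inv hw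
  rw [mder_congr h2, mder_id, mder_extChartAt_symm, ContinuousLinearMap.id_comp] at h
  exact h.symm

variable (d G) in
/-- The bracket of `𝔤` in the preferred chart at `1`. -/
lemma lieB_eq_lieBracket (X Y : LieAlg d) : lieB d G X Y =
    VectorField.lieBracket ℝ
      (fun y => (mder 𝓘(ℝ, 𝔼 d) (𝓡 d) (extChartAt (𝓡 d) (1 : G)).symm y).inverse
        (mder (𝓡 d) (𝓡 d) (fun h : G => (extChartAt (𝓡 d) (1 : G)).symm y * h) 1 X))
      (fun y => (mder 𝓘(ℝ, 𝔼 d) (𝓡 d) (extChartAt (𝓡 d) (1 : G)).symm y).inverse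
        (mder (𝓡 d) (𝓡 d) (fun h : G => (extChartAt (𝓡 d) (1 : G)).symm y * h) 1 Y))
      (extChartAt (𝓡 d) (1 : G) 1) := by
  obtain ⟨P, hP⟩ : ∃ P : 𝔼 d → 𝔼 d →L[ℝ] 𝔼 d, P = fun y =>
    mfderivWithin 𝓘(ℝ, 𝔼 d) (𝓡 d) (extChartAt (𝓡 d) (1 : G)).symm (range (𝓡 d)) y := ⟨_, rfl⟩
  have h : lieB d G X Y = (mder (𝓡 d) 𝓘(ℝ, 𝔼 d) (extChartAt (𝓡 d) (1 : G)) 1).inverse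
    (VectorField.lieBracketWithin ℝ
      (fun y => (P y).inverse
        (mder (𝓡 d) (𝓡 d) (fun h : G => (extChartAt (𝓡 d) (1 : G)).symm y * h) 1 X))
      (fun y => (P y).inverse
        (mder (𝓡 d) (𝓡 d) (fun h : G => (extChartAt (𝓡 d) (1 : G)).symm y * h) 1 Y))
      ((extChartAt (𝓡 d) (1 : G)).symm ⁻¹' univ ∩ range (𝓡 d)) (extChartAt (𝓡 d) (1 : G) 1)) := by
    subst hP
    rfl
  have e1 : ((extChartAt (𝓡 d) (1 : G)).symm ⁻¹' univ ∩ range (𝓡 d)) = univ := by simp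
  have e2 : P = mder 𝓘(ℝ, 𝔼 d) (𝓡 d) (extChartAt (𝓡 d) (1 : G)).symm := by
    funext y
    simp only [hP, mder, modelWithCornersSelf_coe, range_id]
    rw [mfderivWithin_univ]
  rw [h, e1, mder_extChartAt, ContinuousLinearMap.inverse_id, VectorField.lieBracketWithin_univ, e2]
  rfl

variable (d G) in
/-- A globally defined smooth map which agrees near `u` with the inverse of the chart at `1`. -/
lemma exists_chart_symm_extension : ∃ ψ : 𝔼 d → G, ContMDiff 𝓘(ℝ, 𝔼 d) (𝓡 d) ∞ ψ ∧
    ψ =ᶠ[𝓝 (extChartAt (𝓡 d) (1 : G) 1)] (extChartAt (𝓡 d) (1 : G)).symm := by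
  obtain ⟨r, hr, hrt, hre⟩ := exists_smooth_retract
    (isOpen_extChartAt_target (I := 𝓡 d) (1 : G)) (mem_extChartAt_target 1)
  refine ⟨fun y => (extChartAt (𝓡 d) (1 : G)).symm (r y), ?_, ?_⟩
  · exact fun y => ContMDiffAt.comp y
      ((contMDiffOn_extChartAt_symm (n := ∞) (1 : G)).contMDiffAt
        ((isOpen_extChartAt_target (1 : G)).mem_nhds (hrt y))) hr.contMDiff.contMDiffAt
  · filter_upwards [hre] with y hy
    rw [hy]

lemma mder_eq_mul_mc {g : E → G} {u : E} (hg : MDifferentiableAt 𝓘(ℝ, E) (𝓡 d) g u) :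
    mder 𝓘(ℝ, E) (𝓡 d) g u = (mder (𝓡 d) (𝓡 d) (fun h : G => g u * h) 1).comp (mc d g u) := by
  have := mder_comp (x := u) (y := 1) (g := fun h : G => g u * h) (f := fun w => (g u)⁻¹ * g w)
    (by simp) ((contMDiff_mul_left (I := 𝓡 d) (n := ∞) (a := g u) _).mdifferentiableAt (by simp))
    (mdifferentiableAt_mc (d := d) hg)
  simp only [mul_inv_cancel_left] at this
  exact this

lemma mder_inv_mul_comp (g : G) :
    (mder (𝓡 d) (𝓡 d) (fun h : G => g⁻¹ * h) g).comp (mder (𝓡 d) (𝓡 d) (fun h : G => g * h) 1) =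
      ContinuousLinearMap.id ℝ _ := by
  have := mder_comp (x := (1 : G)) (y := g) (g := fun h : G => g⁻¹ * h) (f := fun h => g * h)
    (by simp) ((contMDiff_mul_left (I := 𝓡 d) (n := ∞) (a := g⁻¹) _).mdifferentiableAt (by simp))
    ((contMDiff_mul_left (I := 𝓡 d) (n := ∞) (a := g) _).mdifferentiableAt (by simp))
  rw [← this]
  simp only [inv_mul_cancel_left, mder_id]

lemma mder_mul_comp_inv (g : G) :
    (mder (𝓡 d) (𝓡 d) (fun h : G => g * h) 1).comp (mder (𝓡 d) (𝓡 d) (fun h : G => g⁻¹ * h) g) =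
      ContinuousLinearMap.id ℝ _ := by
  have := mder_comp (x := g) (y := (1 : G)) (g := fun h : G => g * h) (f := fun h => g⁻¹ * h)
    (by simp) ((contMDiff_mul_left (I := 𝓡 d) (n := ∞) (a := g) _).mdifferentiableAt (by simp))
    ((contMDiff_mul_left (I := 𝓡 d) (n := ∞) (a := g⁻¹) _).mdifferentiableAt (by simp))
  rw [← this]
  simp only [mul_inv_cancel_left, mder_id]

/-- In the coordinates `ψ`, the left-invariant vector field generated by `X` is the field on which
the Maurer–Cartan form takes the constant value `X`. -/
lemma inverse_mder_mul {ψ : E → G} {y : E} (hψ : MDifferentiableAt 𝓘(ℝ, E) (𝓡 d) ψ y)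
    (T : E ≃L[ℝ] 𝔼 d) (hT : mc d ψ y = T) (X : LieAlg d) :
    (mder 𝓘(ℝ, E) (𝓡 d) ψ y).inverse (mder (𝓡 d) (𝓡 d) (fun h : G => ψ y * h) 1 X) =
      T.symm X := by
  have h1 := mder_eq_mul_mc hψ
  have h2 : (mder 𝓘(ℝ, E) (𝓡 d) ψ y).inverse =
      (T.symm : 𝔼 d →L[ℝ] E).comp (mder (𝓡 d) (𝓡 d) (fun h : G => (ψ y)⁻¹ * h) (ψ y)) := by
    refine ContinuousLinearMap.inverse_eq ?_ ?_
    · rw [h1, hT, ContinuousLinearMap.comp_assoc,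
        ← ContinuousLinearMap.comp_assoc (T : E →L[ℝ] 𝔼 d),
        ContinuousLinearEquiv.coe_comp_coe_symm, ContinuousLinearMap.id_comp, mder_mul_comp_inv]
    · rw [h1, hT, ContinuousLinearMap.comp_assoc,
        ← ContinuousLinearMap.comp_assoc (mder (𝓡 d) (𝓡 d) (fun h : G => (ψ y)⁻¹ * h) (ψ y)),
        mder_inv_mul_comp]
      simp
  rw [h2, ContinuousLinearMap.comp_apply,
    ← ContinuousLinearMap.comp_apply (mder (𝓡 d) (𝓡 d) (fun h : G => (ψ y)⁻¹ * h) (ψ y)),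
    mder_inv_mul_comp]
  rfl

/-- The structure equation for an extension of the inverse of the chart at `1`. -/
lemma fderiv_mc_chart {ψ : 𝔼 d → G} (hψ : ContMDiff 𝓘(ℝ, 𝔼 d) (𝓡 d) ∞ ψ)
    (he : ψ =ᶠ[𝓝 (extChartAt (𝓡 d) (1 : G) 1)] (extChartAt (𝓡 d) (1 : G)).symm) :
    mc d ψ (extChartAt (𝓡 d) (1 : G) 1) = ContinuousLinearMap.id ℝ _ ∧ ∀ X Y : LieAlg d,
      fderiv ℝ (mc d ψ) (extChartAt (𝓡 d) (1 : G) 1) X Y -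
        fderiv ℝ (mc d ψ) (extChartAt (𝓡 d) (1 : G) 1) Y X = - lieB d G X Y := by
  have : IsManifold (𝓡 d) ∞ G := inferInstance
  set y₀ := extChartAt (𝓡 d) (1 : G) 1 with hy₀
  have hψ0 : ψ y₀ = 1 := by rw [he.self_of_nhds, hy₀, extChartAt_to_inv]
  have hid : mc d ψ y₀ = ContinuousLinearMap.id ℝ _ := by
    have : mder 𝓘(ℝ, 𝔼 d) (𝓡 d) ψ y₀ = ContinuousLinearMap.id ℝ _ := by
      rw [mder_congr he, mder_extChartAt_symm]
    rw [← this, mc, hψ0]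
    simp only [inv_one, one_mul]
  refine ⟨hid, fun X Y => ?_⟩
  have hsm := contDiff_mc hψ
  -- The form is the identity at `y₀`, and invertible maps form an open set.
  have hunit : ∀ᶠ y in 𝓝 y₀, ∃ T : 𝔼 d ≃L[ℝ] 𝔼 d, mc d ψ y = T := by
    have := (ContinuousLinearEquiv.nhds (ContinuousLinearEquiv.refl ℝ (𝔼 d)))
    have h3 := hsm.continuous.continuousAt (x := y₀)
    rw [ContinuousAt, hid] at h3
    filter_upwards [h3.eventually this] with y hy
    obtain ⟨T, hT⟩ := hy
    exact ⟨T, hT.symm⟩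
  -- The coordinate expression of the left-invariant field with value `Z` at `1`; the bracket of `𝔤`
  -- is the bracket of two such fields.
  set W : LieAlg d → 𝔼 d → 𝔼 d := fun Z y =>
    (mder 𝓘(ℝ, 𝔼 d) (𝓡 d) (extChartAt (𝓡 d) (1 : G)).symm y).inverse
        (mder (𝓡 d) (𝓡 d) (fun h : G => (extChartAt (𝓡 d) (1 : G)).symm y * h) 1 Z) with hW
  have hWe (Z : LieAlg d) : W Z =ᶠ[𝓝 y₀] fun y => (mc d ψ y).inverse Z := by
    filter_upwards [hunit, he.eventually_nhds] with y ⟨T, hT⟩ hy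
    rw [hT, ContinuousLinearMap.inverse_equiv]
    have := inverse_mder_mul ((hψ y).mdifferentiableAt (by simp)) T hT Z
    rw [mder_congr hy, hy.self_of_nhds] at this
    exact this
  have hWd (Z : LieAlg d) : DifferentiableAt ℝ (W Z) y₀ := by
    refine DifferentiableAt.congr_of_eventuallyEq ?_ (hWe Z)
    have h4 : ContDiffAt ℝ ∞ ContinuousLinearMap.inverse (mc d ψ y₀) := by
      rw [hid]
      exact contDiffAt_map_inverse (ContinuousLinearEquiv.refl ℝ (𝔼 d))
    exact ((h4.comp y₀ hsm.contDiffAt).clm_apply contDiffAt_const).differentiableAt (by simp)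
  have hWZ (Z : LieAlg d) : (fun y => mc d ψ y (W Z y)) =ᶠ[𝓝 y₀] fun _ => Z := by
    filter_upwards [hunit, hWe Z] with y ⟨T, hT⟩ hy
    rw [hy, hT, ContinuousLinearMap.inverse_equiv]
    simp
  have hW0 (Z : LieAlg d) : W Z y₀ = Z := by
    have : mc d ψ y₀ (W Z y₀) = Z := (hWZ Z).self_of_nhds
    rwa [hid] at this
  -- Differentiating the constant function `mc(W Z) = Z` expresses the derivative of the field
  -- through that of the form.
  have hWf (Z V : LieAlg d) : fderiv ℝ (W Z) y₀ V = - fderiv ℝ (mc d ψ) y₀ V Z := by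
    have h5 := (hWZ Z).fderiv_eq (𝕜 := ℝ)
    rw [fderiv_clm_apply (hsm.differentiable (by simp) y₀) (hWd Z), hid, hW0] at h5
    have h6 := congrArg (fun l : 𝔼 d →L[ℝ] 𝔼 d => l V) h5
    simp at h6
    exact eq_neg_of_add_eq_zero_left h6
  rw [lieB_eq_lieBracket]
  change _ = - VectorField.lieBracket ℝ (W X) (W Y) y₀
  rw [VectorField.lieBracket, hWf, hWf, hW0, hW0]
  abel

/-- The Maurer-Cartan structure equation. -/
lemma fderiv_mc_sub {h : E → G} (hh : ContMDiff 𝓘(ℝ, E) (𝓡 d) ∞ h) (u v w : E) :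
    fderiv ℝ (mc d h) u v w - fderiv ℝ (mc d h) u w v = - lieB d G (mc d h u v) (mc d h u w) := by
  have : IsManifold (𝓡 d) ∞ G := inferInstance
  -- Both sides are unchanged by a constant left translation.
  wlog hu : h u = 1 generalizing h
  · have := this (h := fun w => (h u)⁻¹ * h w) (contMDiff_const.mul hh) (by simp)
    have e : mc d (fun w => (h u)⁻¹ * h w) = mc d h := by
      funext u'; exact mc_mul_left _ _ _
    rwa [e] at this
  obtain ⟨ψ, hψ, he⟩ := exists_chart_symm_extension d G
  obtain ⟨hid, hst⟩ := fderiv_mc_chart hψ he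
  set f : E → 𝔼 d := fun w => extChartAt (𝓡 d) (1 : G) (h w) with hf
  have hfu : f u = extChartAt (𝓡 d) (1 : G) 1 := by rw [hf]; simp only [hu]
  have hfs : ContDiffAt ℝ ∞ f u := contDiffAt_extChartAt_one (by rw [hu]; simp) (hh u)
  have hhf : h =ᶠ[𝓝 u] fun w => ψ (f w) := by
    have h1 := hfs.continuousAt
    rw [ContinuousAt, hfu] at h1
    filter_upwards [h1.eventually he, hh.continuous.continuousAt.preimage_mem_nhds
      ((isOpen_extChartAt_source (I := 𝓡 d) (1 : G)).mem_nhds (by rw [hu]; simp))] with w hw hw'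
    rw [hw]
    exact ((extChartAt (𝓡 d) (1 : G)).left_inv hw').symm
  -- Near `u` the map factors through the chart at `1`, so the form is pulled back from `G`.
  have hmc : mc d h =ᶠ[𝓝 u] fun w => (mc d ψ (f w)).comp (fderiv ℝ f w) := by
    filter_upwards [hhf.eventually_nhds, (hfs.of_le (m := 1) (by simp)).eventually (by simp)] with w hw hw'
    rw [mc_congr hw, mc_comp ((hψ _).mdifferentiableAt (by simp)) (hw'.differentiableAt (by simp))]
  have hd1 : DifferentiableAt ℝ (fun w => mc d ψ (f w)) u :=
    ((contDiff_mc hψ).contDiffAt.comp u hfs).differentiableAt (by simp)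
  have hd2 : DifferentiableAt ℝ (fderiv ℝ f) u :=
    (hfs.fderiv_right (m := ∞) (by simp)).differentiableAt (by simp)
  have hsymm : IsSymmSndFDerivAt ℝ f u := hfs.isSymmSndFDerivAt (by
    rw [minSmoothness_of_isRCLikeNormedField]
    exact WithTop.coe_le_coe.mpr (le_top : (2 : ℕ∞) ≤ ⊤))
  -- The second derivative of the coordinate map is symmetric and drops out of the antisymmetrized
  -- expression.
  have key (v w : E) : fderiv ℝ (mc d h) u v w =
      fderiv ℝ (mc d ψ) (f u) (fderiv ℝ f u v) (fderiv ℝ f u w) +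
        fderiv ℝ (fderiv ℝ f) u v w := by
    rw [hmc.fderiv_eq, fderiv_clm_comp hd1 hd2]
    have h7 : fderiv ℝ (fun w => mc d ψ (f w)) u =
        (fderiv ℝ (mc d ψ) (f u)).comp (fderiv ℝ f u) :=
      fderiv_comp u ((contDiff_mc hψ).differentiable (by simp) _) (hfs.differentiableAt (by simp))
    rw [h7, hfu, hid]
    simp [add_comm]
  rw [key, key, hsymm.eq v w, add_sub_add_right_eq_sub, hfu, hst, hmc.self_of_nhds]
  simp only [hfu, hid]
  rfl

variable (d G) in
-- Read off from the structure equation, whose left-hand side is visibly antisymmetric.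
lemma lieB_swap (X Y : LieAlg d) : lieB d G Y X = - lieB d G X Y := by
  obtain ⟨ψ, hψ, he⟩ := exists_chart_symm_extension d G
  obtain ⟨-, hst⟩ := fderiv_mc_chart hψ he
  rw [← neg_inj, ← hst, neg_neg, ← neg_inj (b := lieB d G X Y), ← hst]
  abel

/-- Both statements are components of the structure equation for `(y, w) ↦ ψ(y)h(w)`, where `ψ`
parametrizes `G` near `1`. Its Maurer–Cartan form is `Ad(h⁻¹)` applied to that of `ψ`, plus that of
`h`. -/
lemma Ad_inv_structure {h : E → G} (hh : ContMDiff 𝓘(ℝ, E) (𝓡 d) ∞ h) (u : E) :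
    (∀ v X, fderiv ℝ (fun w => Ad d (h w)⁻¹) u v X = lieB d G (Ad d (h u)⁻¹ X) (mc d h u v)) ∧
    ∀ X Y, Ad d (h u)⁻¹ (lieB d G X Y) = lieB d G (Ad d (h u)⁻¹ X) (Ad d (h u)⁻¹ Y) := by
  obtain ⟨ψ, hψ, he⟩ := exists_chart_symm_extension d G
  obtain ⟨hid, hst⟩ := fderiv_mc_chart hψ he
  set y₀ := extChartAt (𝓡 d) (1 : G) 1 with hy₀
  set k : 𝔼 d × E → G := fun p => ψ p.1 * h p.2 with hk
  have hψ1 : ContMDiff 𝓘(ℝ, 𝔼 d × E) (𝓡 d) ∞ fun p : 𝔼 d × E => ψ p.1 :=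
    hψ.comp contDiff_fst.contMDiff
  have hh1 : ContMDiff 𝓘(ℝ, 𝔼 d × E) (𝓡 d) ∞ fun p : 𝔼 d × E => h p.2 :=
    hh.comp contDiff_snd.contMDiff
  have hmck : mc d k = fun p => (Ad d (h p.2)⁻¹).comp ((mc d ψ p.1).comp
      (ContinuousLinearMap.fst ℝ (𝔼 d) E)) + (mc d h p.2).comp (ContinuousLinearMap.snd ℝ (𝔼 d) E) := by
    funext p
    rw [hk, mc_mul ((hψ1 p).mdifferentiableAt (by simp)) ((hh1 p).mdifferentiableAt (by simp)),
      mc_comp (g := ψ) (f := Prod.fst) ((hψ _).mdifferentiableAt (by simp)) differentiableAt_fst,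
      mc_comp (g := h) (f := Prod.snd) ((hh _).mdifferentiableAt (by simp)) differentiableAt_snd,
      fderiv_fst, fderiv_snd]
  have dA : HasFDerivAt (fun p : 𝔼 d × E => Ad d (h p.2)⁻¹)
      ((fderiv ℝ (fun w => Ad d (h w)⁻¹) u).comp (ContinuousLinearMap.snd ℝ (𝔼 d) E)) (y₀, u) :=
    HasFDerivAt.comp (g := fun w => Ad d (h w)⁻¹) (f := Prod.snd) (y₀, u) (((contDiff_Ad hh.inv).differentiable (by simp) u).hasFDerivAt)
      hasFDerivAt_snd
  have dψ : HasFDerivAt (fun p : 𝔼 d × E => mc d ψ p.1)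
      ((fderiv ℝ (mc d ψ) y₀).comp (ContinuousLinearMap.fst ℝ (𝔼 d) E)) (y₀, u) :=
    HasFDerivAt.comp (g := mc d ψ) (f := Prod.fst) (y₀, u) (((contDiff_mc hψ).differentiable (by simp) y₀).hasFDerivAt)
      hasFDerivAt_fst
  have dh : HasFDerivAt (fun p : 𝔼 d × E => mc d h p.2)
      ((fderiv ℝ (mc d h) u).comp (ContinuousLinearMap.snd ℝ (𝔼 d) E)) (y₀, u) :=
    HasFDerivAt.comp (g := mc d h) (f := Prod.snd) (y₀, u) (((contDiff_mc hh).differentiable (by simp) u).hasFDerivAt)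
      hasFDerivAt_snd
  have key (a X : 𝔼 d) (b Y : E) : fderiv ℝ (mc d k) (y₀, u) (a, b) (X, Y) =
      fderiv ℝ (fun w => Ad d (h w)⁻¹) u b X + Ad d (h u)⁻¹ (fderiv ℝ (mc d ψ) y₀ a X) +
        fderiv ℝ (mc d h) u b Y := by
    have hd := (dA.clm_comp (dψ.clm_comp
      (hasFDerivAt_const (ContinuousLinearMap.fst ℝ (𝔼 d) E) (y₀, u)))).add
      (dh.clm_comp (hasFDerivAt_const (ContinuousLinearMap.snd ℝ (𝔼 d) E) (y₀, u)))
    rw [hmck]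
    refine (congrArg (fun l : 𝔼 d × E →L[ℝ] 𝔼 d × E →L[ℝ] LieAlg d => l (a, b) (X, Y))
      hd.fderiv).trans ?_
    simp [hid]
    abel
  have hmc (X : 𝔼 d) (Y : E) : mc d k (y₀, u) (X, Y) = Ad d (h u)⁻¹ X + mc d h u Y := by
    rw [hmck]
    simp [hid]
  have hks : ContMDiff 𝓘(ℝ, 𝔼 d × E) (𝓡 d) ∞ k := hψ1.mul hh1
  refine ⟨fun v X => ?_, fun X Y => ?_⟩
  -- The mixed component sees only the variation of `Ad(h⁻¹)`.
  · have := fderiv_mc_sub hks (y₀, u) (0, v) (X, 0)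
    rw [key, key, hmc, hmc] at this
    simp only [map_zero, zero_add, add_zero, zero_apply, sub_zero] at this
    rw [this, ← lieB_swap]
  -- With both directions along the first factor, the structure equations of `ψ` and of the product
  -- are compared.
  · have := fderiv_mc_sub hks (y₀, u) (X, 0) (Y, 0)
    rw [key, key, hmc, hmc] at this
    simp only [map_zero, zero_add, add_zero, zero_apply, ← map_sub, hst,
      map_neg, neg_inj] at this
    exact this

/-- The derivative of the adjoint action. -/
lemma fderiv_Ad_inv {h : E → G} (hh : ContMDiff 𝓘(ℝ, E) (𝓡 d) ∞ h) (u v : E) (X : LieAlg d) :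
    fderiv ℝ (fun w => Ad d (h w)⁻¹) u v X = lieB d G (Ad d (h u)⁻¹ X) (mc d h u v) :=
  (Ad_inv_structure hh u).1 v X

lemma Ad_lieB (g : G) (X Y : LieAlg d) :
    Ad d g (lieB d G X Y) = lieB d G (Ad d g X) (Ad d g Y) := by
  have := (Ad_inv_structure (E := ℝ) (h := fun _ => g⁻¹) (d := d) contMDiff_const 0).2 X Y
  rwa [inv_inv] at this

/-- There is a map into `G` through `1` with prescribed derivative. -/
lemma exists_mc_eq (u : E) (a : E →L[ℝ] LieAlg d) :
    ∃ h : E → G, ContMDiff 𝓘(ℝ, E) (𝓡 d) ∞ h ∧ h u = 1 ∧ mc d h u = a := by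
  obtain ⟨ψ, hψ, he⟩ := exists_chart_symm_extension d G
  obtain ⟨hid, -⟩ := fderiv_mc_chart hψ he
  set y₀ := extChartAt (𝓡 d) (1 : G) 1 with hy₀
  have h0 : y₀ + a (u - u) = y₀ := by simp
  have hf : HasFDerivAt (fun w => y₀ + a (w - u)) a u := by
    have := (a.hasFDerivAt.comp u ((hasFDerivAt_id u).sub_const u)).const_add y₀
    simpa using this
  -- An affine map with linear part `a`, followed by the parametrization, whose Maurer–Cartan form
  -- at `y₀` is the identity.
  refine ⟨fun w => ψ (y₀ + a (w - u)), hψ.comp (ContDiff.contMDiff (by fun_prop)), ?_, ?_⟩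
  · change ψ (y₀ + a (u - u)) = 1
    rw [h0, he.self_of_nhds, hy₀, extChartAt_to_inv]
  · rw [mc_comp (g := ψ) (f := fun w => y₀ + a (w - u)) ((hψ _).mdifferentiableAt (by simp))
      hf.differentiableAt, hf.fderiv, h0, hid, ContinuousLinearMap.id_comp]

end StructureEquation

/-! ### One-forms on diffeological spaces -/

section OneForms

variable {X : Type*} {dX : DiffeologicalSpace X} {V : Type*} [NormedAddCommGroup V]
  [NormedSpace ℝ V] (A : OneForm X dX V)

/-- Locality is not an axiom. It follows from naturality under a smooth map `r` that is the identity
near `u` and takes values where the two plots agree. -/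
lemma OneForm.toFun_congr {n : ℕ} {p p' : 𝔼 n → X} (hp : p ∈ dX.plots n) (hp' : p' ∈ dX.plots n)
    {u : 𝔼 n} (h : p =ᶠ[𝓝 u] p') : A.toFun p u = A.toFun p' u := by
  obtain ⟨O, hO, hOo, huO⟩ := mem_nhds_iff.1 h
  obtain ⟨r, hr, hrO, hru⟩ := exists_smooth_retract hOo huO
  have e : p ∘ r = p' ∘ r := funext fun w => hO (hrO w)
  have h1 := A.natural hp hr u
  have h2 := A.natural hp' hr u
  have hr' : fderiv ℝ r u = ContinuousLinearMap.id ℝ _ := by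
    rw [(show r =ᶠ[𝓝 u] id from hru).fderiv_eq, fderiv_id]
  rw [hru.self_of_nhds, hr', ContinuousLinearMap.comp_id] at h1 h2
  rw [← h1, ← h2, e]

lemma OneForm.toFun_const {n : ℕ} (x : X) (u : 𝔼 n) : A.toFun (fun _ : 𝔼 n => x) u = 0 := by
  have := A.natural (dX.constant_plots x) (contDiff_const (c := (0 : 𝔼 n)) (E := 𝔼 n)) u
  rw [fderiv_const_apply, ContinuousLinearMap.comp_zero] at this
  exact this

/-- The derivative of the diagonal is the sum of those of the two slices. The detour through `𝔼 (n +
n)` is needed because plots are parametrized by Euclidean spaces only. -/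
lemma OneForm.toFun_diag {n : ℕ} {F : 𝔼 n × 𝔼 n → X}
    (hF : (fun z => F (EuclideanSpace.finAddEquivProd (𝕜 := ℝ) z)) ∈ dX.plots (n + n)) (u : 𝔼 n) :
    A.toFun (fun w => F (w, w)) u =
      A.toFun (fun w => F (w, u)) u + A.toFun (fun w => F (u, w)) u := by
  set e := EuclideanSpace.finAddEquivProd (𝕜 := ℝ) (n := n) (m := n) with he
  have key {f : 𝔼 n → 𝔼 n × 𝔼 n} {f' : 𝔼 n →L[ℝ] 𝔼 n × 𝔼 n} (hfs : ContDiff ℝ ∞ f)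
      (hf : HasFDerivAt f f' u) :
      A.toFun (fun w => F (f w)) u =
        (A.toFun (fun z => F (e z)) (e.symm (f u))).comp ((e.symm : 𝔼 n × 𝔼 n →L[ℝ] _).comp f') := by
    have h1 := A.natural hF (e.symm.contDiff.comp hfs) u
    rw [(e.symm.hasFDerivAt.comp u hf).fderiv] at h1
    refine Eq.trans ?_ h1
    congr 1
    funext w
    simp
  rw [key (f := fun w => (w, w)) (contDiff_id.prodMk contDiff_id) ((hasFDerivAt_id u).prodMk (hasFDerivAt_id u)),
    key (f := fun w => (w, u)) (contDiff_id.prodMk contDiff_const) ((hasFDerivAt_id u).prodMk (hasFDerivAt_const u u)),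
    key (f := fun w => (u, w)) (contDiff_const.prodMk contDiff_id) ((hasFDerivAt_const u u).prodMk (hasFDerivAt_id u)),
    ← ContinuousLinearMap.comp_add, ← ContinuousLinearMap.comp_add]
  congr 2
  ext v <;> simp

/-- The product rule that separates the motion of the point from the motion of the group element. -/
lemma OneForm.toFun_act {H : Type*} [Group H] {dH : DiffeologicalSpace H}
    {Y : Type*} [TopologicalSpace Y] {dY : DiffeologicalSpace Y} {P : PrincipalBundle H dH Y dY}
    (A : OneForm P.Total P.diffeology V) {n : ℕ} {p : 𝔼 n → P.Total} {a : 𝔼 n → H}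
    (hp : p ∈ P.diffeology.plots n) (ha : a ∈ dH.plots n) (u : 𝔼 n) :
    A.toFun (fun w => P.act (p w) (a w)) u =
      A.toFun (fun w => P.act (p w) (a u)) u + A.toFun (fun w => P.act (p u) (a w)) u := by
  refine A.toFun_diag (F := fun z => P.act (p z.1) (a z.2)) ?_ u
  exact P.act_smooth (P.diffeology.plot_reparam hp
    (contDiff_fst.comp (EuclideanSpace.finAddEquivProd (𝕜 := ℝ)).contDiff))
    (dH.plot_reparam ha (contDiff_snd.comp (EuclideanSpace.finAddEquivProd (𝕜 := ℝ)).contDiff))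

lemma PrincipalBundle.act_const_smooth {H : Type*} [Group H] {dH : DiffeologicalSpace H}
    {Y : Type*} [TopologicalSpace Y] {dY : DiffeologicalSpace Y} (P : PrincipalBundle H dH Y dY)
    {n : ℕ} {p : 𝔼 n → P.Total} (hp : p ∈ P.diffeology.plots n) (a : H) :
    (fun w => P.act (p w) a) ∈ P.diffeology.plots n := P.act_smooth hp (dH.constant_plots a)

end OneForms

/-! ### Smoothness of families of alternating maps -/

section AlternatingMaps

variable {E F V : Type*} [NormedAddCommGroup E] [NormedSpace ℝ E] [FiniteDimensional ℝ E]
  [NormedAddCommGroup V] [NormedSpace ℝ V] [FiniteDimensional ℝ V]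
  [NormedAddCommGroup F] [NormedSpace ℝ F]

variable (E V) in
/-- Evaluation of alternating maps on a basis. -/
def evalBasis (q : ℕ) : (E [⋀^Fin q]→L[ℝ] V) →ₗ[ℝ]
    ((Fin q → Fin (Module.finrank ℝ E)) → V) where
  toFun f v := f fun i => Module.finBasis ℝ E (v i)
  map_add' _ _ := rfl
  map_smul' _ _ := rfl

lemma evalBasis_injective (q : ℕ) : Function.Injective (evalBasis E V q) := by
  intro f g h
  apply ContinuousAlternatingMap.toAlternatingMap_injective
  refine (Module.finBasis ℝ E).ext_alternating fun v _ => ?_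
  exact congrFun h v

instance (q : ℕ) : FiniteDimensional ℝ (E [⋀^Fin q]→L[ℝ] V) :=
  FiniteDimensional.of_injective _ (evalBasis_injective q)

/-- Evaluation on basis vectors is linear and injective, so it has a linear left inverse that
recovers the form smoothly from its values. -/
lemma contDiffAt_alternating {q : ℕ} {r : WithTop ℕ∞} {f : F → E [⋀^Fin q]→L[ℝ] V} {u : F}
    (h : ∀ v, ContDiffAt ℝ r (fun w => f w v) u) : ContDiffAt ℝ r f u := by
  obtain ⟨g, hg⟩ := LinearMap.exists_leftInverse_of_injective (evalBasis E V q)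
    (LinearMap.ker_eq_bot.2 (evalBasis_injective q))
  have h1 : ContDiffAt ℝ r (fun w => evalBasis E V q (f w)) u :=
    contDiffAt_pi.2 fun v => h _
  have h2 := (LinearMap.toContinuousLinearMap g).contDiff.contDiffAt.comp u h1
  refine h2.congr_of_eventuallyEq (Eventually.of_forall fun w => ?_)
  exact (LinearMap.congr_fun hg (f w)).symm

lemma contDiffAt_alternating_apply {q : ℕ} {r : WithTop ℕ∞} {f : F → E [⋀^Fin q]→L[ℝ] V} {u : F}
    (h : ContDiffAt ℝ r f u) (v : Fin q → E) : ContDiffAt ℝ r (fun w => f w v) u := by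
  have h2 := (LinearMap.toContinuousLinearMap (LinearMap.proj v ∘ₗ
    ({ toFun := fun f => f, map_add' := fun _ _ => rfl, map_smul' := fun _ _ => rfl } :
      (E [⋀^Fin q]→L[ℝ] V) →ₗ[ℝ] (Fin q → E) → V))).contDiff.contDiffAt.comp u h
  exact h2

end AlternatingMaps

/-! ### Curvature of a connection and its gauge transformation -/

section Curvature

variable {d : ℕ} {G : Type*} [TopologicalSpace G] [ChartedSpace (𝔼 d) G] [Group G]
  [LieGroup (𝓡 d) ∞ G]
  {E : Type*} [NormedAddCommGroup E] [NormedSpace ℝ E] {H : Type*} [TopologicalSpace H]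
  {I : ModelWithCorners ℝ E H} {X : Type*} [TopologicalSpace X] [ChartedSpace H X]
  {Q : GBundle d G I X} {A : OneForm Q.Total Q.diffeology (LieAlg d)}

variable (d G) in
lemma lieB_add_left (X X' Y : LieAlg d) :
    lieB d G (X + X') Y = lieB d G X Y + lieB d G X' Y := LinearMap.map_add₂ (lieBLinear d G) X X' Y

variable (d G) in
lemma lieB_add_right (X Y Y' : LieAlg d) :
    lieB d G X (Y + Y') = lieB d G X Y + lieB d G X Y' := map_add (lieBLinear d G X) Y Y'

/-- The classical transformation law of a potential, from the two axioms of a connection and the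
product rule. -/
lemma IsConnection.toFun_act (hA : IsConnection Q A) {n : ℕ} {p : 𝔼 n → Q.Total} {h : 𝔼 n → G}
    (hp : p ∈ Q.diffeology.plots n) (hh : ContMDiff (𝓡 n) (𝓡 d) ∞ h) (u : 𝔼 n) :
    A.toFun (fun w => Q.act (p w) (h w)) u = (Ad d (h u)⁻¹).comp (A.toFun p u) + mc d h u := by
  rw [A.toFun_act (p := p) (a := h) hp hh]
  ext1 v
  rw [add_apply, add_apply, hA.equivariant hp]
  congr 1
  -- Moving the base point to `p(u)h(u)` makes the group-valued map pass through `1`, as the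
  -- vertical axiom demands.
  have h1 : (fun w => Q.act (p u) (h w)) = fun w => Q.act (Q.act (p u) (h u)) ((h u)⁻¹ * h w) := by
    funext w; rw [← Q.act_mul, mul_inv_cancel_left]
  rw [h1, hA.vertical (Q.act (p u) (h u)) (c := fun w => (h u)⁻¹ * h w) (contMDiff_const.mul hh) u (by simp) v]
  rfl

/-- Alternatization over two arguments is not normalized; the resulting `2` cancels the `½` in the
curvature. -/
lemma bracketForm_apply {n : ℕ} (a : 𝔼 n →L[ℝ] LieAlg d) (x : Fin 2 → 𝔼 n) :
    bracketForm d G a x = (2 : ℝ) • lieB d G (a (x 0)) (a (x 1)) := by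
  have : bracketForm d G a x = lieB d G (a (x 0)) (a (x 1)) - lieB d G (a (x 1)) (a (x 0)) := by
    rw [bracketForm, ContinuousMultilinearMap.alternatization_apply_apply]
    have : (Finset.univ : Finset (Equiv.Perm (Fin 2))) = {1, Equiv.swap 0 1} := by decide
    rw [this, Finset.sum_pair (by decide)]
    simp [sub_eq_add_neg]
    rfl
  rw [this, lieB_swap d G (a (x 0)), two_smul, sub_neg_eq_add]

lemma curvature_apply {n : ℕ} {p : 𝔼 n → Q.Total} (hp : p ∈ Q.diffeology.plots n) (u : 𝔼 n)
    (x : Fin 2 → 𝔼 n) : curvature Q A p u x =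
      fderiv ℝ (A.toFun p) u (x 0) (x 1) - fderiv ℝ (A.toFun p) u (x 1) (x 0) +
        lieB d G (A.toFun p u (x 0)) (A.toFun p u (x 1)) := by
  have hd : DifferentiableAt ℝ (A.toFun p) u := (A.smooth hp).differentiable (by simp) u
  have hf : HasFDerivAt (fun w => ContinuousAlternatingMap.ofSubsingleton ℝ (𝔼 n) (LieAlg d) (0 : Fin 1)
      (A.toFun p w)) _ u :=
    (ContinuousAlternatingMap.ofSubsingletonLIE (𝕜 := ℝ) (E := 𝔼 n) (F := LieAlg d)
      (0 : Fin 1)).toContinuousLinearEquiv.hasFDerivAt.comp u hd.hasFDerivAt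
  rw [curvature, ContinuousAlternatingMap.add_apply, ContinuousAlternatingMap.smul_apply,
    bracketForm_apply, smul_smul, inv_mul_cancel₀ (by norm_num), one_smul]
  congr 1
  rw [extDeriv, hf.fderiv, ContinuousAlternatingMap.alternatizeUncurryFin_apply, Fin.sum_univ_two]
  simp [sub_eq_add_neg, Fin.removeNth]
  rfl

/-- Gauge transformations act on the curvature by the adjoint action. -/
lemma IsConnection.curvature_act (hA : IsConnection Q A) {n : ℕ} {p : 𝔼 n → Q.Total}
    {h : 𝔼 n → G} (hp : p ∈ Q.diffeology.plots n) (hh : ContMDiff (𝓡 n) (𝓡 d) ∞ h) (u : 𝔼 n)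
    (x : Fin 2 → 𝔼 n) :
    curvature Q A (fun w => Q.act (p w) (h w)) u x = Ad d (h u)⁻¹ (curvature Q A p u x) := by
  have hp' : (fun w => Q.act (p w) (h w)) ∈ Q.diffeology.plots n := Q.act_smooth hp hh
  rw [curvature_apply hp', curvature_apply hp]
  have e : A.toFun (fun w => Q.act (p w) (h w)) = fun u =>
      (Ad d (h u)⁻¹).comp (A.toFun p u) + mc d h u := by
    funext u; exact hA.toFun_act hp hh u
  have hd : DifferentiableAt ℝ (A.toFun p) u := (A.smooth hp).differentiable (by simp) u
  have hAd : DifferentiableAt ℝ (fun w => Ad d (h w)⁻¹) u :=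
    (contDiff_Ad hh.inv).differentiable (by simp) u
  have hmc : DifferentiableAt ℝ (mc d h) u := (contDiff_mc hh).differentiable (by simp) u
  -- Leibniz rule for `Ad(h⁻¹)A + h⁻¹dh`, with the derivative of `Ad(h⁻¹)` turned into a bracket
  -- with `h⁻¹dh`.
  have key (v w : 𝔼 n) : fderiv ℝ (A.toFun (fun w => Q.act (p w) (h w))) u v w =
      Ad d (h u)⁻¹ (fderiv ℝ (A.toFun p) u v w) +
        lieB d G (Ad d (h u)⁻¹ (A.toFun p u w)) (mc d h u v) + fderiv ℝ (mc d h) u v w := by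
    rw [e]
    refine (congrArg (fun l : 𝔼 n →L[ℝ] 𝔼 n →L[ℝ] LieAlg d => l v w)
      ((hAd.hasFDerivAt.clm_comp hd.hasFDerivAt).add hmc.hasFDerivAt).fderiv).trans ?_
    simp [fderiv_Ad_inv hh]
  have hst := fderiv_mc_sub hh u (x 0) (x 1)
  rw [key, key, e]
  simp only [add_apply, ContinuousLinearMap.comp_apply, lieB_add_left,
    lieB_add_right, map_add, map_sub, Ad_lieB]
  rw [← neg_eq_iff_eq_neg] at hst
  -- The structure equation cancels the terms in `h⁻¹dh` alone; the mixed brackets cancel by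
  -- antisymmetry.
  rw [← hst, lieB_swap d G (mc d h u (x 0)) (Ad d (h u)⁻¹ (A.toFun p u (x 1)))]
  abel

lemma curvature_congr {n : ℕ} {p p' : 𝔼 n → Q.Total} (hp : p ∈ Q.diffeology.plots n)
    (hp' : p' ∈ Q.diffeology.plots n) {u : 𝔼 n} (h : p =ᶠ[𝓝 u] p') :
    curvature Q A p u = curvature Q A p' u := by
  have e : A.toFun p =ᶠ[𝓝 u] A.toFun p' := by
    filter_upwards [h.eventually_nhds] with w hw
    exact A.toFun_congr hp hp' hw
  ext x
  rw [curvature_apply hp, curvature_apply hp', e.fderiv_eq, e.self_of_nhds]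

/-- The only non-tensorial term contains the second derivative of `f`, which is symmetric and
cancels. -/
lemma curvature_comp {n k : ℕ} {p : 𝔼 n → Q.Total} (hp : p ∈ Q.diffeology.plots n)
    {f : 𝔼 k → 𝔼 n} (hf : ContDiff ℝ ∞ f) (u : 𝔼 k) :
    curvature Q A (fun w => p (f w)) u =
      (curvature Q A p (f u)).compContinuousLinearMap (fderiv ℝ f u) := by
  have hpf : (fun w => p (f w)) ∈ Q.diffeology.plots k := Q.diffeology.plot_reparam hp hf
  ext x
  rw [ContinuousAlternatingMap.compContinuousLinearMap_apply, curvature_apply hpf,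
    curvature_apply hp]
  have e : A.toFun (fun w => p (f w)) = fun w => (A.toFun p (f w)).comp (fderiv ℝ f w) :=
    funext (A.natural hp hf)
  have hd : DifferentiableAt ℝ (A.toFun p) (f u) := (A.smooth hp).differentiable (by simp) _
  have hd1 : HasFDerivAt (fun w => A.toFun p (f w)) _ u :=
    hd.hasFDerivAt.comp u (hf.differentiable (by simp) u).hasFDerivAt
  have hd2 : DifferentiableAt ℝ (fderiv ℝ f) u :=
    (hf.fderiv_right (m := ∞) (by simp)).differentiable (by simp) u
  have hsymm : IsSymmSndFDerivAt ℝ f u := hf.contDiffAt.isSymmSndFDerivAt (by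
    rw [minSmoothness_of_isRCLikeNormedField]
    exact WithTop.coe_le_coe.mpr (le_top : (2 : ℕ∞) ≤ ⊤))
  have key (v w : 𝔼 k) : fderiv ℝ (A.toFun (fun w => p (f w))) u v w =
      fderiv ℝ (A.toFun p) (f u) (fderiv ℝ f u v) (fderiv ℝ f u w) +
        A.toFun p (f u) (fderiv ℝ (fderiv ℝ f) u v w) := by
    rw [e]
    refine (congrArg (fun l : 𝔼 k →L[ℝ] 𝔼 k →L[ℝ] LieAlg d => l v w)
      (hd1.clm_comp hd2.hasFDerivAt).fderiv).trans ?_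
    simp [add_comm]
  rw [key, key, hsymm.eq (x 0) (x 1), e]
  simp

lemma contDiff_curvature {n : ℕ} {p : 𝔼 n → Q.Total} (hp : p ∈ Q.diffeology.plots n) :
    ContDiff ℝ ∞ (curvature Q A p) := by
  rw [contDiff_iff_contDiffAt]
  refine fun u => contDiffAt_alternating fun x => ContDiff.contDiffAt ?_
  simp only [curvature_apply hp]
  have h1 : ContDiff ℝ ∞ (A.toFun p) := A.smooth hp
  have h2 : ContDiff ℝ ∞ (fderiv ℝ (A.toFun p)) := h1.fderiv_right (by simp)
  refine (((h2.clm_apply contDiff_const).clm_apply contDiff_const).sub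
    ((h2.clm_apply contDiff_const).clm_apply contDiff_const)).add ?_
  refine (lieBMultilinear d G).contDiff.comp (g := lieBMultilinear d G)
    (f := fun u i => A.toFun p u (x i)) ?_
  exact contDiff_pi.2 fun i => h1.clm_apply contDiff_const

end Curvature

/-! ### The forms `f(F, …, F)` -/

section InvariantPolynomials

variable {d : ℕ} {G : Type*} [TopologicalSpace G] [ChartedSpace (𝔼 d) G] [Group G]
  [LieGroup (𝓡 d) ∞ G] {k n l : ℕ} (f : InvariantPolynomial d G k)

lemma polyForm_apply (F : 𝔼 n [⋀^Fin 2]→L[ℝ] LieAlg d) (v : Fin (2 * k) → 𝔼 n) :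
    polyForm f F v = ((2 : ℝ) ^ k)⁻¹ * ∑ σ : Equiv.Perm (Fin (2 * k)), Equiv.Perm.sign σ •
      f.toMap fun i => F fun j =>
        v (σ (finProdFinEquiv.trans (finCongr (Nat.mul_comm k 2)) (i, j))) := by
  rw [polyForm, ContinuousAlternatingMap.smul_apply,
    ContinuousMultilinearMap.alternatization_apply_apply]
  rfl

lemma polyForm_comp (F : 𝔼 n [⋀^Fin 2]→L[ℝ] LieAlg d) (L : 𝔼 l →L[ℝ] 𝔼 n) :
    polyForm f (F.compContinuousLinearMap L) = (polyForm f F).compContinuousLinearMap L := by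
  ext v
  rw [ContinuousAlternatingMap.compContinuousLinearMap_apply, polyForm_apply, polyForm_apply]
  rfl

/-- This is where `ad`-invariance of `f` enters: gauge-equivalent curvatures have the same
characteristic form. -/
lemma polyForm_eq_of_Ad {F F' : 𝔼 n [⋀^Fin 2]→L[ℝ] LieAlg d} (g : G)
    (h : ∀ x, F' x = Ad d g (F x)) : polyForm f F' = polyForm f F := by
  ext v
  rw [polyForm_apply, polyForm_apply]
  simp only [h, f.invariant g]

lemma contDiff_polyForm {E : Type*} [NormedAddCommGroup E] [NormedSpace ℝ E]
    {F : E → 𝔼 n [⋀^Fin 2]→L[ℝ] LieAlg d} (hF : ContDiff ℝ ∞ F) :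
    ContDiff ℝ ∞ fun u => polyForm f (F u) := by
  rw [contDiff_iff_contDiffAt]
  refine fun u => contDiffAt_alternating fun x => ?_
  simp only [polyForm_apply]
  refine contDiffAt_const.mul (ContDiffAt.sum fun σ _ => ContDiffAt.const_smul _ ?_)
  refine f.toMap.contDiff.contDiffAt.comp u (contDiffAt_pi.2 fun i => ?_)
  exact contDiffAt_alternating_apply hF.contDiffAt _

end InvariantPolynomials

/-! ### Combinatorics of antisymmetrization -/

section Alternation

/-- Reindexing by the even permutation `c`, or by its square, does not change the signed sum. So
three times this sum is the signed sum of the cyclic expression in `h`, which vanishes. -/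
lemma sum_sign_smul_eq_zero {N : ℕ} {α : Type*} (G : (Fin N → α) → ℝ) (c : Equiv.Perm (Fin N))
    (hc : Equiv.Perm.sign c = 1) (h : ∀ w, G w + G (w ∘ c) + G (w ∘ c ∘ c) = 0) (v : Fin N → α) :
    ∑ τ : Equiv.Perm (Fin N), Equiv.Perm.sign τ • G (v ∘ τ) = 0 := by
  have e1 : ∑ τ : Equiv.Perm (Fin N), Equiv.Perm.sign τ • G ((v ∘ τ) ∘ c) =
      ∑ τ : Equiv.Perm (Fin N), Equiv.Perm.sign τ • G (v ∘ τ) := by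
    rw [← Equiv.sum_comp (Equiv.mulRight c)
      fun τ : Equiv.Perm (Fin N) => Equiv.Perm.sign τ • G (v ∘ τ)]
    refine Finset.sum_congr rfl fun τ _ => ?_
    simp [hc, Function.comp_assoc]
  have e2 : ∑ τ : Equiv.Perm (Fin N), Equiv.Perm.sign τ • G ((v ∘ τ) ∘ c ∘ c) =
      ∑ τ : Equiv.Perm (Fin N), Equiv.Perm.sign τ • G (v ∘ τ) := by
    rw [← Equiv.sum_comp (Equiv.mulRight (c * c))
      fun τ : Equiv.Perm (Fin N) => Equiv.Perm.sign τ • G (v ∘ τ)]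
    refine Finset.sum_congr rfl fun τ _ => ?_
    simp [hc, Function.comp_assoc]
  have e3 : ∑ τ : Equiv.Perm (Fin N), (Equiv.Perm.sign τ • G (v ∘ τ) +
      Equiv.Perm.sign τ • G ((v ∘ τ) ∘ c) + Equiv.Perm.sign τ • G ((v ∘ τ) ∘ c ∘ c)) = 0 := by
    refine Finset.sum_eq_zero fun τ _ => ?_
    rw [← smul_add, ← smul_add, h, smul_zero]
  rw [Finset.sum_add_distrib, Finset.sum_add_distrib, e1, e2] at e3
  linarith

/-- A permutation of `N + 1` indices amounts to the image `a` of `0` and a permutation of the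
remaining indices; moving `a` to the front costs the sign `(-1)ᵃ`. This merges the alternation in
`d` with that in the form. -/
lemma sum_perm_succ {N : ℕ} {α : Type*} (g : α → (Fin N → α) → ℝ) (v : Fin (N + 1) → α) :
    ∑ a : Fin (N + 1), (-1 : ℝ) ^ (a : ℕ) * ∑ σ : Equiv.Perm (Fin N),
      Equiv.Perm.sign σ • g (v a) (a.removeNth v ∘ σ) =
    ∑ τ : Equiv.Perm (Fin (N + 1)), Equiv.Perm.sign τ • g ((v ∘ τ) 0) ((v ∘ τ) ∘ Fin.succ) := by
  simp only [Finset.mul_sum]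
  rw [← Fintype.sum_prod_type']
  let T : Fin (N + 1) × Equiv.Perm (Fin N) → Equiv.Perm (Fin (N + 1)) := fun x =>
    x.1.cycleRange.symm * Equiv.Perm.decomposeFin.symm (0, x.2)
  have h0 (x) : T x 0 = x.1 := by simp [T]
  have hs (x) (i : Fin N) : T x i.succ = x.1.succAbove (x.2 i) := by simp [T]
  have hinj : Function.Injective T := by
    rintro ⟨a, σ⟩ ⟨b, σ'⟩ h
    obtain rfl : a = b := by simpa only [h0] using congrArg (fun τ : Equiv.Perm (Fin (N + 1)) => τ 0) h
    congr 1
    ext i : 1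
    have := congrArg (fun τ : Equiv.Perm (Fin (N + 1)) => τ i.succ) h
    simp only [hs] at this
    exact Fin.succAbove_right_injective this
  have hbij : Function.Bijective T := (Fintype.bijective_iff_injective_and_card _).2
    ⟨hinj, by simp [Fintype.card_perm, Nat.factorial_succ]⟩
  refine Fintype.sum_bijective T hbij _ _ fun x => ?_
  have hsign : Equiv.Perm.sign (T x) = (-1) ^ (x.1 : ℕ) * Equiv.Perm.sign x.2 := by
    simp only [T]
    rw [Equiv.Perm.sign_mul, Equiv.Perm.sign_symm, Fin.sign_cycleRange,
      Equiv.Perm.decomposeFin.symm_sign]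
    simp
  have hv : (v ∘ T x) ∘ Fin.succ = x.1.removeNth v ∘ x.2 := by
    funext i
    simp [hs, Fin.removeNth]
  rw [hv, Function.comp_apply, h0, hsign]
  simp [Units.smul_def, mul_assoc]

end Alternation

/-! ### Closedness of the characteristic form on the total space -/

section Closed

variable {d : ℕ} {G : Type*} [TopologicalSpace G] [ChartedSpace (𝔼 d) G] [Group G]
  [LieGroup (𝓡 d) ∞ G] {k n : ℕ} (f : InvariantPolynomial d G k)

/-- The Leibniz rule gives one term for each slot `j`. Antisymmetrizing over all `2k + 1` arguments
includes the cyclic sum over the direction of differentiation and the two arguments of slot `j`, and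
this sum vanishes by `hB`. -/
lemma extDeriv_polyForm_eq_zero {F : 𝔼 n → 𝔼 n [⋀^Fin 2]→L[ℝ] LieAlg d} {u : 𝔼 n}
    (hF : ContDiff ℝ ∞ F) (hB : ∀ x y z : 𝔼 n, fderiv ℝ F u x ![y, z] +
      fderiv ℝ F u y ![z, x] + fderiv ℝ F u z ![x, y] = 0) :
    extDeriv (fun w => polyForm f (F w)) u = 0 := by
  have hd := (contDiff_polyForm f hF).differentiable (by simp) u
  set e := finProdFinEquiv.trans (finCongr (Nat.mul_comm k 2)) with he
  have evalL (v : Fin 2 → 𝔼 n) : ∃ l : (𝔼 n [⋀^Fin 2]→L[ℝ] LieAlg d) →L[ℝ] LieAlg d,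
      ∀ F, l F = F v := ⟨LinearMap.toContinuousLinearMap
        { toFun := fun F => F v, map_add' := fun _ _ => rfl, map_smul' := fun _ _ => rfl },
        fun _ => rfl⟩
  have evalL' (v : Fin (2 * k) → 𝔼 n) : ∃ l : (𝔼 n [⋀^Fin (2 * k)]→L[ℝ] ℝ) →L[ℝ] ℝ,
      ∀ F, l F = F v := ⟨LinearMap.toContinuousLinearMap
        { toFun := fun F => F v, map_add' := fun _ _ => rfl, map_smul' := fun _ _ => rfl },
        fun _ => rfl⟩
  -- The Leibniz term in which the `j`-th factor is differentiated in the direction `x`.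
  let g (j : Fin k) (x : 𝔼 n) (v : Fin (2 * k) → 𝔼 n) : ℝ :=
    f.toMap (Function.update (fun i => F u fun b => v (e (i, b))) j
      (fderiv ℝ F u x fun b => v (e (j, b))))
  have hDF (v : Fin 2 → 𝔼 n) : HasFDerivAt (fun w => F w v)
      ((evalL v).choose.comp (fderiv ℝ F u)) u := by
    have := (evalL v).choose.hasFDerivAt.comp u (hF.differentiable (by simp) u).hasFDerivAt
    refine this.congr_of_eventuallyEq (Eventually.of_forall fun w => ?_)
    exact ((evalL v).choose_spec _).symm
  have hD (x : 𝔼 n) (v : Fin (2 * k) → 𝔼 n) :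
      fderiv ℝ (fun w => polyForm f (F w)) u x v =
        ((2 : ℝ) ^ k)⁻¹ * ∑ σ : Equiv.Perm (Fin (2 * k)), Equiv.Perm.sign σ •
          ∑ j, g j x (v ∘ σ) := by
    obtain ⟨l, hl⟩ := evalL' v
    have h1 := l.hasFDerivAt.comp u hd.hasFDerivAt
    have h2 : HasFDerivAt (fun w => ((2 : ℝ) ^ k)⁻¹ * ∑ σ : Equiv.Perm (Fin (2 * k)),
        Equiv.Perm.sign σ • f.toMap fun i => F w fun b => v (σ (e (i, b))))
        (((2 : ℝ) ^ k)⁻¹ • ∑ σ : Equiv.Perm (Fin (2 * k)), Equiv.Perm.sign σ •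
          ((f.toMap.linearDeriv fun i => F u fun b => v (σ (e (i, b)))).comp
            (ContinuousLinearMap.pi fun i => (evalL fun b => v (σ (e (i, b)))).choose.comp
              (fderiv ℝ F u)))) u := by
      refine HasFDerivAt.const_mul (HasFDerivAt.fun_sum fun σ _ => HasFDerivAt.const_smul ?_ _) _
      exact (f.toMap.hasFDerivAt _).comp u (hasFDerivAt_pi.2 fun i => hDF _)
    have h3 : (l ∘ fun w => polyForm f (F w)) = fun w => ((2 : ℝ) ^ k)⁻¹ *
        ∑ σ : Equiv.Perm (Fin (2 * k)),
        Equiv.Perm.sign σ • f.toMap fun i => F w fun b => v (σ (e (i, b))) := by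
      funext w
      rw [Function.comp_apply, hl, polyForm_apply]
    have h4 := congrArg (fun L : 𝔼 n →L[ℝ] ℝ => L x) ((h3 ▸ h1).unique h2)
    simp only [ContinuousLinearMap.comp_apply, hl] at h4
    rw [h4]
    simp [g, ContinuousMultilinearMap.linearDeriv_apply, (evalL _).choose_spec]
  ext v
  rw [extDeriv, ContinuousAlternatingMap.alternatizeUncurryFin_apply]
  have e1 : ∑ a : Fin (2 * k + 1), (-1 : ℤ) ^ (a : ℕ) •
      fderiv ℝ (fun w => polyForm f (F w)) u (v a) (a.removeNth v) = ((2 : ℝ) ^ k)⁻¹ *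
        ∑ j, ∑ a : Fin (2 * k + 1), (-1 : ℝ) ^ (a : ℕ) * ∑ σ : Equiv.Perm (Fin (2 * k)),
          Equiv.Perm.sign σ • g j (v a) (a.removeNth v ∘ σ) := by
    rw [Finset.sum_comm, Finset.mul_sum]
    refine Finset.sum_congr rfl fun a _ => ?_
    rw [hD, zsmul_eq_mul, mul_left_comm, ← Finset.mul_sum, Finset.sum_comm]
    simp only [Finset.smul_sum]
    push_cast
    rfl
  refine e1.trans ?_
  rw [Finset.sum_eq_zero, mul_zero]
  · rfl
  intro j _
  rw [sum_perm_succ]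
  -- The positions of the two arguments of slot `j`, shifted by one because position `0` holds the
  -- direction of differentiation.
  set s₀ : Fin (2 * k + 1) := (e (j, 0)).succ with hs₀
  set s₁ : Fin (2 * k + 1) := (e (j, 1)).succ with hs₁
  have h01 : s₀ ≠ s₁ := by simp [hs₀, hs₁]
  have h0 : (0 : Fin (2 * k + 1)) ≠ s₀ := (Fin.succ_ne_zero _).symm
  have h1 : (0 : Fin (2 * k + 1)) ≠ s₁ := (Fin.succ_ne_zero _).symm
  -- The even permutation is the three-cycle `0 → s₀ → s₁ → 0`, which leaves the arguments of all
  -- other slots in place.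
  refine sum_sign_smul_eq_zero (fun w => g j (w 0) (w ∘ Fin.succ))
    (Equiv.swap 0 s₀ * Equiv.swap s₀ s₁) ?_ (fun w => ?_) v
  · rw [Equiv.Perm.sign_mul, Equiv.Perm.sign_swap h0, Equiv.Perm.sign_swap h01]
    rfl
  set c := Equiv.swap 0 s₀ * Equiv.swap s₀ s₁ with hc
  have c0 : c 0 = s₀ := by
    rw [hc, Equiv.Perm.mul_apply, Equiv.swap_apply_of_ne_of_ne h0 h1, Equiv.swap_apply_left]
  have c1 : c s₀ = s₁ := by
    rw [hc, Equiv.Perm.mul_apply, Equiv.swap_apply_left, Equiv.swap_apply_of_ne_of_ne h1.symm h01.symm]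
  have c2 : c s₁ = 0 := by
    rw [hc, Equiv.Perm.mul_apply, Equiv.swap_apply_right, Equiv.swap_apply_right]
  have c3 (i : Fin k) (hi : i ≠ j) (b : Fin 2) : c (e (i, b)).succ = (e (i, b)).succ := by
    have n0 : (e (i, b)).succ ≠ s₀ := by simp [hs₀, hi]
    have n1 : (e (i, b)).succ ≠ s₁ := by simp [hs₁, hi]
    rw [hc, Equiv.Perm.mul_apply, Equiv.swap_apply_of_ne_of_ne n0 n1,
      Equiv.swap_apply_of_ne_of_ne (Fin.succ_ne_zero _) n0]
  have key (w w' : Fin (2 * k + 1) → 𝔼 n)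
      (hw : ∀ i ≠ j, ∀ b, w' (e (i, b)).succ = w (e (i, b)).succ) :
      g j (w' 0) (w' ∘ Fin.succ) = f.toMap (Function.update
        (fun i => F u fun b => w (e (i, b)).succ) j
        (fderiv ℝ F u (w' 0) ![w' s₀, w' s₁])) := by
    simp only [g]
    congr 1
    funext i
    by_cases hi : i = j
    · subst hi
      simp only [Function.update_self]
      congr 1
      funext b
      fin_cases b <;> rfl
    · simp only [Function.update_of_ne hi, Function.comp_apply, hw i hi]
  rw [key w w (fun _ _ _ => rfl), key w (w ∘ c) (fun i hi b => by simp [c3 i hi]),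
    key w (w ∘ c ∘ c) (fun i hi b => by simp [c3 i hi])]
  simp only [Function.comp_apply, c0, c1, c2]
  rw [← f.toMap.map_update_add, ← f.toMap.map_update_add, hB]
  exact f.toMap.map_coord_zero j (by simp)

variable {E : Type*} [NormedAddCommGroup E] [NormedSpace ℝ E] {H : Type*} [TopologicalSpace H]
  {I : ModelWithCorners ℝ E H} {X : Type*} [TopologicalSpace X] [ChartedSpace H X]
  {Q : GBundle d G I X} {A : OneForm Q.Total Q.diffeology (LieAlg d)}

/-- The form `f(F, …, F)` is closed. At a given point one may assume that the connection form
vanishes, after a gauge transformation. -/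
lemma IsConnection.extDeriv_polyForm_curvature (hA : IsConnection Q A) {p : 𝔼 n → Q.Total}
    (hp : p ∈ Q.diffeology.plots n) (u : 𝔼 n) :
    extDeriv (fun w => polyForm f (curvature Q A p w)) u = 0 := by
  -- Since `h(u) = 1`, the transformed potential at `u` is `A + h⁻¹dh`; the prescribed value of
  -- `h⁻¹dh` makes it zero.
  obtain ⟨h, hh, hu, hmc⟩ := exists_mc_eq (d := d) (G := G) u (-A.toFun p u)
  set p' := fun w => Q.act (p w) (h w) with hp'
  have hp's : p' ∈ Q.diffeology.plots n := Q.act_smooth hp hh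
  have e : (fun w => polyForm f (curvature Q A p w)) = fun w => polyForm f (curvature Q A p' w) := by
    funext w
    exact (polyForm_eq_of_Ad f (h w)⁻¹ (hA.curvature_act hp hh w)).symm
  rw [e]
  set α := A.toFun p' with hα
  have hα0 : α u = 0 := by
    rw [hα, hA.toFun_act hp hh, hu, hmc, inv_one, Ad_one, ContinuousLinearMap.id_comp,
      add_neg_cancel]
  have hαs : ContDiff ℝ ∞ α := A.smooth hp's
  have hα1 : ContDiff ℝ ∞ (fderiv ℝ α) := hαs.fderiv_right (by simp)
  refine extDeriv_polyForm_eq_zero f (contDiff_curvature hp's) ?_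
  have hsymm : IsSymmSndFDerivAt ℝ α u := hαs.contDiffAt.isSymmSndFDerivAt (by
    rw [minSmoothness_of_isRCLikeNormedField]
    exact WithTop.coe_le_coe.mpr (le_top : (2 : ℕ∞) ≤ ⊤))
  have key (x y z : 𝔼 n) : fderiv ℝ (curvature Q A p') u x ![y, z] =
      fderiv ℝ (fderiv ℝ α) u x y z - fderiv ℝ (fderiv ℝ α) u x z y := by
    obtain ⟨l, hl⟩ : ∃ l : (𝔼 n [⋀^Fin 2]→L[ℝ] LieAlg d) →L[ℝ] LieAlg d,
      ∀ F, l F = F ![y, z] := ⟨LinearMap.toContinuousLinearMap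
        { toFun := fun F => F ![y, z], map_add' := fun _ _ => rfl, map_smul' := fun _ _ => rfl },
        fun _ => rfl⟩
    have h1 := l.hasFDerivAt.comp u
      ((contDiff_curvature (A := A) hp's).differentiable (by simp) u).hasFDerivAt
    have h3 : l ∘ (curvature Q A p') = fun w => fderiv ℝ α w y z - fderiv ℝ α w z y +
        lieBMultilinear d G (fun b => α w (![y, z] b)) := by
      funext w
      rw [Function.comp_apply, hl, curvature_apply hp's]
      rfl
    have hα2 : HasFDerivAt (fderiv ℝ α) (fderiv ℝ (fderiv ℝ α) u) u :=
      (hα1.differentiable (by simp) u).hasFDerivAt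
    have hf1 (y z : 𝔼 n) := (hα2.clm_apply
      (hasFDerivAt_const y u)).clm_apply (hasFDerivAt_const z u)
    -- The bracket is bilinear in `α` and `α(u) = 0`, so its first derivative at `u` vanishes.
    have hf2 : HasFDerivAt (𝕜 := ℝ) (fun w : 𝔼 n =>
        lieBMultilinear d G (fun b => α w (![y, z] b))) (0 : 𝔼 n →L[ℝ] LieAlg d) u := by
      have h5 : HasFDerivAt (fun w (b : Fin 2) => α w (![y, z] b)) _ u :=
        hasFDerivAt_pi.2 fun b => (ContinuousLinearMap.apply ℝ (LieAlg d)
          (![y, z] b)).hasFDerivAt.comp u (hαs.differentiable (by simp) u).hasFDerivAt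
      have h6 := ((lieBMultilinear d G).hasFDerivAt (fun b => α u (![y, z] b))).comp u h5
      have h7 : (lieBMultilinear d G).linearDeriv (fun b => α u (![y, z] b)) = 0 := by
        ext w
        rw [ContinuousMultilinearMap.linearDeriv_apply]
        simp only [hα0]
        rw [Fin.sum_univ_two, (lieBMultilinear d G).map_coord_zero (1 : Fin 2) (by simp),
          (lieBMultilinear d G).map_coord_zero (0 : Fin 2) (by simp)]
        simp
      rw [h7, ContinuousLinearMap.zero_comp] at h6
      exact h6
    have h4 := congrArg (fun L : 𝔼 n →L[ℝ] LieAlg d => L x)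
      ((h3 ▸ h1).unique (((hf1 y z).sub (hf1 z y)).add hf2))
    simp only [ContinuousLinearMap.comp_apply, hl] at h4
    rw [h4]
    simp
  intro x y z
  -- What remains of the Bianchi identity is `d(dα) = 0`.
  rw [key, key, key, hsymm.eq x y, hsymm.eq x z, hsymm.eq y z]
  abel

end Closed

/-! ### Descent of the characteristic form to the base -/

section ChernWeil

variable {d : ℕ} {G : Type*} [TopologicalSpace G] [ChartedSpace (𝔼 d) G] [Group G]
  [LieGroup (𝓡 d) ∞ G]
  {E : Type*} [NormedAddCommGroup E] [NormedSpace ℝ E] [FiniteDimensional ℝ E]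
  {H : Type*} [TopologicalSpace H]
  {I : ModelWithCorners ℝ E H} [I.Boundaryless]
  {X : Type*} [TopologicalSpace X] [ChartedSpace H X] [IsManifold I ∞ X]

/-- A local section of a bundle near `x`, extended to a smooth map on a Euclidean space. -/
lemma exists_local_section (Q : GBundle d G I X) (x : X) :
    ∃ (N : ℕ) (W : Set X) (σ : 𝔼 N → Q.Total) (φ : X → 𝔼 N), IsOpen W ∧ x ∈ W ∧
      σ ∈ Q.diffeology.plots N ∧ ContMDiffOn I (𝓡 N) ∞ φ W ∧ (∀ y ∈ W, Q.proj (σ (φ y)) = y) ∧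
      ∀ {n : ℕ} {p : 𝔼 n → Q.Total}, p ∈ Q.diffeology.plots n → ∀ u, Q.proj (p u) ∈ W →
        ∃ (f : 𝔼 n → 𝔼 N) (h : 𝔼 n → G), ContDiff ℝ ∞ f ∧ ContMDiff (𝓡 n) (𝓡 d) ∞ h ∧
          f =ᶠ[𝓝 u] (fun w => φ (Q.proj (p w))) ∧ p =ᶠ[𝓝 u] fun w => Q.act (σ (f w)) (h w) := by
  obtain ⟨U, s, τ, hU, hxU, h1, h2, h3, h4, h5⟩ := Q.locally_trivial x
  -- The model space `E` is only known to be finite-dimensional, while plots need a Euclidean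
  -- source.
  let e : E ≃L[ℝ] 𝔼 (Module.finrank ℝ E) := toEuclidean
  set c := extChartAt I x with hc
  set φ : X → 𝔼 (Module.finrank ℝ E) := fun y => e (c y) with hφ
  set T : Set (𝔼 (Module.finrank ℝ E)) := e.symm ⁻¹' (c.target ∩ c.symm ⁻¹' U) with hT
  have hTo : IsOpen T := ((continuousOn_extChartAt_symm x).isOpen_inter_preimage
    (isOpen_extChartAt_target x) hU).preimage e.symm.continuous
  have hxT : φ x ∈ T := by
    simp only [hT, hφ, mem_preimage, e.symm_apply_apply]
    refine ⟨mem_extChartAt_target x, ?_⟩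
    rw [mem_preimage, hc, extChartAt_to_inv]
    exact hxU
  -- The map `r` into the coordinate domain makes the local section a globally defined plot; `W`
  -- below is the region where `r` is the identity in coordinates.
  obtain ⟨r, hr, hrT, hrx⟩ := exists_smooth_retract hTo hxT
  have hrs : ContMDiff (𝓡 _) I ∞ fun z => c.symm (e.symm (r z)) := fun z =>
    ContMDiffAt.comp (g := c.symm) z ((contMDiffOn_extChartAt_symm (n := ∞) x).contMDiffAt
      ((isOpen_extChartAt_target x).mem_nhds (hrT z).1)) (e.symm.contDiff.comp hr).contMDiff.contMDiffAt
  set W := c.source ∩ φ ⁻¹' interior {z | r z = z} with hW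
  have hφc : ContinuousOn φ c.source := e.continuous.comp_continuousOn (continuousOn_extChartAt x)
  have hφs : ContMDiffOn I (𝓡 _) ∞ φ c.source :=
    e.contDiff.contMDiff.comp_contMDiffOn
      (by rw [hc, extChartAt_source]; exact contMDiffOn_extChartAt)
  have hrW {y : X} (hy : y ∈ W) : r (φ y) = φ y :=
    interior_subset (s := {z | r z = z}) hy.2
  have hσ {y : X} (hy : y ∈ W) : c.symm (e.symm (r (φ y))) = y := by
    rw [hrW hy, hφ]
    simp only [e.symm_apply_apply]
    exact c.left_inv hy.1
  have hWU {y : X} (hy : y ∈ W) : y ∈ U := by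
    have := (hrT (φ y)).2
    rwa [mem_preimage, hσ hy] at this
  refine ⟨Module.finrank ℝ E, W, fun z => s (c.symm (e.symm (r z))), φ,
    hφc.isOpen_inter_preimage (isOpen_extChartAt_source x) isOpen_interior,
    ⟨mem_extChartAt_source x, mem_interior_iff_mem_nhds.2 hrx⟩,
    h4 (p := fun z => c.symm (e.symm (r z))) hrs fun z => (hrT z).2,
    hφs.mono inter_subset_left, fun y hy => ?_, fun {n p} hp u hu => ?_⟩
  · simp only [hσ hy]
    exact h1 y (hWU hy)
  · have hps : ContMDiff (𝓡 n) I ∞ fun w => Q.proj (p w) := Q.proj_smooth hp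
    have hWo : IsOpen W :=
      hφc.isOpen_inter_preimage (isOpen_extChartAt_source x) isOpen_interior
    -- The transition function is smooth only over `W`; replacing `p` by `p ∘ ρ` makes it global
    -- without changing it near `u`.
    obtain ⟨ρ, hρ, hρW, hρu⟩ := exists_smooth_retract (hWo.preimage hps.continuous) hu
    have hpρ := Q.diffeology.plot_reparam hp hρ
    refine ⟨fun w => φ (Q.proj (p (ρ w))), fun w => τ (p (ρ w)), ?_, ?_, ?_, ?_⟩
    · rw [← contMDiff_iff_contDiff]
      intro w
      exact ContMDiffAt.comp (g := φ) (f := fun w => Q.proj (p (ρ w))) w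
        (hφs.contMDiffAt ((isOpen_extChartAt_source x).mem_nhds (hρW w).1))
        ((hps.comp hρ.contMDiff) w)
    · exact h5 hpρ fun w => hWU (hρW w)
    · filter_upwards [hρu] with w hw
      rw [hw]
    · filter_upwards [hρu] with w hw
      have hw' : Q.proj (p w) ∈ W := by
        have := hρW w
        rwa [hw] at this
      simp only [hw]
      rw [hσ hw', h2 _ (hWU hw')]

lemma formPullback_eq_mder {E' : Type*} [NormedAddCommGroup E'] [NormedSpace ℝ E']
    {H' : Type*} [TopologicalSpace H'] {J : ModelWithCorners ℝ E' H'}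
    {N : Type*} [TopologicalSpace N] [ChartedSpace H' N] {q : ℕ} (ψ : N → X) (α : MForm E X q)
    (y : N) : formPullback I J ψ α y = (α (ψ y)).compContinuousLinearMap (mder J I ψ y) := rfl

lemma compContinuousLinearMap_comp {E₁ E₂ E₃ V : Type*} [NormedAddCommGroup E₁] [NormedSpace ℝ E₁]
    [NormedAddCommGroup E₂] [NormedSpace ℝ E₂] [NormedAddCommGroup E₃] [NormedSpace ℝ E₃]
    [NormedAddCommGroup V] [NormedSpace ℝ V] {q : ℕ}
    (α : E₃ [⋀^Fin q]→L[ℝ] V) (L : E₂ →L[ℝ] E₃) (L' : E₁ →L[ℝ] E₂) :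
    (α.compContinuousLinearMap L).compContinuousLinearMap L' =
      α.compContinuousLinearMap (L.comp L') := rfl

lemma compContinuousLinearMap_id {E₁ V : Type*} [NormedAddCommGroup E₁] [NormedSpace ℝ E₁]
    [NormedAddCommGroup V] [NormedSpace ℝ V] {q : ℕ} (α : E₁ [⋀^Fin q]→L[ℝ] V) :
    α.compContinuousLinearMap (ContinuousLinearMap.id ℝ E₁) = α := rfl

lemma mdifferentiableAt_proj (Q : GBundle d G I X) {n : ℕ} {p : 𝔼 n → Q.Total}
    (hp : p ∈ Q.diffeology.plots n) (u : 𝔼 n) :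
    MDifferentiableAt (𝓡 n) I (fun w => Q.proj (p w)) u :=
  (show ContMDiff (𝓡 n) I ∞ (fun w => Q.proj (p w)) from Q.proj_smooth hp).mdifferentiableAt
    (by simp)

lemma mder_proj_section (Q : GBundle d G I X) {N : ℕ} {W : Set X} (hW : IsOpen W)
    {σ : 𝔼 N → Q.Total} {φ : X → 𝔼 N} (hσ : σ ∈ Q.diffeology.plots N)
    (hφ : ContMDiffOn I (𝓡 N) ∞ φ W) (hσφ : ∀ y ∈ W, Q.proj (σ (φ y)) = y) {y : X} (hy : y ∈ W) :
    (mder (𝓡 N) I (fun z => Q.proj (σ z)) (φ y)).comp (mder I (𝓡 N) φ y) =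
      ContinuousLinearMap.id ℝ E := by
  rw [← mder_comp rfl (mdifferentiableAt_proj Q hσ _)
    ((hφ.contMDiffAt (hW.mem_nhds hy)).mdifferentiableAt (by simp)),
    mder_congr (f' := fun z => z) (by filter_upwards [hW.mem_nhds hy] with z hz using hσφ z hz),
    mder_id]

/-- Forms on the base of a bundle are determined by their pullbacks to the total space. -/
lemma form_ext (Q : GBundle d G I X) {q : ℕ} {α β : MForm E X q}
    (h : ∀ {n : ℕ} {p : 𝔼 n → Q.Total}, p ∈ Q.diffeology.plots n →
      formPullback I (𝓡 n) (fun w => Q.proj (p w)) α =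
        formPullback I (𝓡 n) (fun w => Q.proj (p w)) β) : α = β := by
  funext x
  obtain ⟨N, W, σ, φ, hW, hx, hσ, hφ, hσφ, -⟩ := exists_local_section Q x
  have h1 := congrArg (fun a : 𝔼 N [⋀^Fin q]→L[ℝ] ℝ =>
    a.compContinuousLinearMap (mder I (𝓡 N) φ x)) (congrFun (h hσ) (φ x))
  simp only [formPullback_eq_mder, compContinuousLinearMap_comp,
    mder_proj_section Q hW hσ hφ hσφ hx, compContinuousLinearMap_id, hσφ x hx] at h1
  exact h1

lemma isChernWeilForm_unique {k : ℕ} {f : InvariantPolynomial d G k} {Q : GBundle d G I X}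
    {A : OneForm Q.Total Q.diffeology (LieAlg d)} {β β' : MForm E X (2 * k)}
    (h : IsChernWeilForm f Q A β) (h' : IsChernWeilForm f Q A β') : β = β' :=
  form_ext Q fun hp => funext fun u => (h.2 hp u).trans (h'.2 hp u).symm

lemma formD_eq_zero_of_extDeriv {n q : ℕ} {α : MForm (𝔼 n) (𝔼 n) q}
    (h : ∀ u, extDeriv (α : 𝔼 n → 𝔼 n [⋀^Fin q]→L[ℝ] ℝ) u = 0) : formD (𝓡 n) α = 0 := by
  have e (u : 𝔼 n) : formInChart (𝓡 n) α u = α := by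
    funext w
    rw [formInChart, formPullback_eq_mder]
    simp only [extChartAt_model_space_eq_id, PartialEquiv.refl_symm, PartialEquiv.refl_coe]
    exact congrArg _ (mder_id (I₁ := 𝓡 n) w)
  funext u
  rw [formD, e, h]
  rfl

/-- Pullback commutes with `d` and is injective on forms, so closedness is checked on the total
space. -/
lemma IsChernWeilForm.formD_eq_zero {k : ℕ} {f : InvariantPolynomial d G k} {Q : GBundle d G I X}
    {A : OneForm Q.Total Q.diffeology (LieAlg d)} (hA : IsConnection Q A) {β : MForm E X (2 * k)}
    (h : IsChernWeilForm f Q A β) : formD I β = 0 := by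
  refine form_ext Q fun {n p} hp => ?_
  rw [← formD_pullback h.1 (show ContMDiff (𝓡 n) I ∞ fun w => Q.proj (p w) from Q.proj_smooth hp)]
  refine (formD_eq_zero_of_extDeriv fun u => ?_).trans ?_
  · have e : formPullback I (𝓡 n) (fun w => Q.proj (p w)) β =
        fun w => polyForm f (curvature Q A p w) := funext (h.2 hp)
    rw [e]
    exact hA.extDeriv_polyForm_curvature f hp u
  · funext u
    ext v
    rfl

/-- Existence of the Chern-Weil form. -/
lemma IsConnection.exists_isChernWeilForm {k : ℕ} (f : InvariantPolynomial d G k)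
    {Q : GBundle d G I X} {A : OneForm Q.Total Q.diffeology (LieAlg d)} (hA : IsConnection Q A) :
    ∃ β, IsChernWeilForm f Q A β := by
  choose N W σ φ hW hx hσ hφ hσφ hp using exists_local_section Q
  let γ (x : X) (z : 𝔼 (N x)) := polyForm f (curvature Q A (σ x) z)
  -- At each point `x` the form is computed from the section chosen at that same `x`.
  let β : MForm E X (2 * k) := fun x =>
    (γ x (φ x x)).compContinuousLinearMap (mder I (𝓡 (N x)) (φ x) x)
  have hφd (x : X) {y : X} (hy : y ∈ W x) : MDifferentiableAt I (𝓡 (N x)) (φ x) y :=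
    ((hφ x).contMDiffAt ((hW x).mem_nhds hy)).mdifferentiableAt (by simp)
  -- Near `u` the plot is the section moved by a gauge transformation `h`, which the invariant
  -- polynomial ignores; so any section defined near the point gives the same result.
  have key (x : X) {n : ℕ} {p : 𝔼 n → Q.Total} (hpp : p ∈ Q.diffeology.plots n) (u : 𝔼 n)
      (hu : Q.proj (p u) ∈ W x) : polyForm f (curvature Q A p u) =
        ((γ x (φ x (Q.proj (p u)))).compContinuousLinearMap
          (mder I (𝓡 (N x)) (φ x) (Q.proj (p u)))).compContinuousLinearMap
            (mder (𝓡 n) I (fun w => Q.proj (p w)) u) := by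
    obtain ⟨g, h, hg, hh, hgφ, hpg⟩ := hp x hpp u hu
    have hσg : (fun w => σ x (g w)) ∈ Q.diffeology.plots n := Q.diffeology.plot_reparam (hσ x) hg
    rw [curvature_congr hpp (Q.act_smooth hσg hh) hpg,
      polyForm_eq_of_Ad f (h u)⁻¹ (hA.curvature_act hσg hh u), curvature_comp (hσ x) hg,
      polyForm_comp, compContinuousLinearMap_comp, ← mder_comp (f := fun w => Q.proj (p w)) rfl (hφd x hu)
        (mdifferentiableAt_proj Q hpp u), ← mder_congr hgφ, mder_eq_fderiv]
    simp only [γ]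
    rw [hgφ.self_of_nhds]
  have hcw {n : ℕ} {p : 𝔼 n → Q.Total} (hpp : p ∈ Q.diffeology.plots n) (u : 𝔼 n) :
      formPullback I (𝓡 n) (fun w => Q.proj (p w)) β u = polyForm f (curvature Q A p u) :=
    (key (Q.proj (p u)) hpp u (hx _)).symm
  -- On all of `W x` the pointwise choices agree with the single section at `x`; smoothness follows.
  have hβ (x : X) {y : X} (hy : y ∈ W x) :
      β y = (γ x (φ x y)).compContinuousLinearMap (mder I (𝓡 (N x)) (φ x) y) := by
    have h1 := hcw (hσ x) (φ x y)
    rw [formPullback_eq_mder, hσφ x y hy] at h1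
    simp only [γ]
    rw [← h1, compContinuousLinearMap_comp, mder_proj_section Q (hW x) (hσ x) (hφ x) (hσφ x) hy,
      compContinuousLinearMap_id]
  refine ⟨β, fun x₀ y hy => ContDiffAt.contDiffWithinAt ?_, hcw⟩
  set c := extChartAt I x₀ with hc
  set z := c.symm y with hz
  have hcs : ContMDiffAt 𝓘(ℝ, E) I ∞ c.symm y :=
    (contMDiffOn_extChartAt_symm (n := ∞) x₀).contMDiffAt
      ((isOpen_extChartAt_target x₀).mem_nhds hy)
  have hφc : ContDiffAt ℝ ∞ (fun w => φ z (c.symm w)) y := by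
    rw [← contMDiffAt_iff_contDiffAt]
    exact ((hφ z).contMDiffAt ((hW z).mem_nhds (hx z))).comp y hcs
  have h1 : ContDiffAt ℝ ∞ (fun w => γ z (φ z (c.symm w))) y :=
    (contDiff_polyForm f (contDiff_curvature (hσ z))).contDiffAt.comp y hφc
  refine (contDiffAt_compContinuousLinearMap h1
    (hφc.fderiv_right (m := ∞) (by simp))).congr_of_eventuallyEq ?_
  filter_upwards [(isOpen_extChartAt_target x₀).mem_nhds hy,
    hcs.continuousAt.preimage_mem_nhds ((hW z).mem_nhds (hx z))] with w hw hw'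
  have hw' : c.symm w ∈ W z := hw'
  rw [formInChart, formPullback_eq_mder, hβ z hw', compContinuousLinearMap_comp,
    ← mder_comp rfl (hφd z hw') (mdifferentiableAt_extChartAt_symm hw), mder_eq_fderiv]

end ChernWeil

/-! ### Integrals depending on a parameter and the local homotopy formula -/

section ParametricIntegral

universe w

variable {E : Type w} [NormedAddCommGroup E] [NormedSpace ℝ E] [FiniteDimensional ℝ E]
  {V : Type w} [NormedAddCommGroup V] [NormedSpace ℝ V] [CompleteSpace V]

lemma continuous_slice {Y : Type*} [TopologicalSpace Y] {F : E × ℝ → Y} {s : Set E} (hF : ContinuousOn F (s ×ˢ univ)) {x : E}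
    (hx : x ∈ s) : Continuous fun t => F (x, t) :=
  hF.comp_continuous (by fun_prop) fun t => ⟨hx, mem_univ t⟩

/-- Differentiation under the integral sign; the dominating constant comes from compactness of a
closed ball times the interval. -/
lemma hasFDerivAt_integral_slice {F : E × ℝ → V} {s : Set E} (hs : IsOpen s)
    (hF : ContDiffOn ℝ ∞ F (s ×ˢ univ)) (a b : ℝ) {x : E} (hx : x ∈ s) :
    HasFDerivAt (fun y => ∫ t in a..b, F (y, t))
      (∫ t in a..b, (fderiv ℝ F (x, t)).comp (ContinuousLinearMap.inl ℝ E ℝ)) x := by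
  have hso : IsOpen (s ×ˢ (univ : Set ℝ)) := hs.prod isOpen_univ
  have hF' : ContinuousOn (fun z => (fderiv ℝ F z).comp (ContinuousLinearMap.inl ℝ E ℝ))
      (s ×ˢ univ) :=
    (hF.continuousOn_fderiv_of_isOpen hso (by simp)).clm_comp continuousOn_const
  obtain ⟨ε, hε, hεs⟩ := Metric.nhds_basis_closedBall.mem_iff.1 (hs.mem_nhds hx)
  obtain ⟨C, hC⟩ := ((isCompact_closedBall x ε).prod (isCompact_uIcc (a := a) (b := b)))
    |>.exists_bound_of_continuousOn (hF'.mono (prod_mono hεs (subset_univ _)))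
  refine (intervalIntegral.hasFDerivAt_integral_of_dominated_of_fderiv_le
    (F' := fun y t => (fderiv ℝ F (y, t)).comp (ContinuousLinearMap.inl ℝ E ℝ))
    (bound := fun _ => C) (Metric.ball_mem_nhds x hε) ?_ ?_ ?_ ?_ ?_ ?_)
  · filter_upwards [hs.mem_nhds hx] with y hy
    exact (continuous_slice hF.continuousOn hy).aestronglyMeasurable
  · exact (continuous_slice hF.continuousOn hx).intervalIntegrable _ _
  · exact (continuous_slice hF' hx).aestronglyMeasurable
  · refine MeasureTheory.ae_of_all _ fun t ht y hy => hC (y, t) ⟨Metric.ball_subset_closedBall hy, ?_⟩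
    exact uIoc_subset_uIcc ht
  · exact intervalIntegrable_const
  · refine MeasureTheory.ae_of_all _ fun t ht y hy => ?_
    have h1 : HasFDerivAt F (fderiv ℝ F (y, t)) (y, t) :=
      ((hF.contDiffAt (hso.mem_nhds ⟨hεs (Metric.ball_subset_closedBall hy), mem_univ t⟩)).differentiableAt
        (by simp)).hasFDerivAt
    exact h1.comp y (hasFDerivAt_prodMk_left y t)

/-- The derivative is again such an integral, with values in `E →L[ℝ] V`. The target therefore
varies in the induction, and `E` and `V` share a universe. -/
lemma contDiffOn_integral_slice_nat (n : ℕ) : ∀ {V : Type w} [NormedAddCommGroup V]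
    [NormedSpace ℝ V] [CompleteSpace V] {F : E × ℝ → V} {s : Set E} (_ : IsOpen s)
    (_ : ContDiffOn ℝ ∞ F (s ×ˢ univ)) (a b : ℝ),
    ContDiffOn ℝ n (fun y => ∫ t in a..b, F (y, t)) s := by
  induction n with
  | zero =>
    intro V _ _ _ F s hs hF a b
    exact contDiffOn_zero.2 fun x hx =>
      (hasFDerivAt_integral_slice hs hF a b hx).continuousAt.continuousWithinAt
  | succ n ih =>
    intro V _ _ _ F s hs hF a b
    have hso : IsOpen (s ×ˢ (univ : Set ℝ)) := hs.prod isOpen_univ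
    rw [show ((n + 1 : ℕ) : WithTop ℕ∞) = (n : WithTop ℕ∞) + 1 by norm_cast,
      contDiffOn_succ_iff_fderiv_of_isOpen hs]
    refine ⟨fun x hx => (hasFDerivAt_integral_slice hs hF a b
      hx).differentiableAt.differentiableWithinAt, by simp, ?_⟩
    have h1 := ih (F := fun z => (fderiv ℝ F z).comp (ContinuousLinearMap.inl ℝ E ℝ)) hs
      ((hF.fderiv_of_isOpen hso (m := ∞) (by simp)).clm_comp contDiffOn_const) a b
    exact h1.congr fun x hx => (hasFDerivAt_integral_slice hs hF a b hx).fderiv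

lemma contDiffOn_integral_slice {F : E × ℝ → V} {s : Set E} (hs : IsOpen s)
    (hF : ContDiffOn ℝ ∞ F (s ×ˢ univ)) (a b : ℝ) :
    ContDiffOn ℝ ∞ (fun y => ∫ t in a..b, F (y, t)) s :=
  contDiffOn_infty.2 fun n => contDiffOn_integral_slice_nat n hs hF a b

variable (E) in
/-- Contraction of forms on `E × ℝ` with `∂_t`, restricted to `E`. -/
def contractT (q : ℕ) : ((E × ℝ) [⋀^Fin (q + 1)]→L[ℝ] ℝ) →L[ℝ] E [⋀^Fin q]→L[ℝ] ℝ :=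
  LinearMap.toContinuousLinearMap
    { toFun := fun f => (f.curryLeft (0, 1)).compContinuousLinearMap
        (ContinuousLinearMap.inl ℝ E ℝ)
      map_add' := fun _ _ => rfl
      map_smul' := fun _ _ => rfl }

lemma contractT_apply {q : ℕ} (f : (E × ℝ) [⋀^Fin (q + 1)]→L[ℝ] ℝ) (v : Fin q → E) :
    contractT E q f v = f (Fin.cons (0, 1) fun i => (v i, 0)) := rfl

lemma contractT_comp {q : ℕ} {E' : Type*} [NormedAddCommGroup E'] [NormedSpace ℝ E']
    [FiniteDimensional ℝ E'] (f : (E × ℝ) [⋀^Fin (q + 1)]→L[ℝ] ℝ) (L : E' →L[ℝ] E) :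
    contractT E' q (f.compContinuousLinearMap (L.prodMap (ContinuousLinearMap.id ℝ ℝ))) =
      (contractT E q f).compContinuousLinearMap L := by
  ext v
  rw [ContinuousAlternatingMap.compContinuousLinearMap_apply, contractT_apply, contractT_apply,
    ContinuousAlternatingMap.compContinuousLinearMap_apply]
  congr 1
  funext i
  refine Fin.cases ?_ (fun i => ?_) i <;> simp

/-- Evaluation of alternating forms as a continuous linear map. -/
def evalL {q : ℕ} (v : Fin q → E) : (E [⋀^Fin q]→L[ℝ] ℝ) →L[ℝ] ℝ :=
  LinearMap.toContinuousLinearMap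
    { toFun := fun f => f v, map_add' := fun _ _ => rfl, map_smul' := fun _ _ => rfl }

lemma evalL_apply {q : ℕ} (v : Fin q → E) (f : E [⋀^Fin q]→L[ℝ] ℝ) : evalL v f = f v := rfl

/-- The homotopy formula for forms on `s × ℝ`, for an open subset `s` of `E`. -/
lemma integral_contractT_extDeriv {q : ℕ} {β : E × ℝ → (E × ℝ) [⋀^Fin (q + 1)]→L[ℝ] ℝ} {s : Set E}
    (hs : IsOpen s) (hβ : ContDiffOn ℝ ∞ β (s ×ˢ univ)) (a b : ℝ) {x : E} (hx : x ∈ s) :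
    ∫ t in a..b, contractT E (q + 1) (extDeriv β (x, t)) =
      (β (x, b)).compContinuousLinearMap (ContinuousLinearMap.inl ℝ E ℝ) -
        (β (x, a)).compContinuousLinearMap (ContinuousLinearMap.inl ℝ E ℝ) -
        extDeriv (fun y => ∫ t in a..b, contractT E q (β (y, t))) x := by
  have hso : IsOpen (s ×ˢ (univ : Set ℝ)) := hs.prod isOpen_univ
  have hβ' : ContinuousOn (fderiv ℝ β) (s ×ˢ univ) :=
    hβ.continuousOn_fderiv_of_isOpen hso (by simp)
  have hd (t : ℝ) : DifferentiableAt ℝ β (x, t) :=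
    (hβ.contDiffAt (hso.mem_nhds ⟨hx, mem_univ t⟩)).differentiableAt (by simp)
  have hcont (z : E × ℝ) (v : Fin (q + 1) → E × ℝ) :
      Continuous fun t => fderiv ℝ β (x, t) z v := by
    have := (evalL v).continuous.comp ((continuous_slice hβ' hx).clm_apply
      (continuous_const (y := z)))
    exact this
  have hext (t : ℝ) (v : Fin (q + 2) → E × ℝ) : extDeriv β (x, t) v =
      ∑ i : Fin (q + 2), (-1 : ℝ) ^ (i : ℕ) * fderiv ℝ β (x, t) (v i) (i.removeNth v) := by
    rw [extDeriv, ContinuousAlternatingMap.alternatizeUncurryFin_apply]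
    refine Finset.sum_congr rfl fun i _ => ?_
    rw [zsmul_eq_mul]
    push_cast
    rfl
  have hexts (v : Fin (q + 2) → E × ℝ) : Continuous fun t => extDeriv β (x, t) v := by
    simp only [hext]
    exact continuous_finsetSum _ fun i _ => continuous_const.mul (hcont _ _)
  have hextc : Continuous fun t => extDeriv β (x, t) := by
    have h1 : Continuous fun t => fderiv ℝ β (x, t) := continuous_slice hβ' hx
    exact (ContinuousAlternatingMap.alternatizeUncurryFinCLM ℝ (E × ℝ) ℝ).continuous.comp h1
  have hK := hasFDerivAt_integral_slice (F := fun z => contractT E q (β z)) hs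
    ((contractT E q).contDiff.comp_contDiffOn hβ) a b hx
  have hfK (t : ℝ) : fderiv ℝ (fun z => contractT E q (β z)) (x, t) =
      (contractT E q).comp (fderiv ℝ β (x, t)) :=
    ((contractT E q).hasFDerivAt.comp (x, t) (hd t).hasFDerivAt).fderiv
  simp only [hfK] at hK
  have hint1 : Continuous fun t => ((contractT E q).comp (fderiv ℝ β (x, t))).comp
      (ContinuousLinearMap.inl ℝ E ℝ) :=
    ((continuous_const).clm_comp (continuous_slice hβ' hx)).clm_comp continuous_const
  have hKv (w : E) (v : Fin q → E) :
      fderiv ℝ (fun y => ∫ t in a..b, contractT E q (β (y, t))) x w v =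
        ∫ t in a..b, fderiv ℝ β (x, t) (w, 0) (Fin.cons (0, 1) fun i => (v i, 0)) := by
    rw [hK.fderiv, ← evalL_apply, ContinuousLinearMap.intervalIntegral_apply
      (hint1.intervalIntegrable _ _), ← ContinuousLinearMap.intervalIntegral_comp_comm]
    · rfl
    · exact (hint1.clm_apply continuous_const).intervalIntegrable _ _
  have hcc : Continuous fun t => contractT E (q + 1) (extDeriv β (x, t)) :=
    (contractT E (q + 1)).continuous.comp hextc
  ext v
  rw [← evalL_apply v, ← ContinuousLinearMap.intervalIntegral_comp_comm _
    (hcc.intervalIntegrable _ _)]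
  -- The summand that differentiates along `∂_t` is split off and integrates to the boundary terms.
  -- The others give `d` of the contracted form with a minus sign, since `∂_t` in front shifts their
  -- index by one.
  simp only [evalL_apply, contractT_apply, hext, Fin.sum_univ_succ (n := q + 1)]
  rw [intervalIntegral.integral_add, intervalIntegral.integral_finsetSum]
  · have hftc : ∫ t in a..b, fderiv ℝ β (x, t) (0, 1) (fun i => (v i, (0 : ℝ))) =
        β (x, b) (fun i => (v i, 0)) - β (x, a) (fun i => (v i, 0)) := by
      refine intervalIntegral.integral_eq_sub_of_hasDerivAt
        (f := fun t => β (x, t) (fun i => (v i, 0))) (fun t _ => ?_)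
        ((hcont _ _).intervalIntegrable _ _)
      have h1 : HasDerivAt (fun t : ℝ => (x, t)) ((0 : E), (1 : ℝ)) t :=
        (hasDerivAt_const t x).prodMk (hasDerivAt_id t)
      exact (evalL fun i => (v i, (0 : ℝ))).hasFDerivAt.comp_hasDerivAt t
        ((hd t).hasFDerivAt.comp_hasDerivAt t h1)
    have hextK : extDeriv (fun y => ∫ t in a..b, contractT E q (β (y, t))) x v =
        ∑ i : Fin (q + 1), (-1 : ℝ) ^ (i : ℕ) *
          ∫ t in a..b, fderiv ℝ β (x, t) (v i, 0) (Fin.cons (0, 1) fun j => (i.removeNth v j, 0)) := by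
      rw [extDeriv, ContinuousAlternatingMap.alternatizeUncurryFin_apply]
      refine Finset.sum_congr rfl fun i _ => ?_
      rw [zsmul_eq_mul, hKv]
      push_cast
      rfl
    change _ = β (x, b) (fun i => (v i, 0)) - β (x, a) (fun i => (v i, 0)) -
      extDeriv (fun y => ∫ t in a..b, contractT E q (β (y, t))) x v
    rw [← hftc, hextK, sub_eq_add_neg, ← Finset.sum_neg_distrib]
    congr 1
    · refine intervalIntegral.integral_congr fun t _ => ?_
      simp
    · refine Finset.sum_congr rfl fun i _ => ?_
      rw [← neg_mul, ← intervalIntegral.integral_const_mul]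
      refine intervalIntegral.integral_congr fun t _ => ?_
      have : Fin.removeNth (α := fun _ => E × ℝ) i.succ
          (Fin.cons (α := fun _ => E × ℝ) ((0 : E), (1 : ℝ)) fun i => (v i, (0 : ℝ))) =
          Fin.cons (α := fun _ => E × ℝ) (0, 1) fun j => (i.removeNth v j, 0) := by
        funext j
        refine Fin.cases ?_ (fun j => ?_) j
        · simp [Fin.removeNth]
        · simp [Fin.removeNth]
      simp only [this]
      simp [pow_succ]
  · exact fun i _ => (continuous_const.mul (hcont _ _)).intervalIntegrable _ _
  · exact (continuous_const.mul (hcont _ _)).intervalIntegrable _ _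
  · exact (continuous_finsetSum _ fun i _ =>
      continuous_const.mul (hcont _ _)).intervalIntegrable _ _

end ParametricIntegral

/-! ### The homotopy formula on `X × ℝ` -/

section FiberIntegral

universe w

variable {E : Type w} [NormedAddCommGroup E] [NormedSpace ℝ E] [FiniteDimensional ℝ E]
  {H : Type*} [TopologicalSpace H] {I : ModelWithCorners ℝ E H} [I.Boundaryless]
  {X : Type*} [TopologicalSpace X] [ChartedSpace H X] [IsManifold I ∞ X]

/-- Integration of forms on `X × ℝ` over the interval from `a` to `b`. -/
def integralT (a b : ℝ) {q : ℕ} (β : MForm (E × ℝ) (X × ℝ) (q + 1)) : MForm E X q :=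
  fun x => ∫ t in a..b, contractT E q (β (x, t))

/-- Precomposition of alternating forms with a linear map, as a continuous linear map. -/
def precompL {E' : Type*} [NormedAddCommGroup E'] [NormedSpace ℝ E'] (q : ℕ) (L : E' →L[ℝ] E) :
    (E [⋀^Fin q]→L[ℝ] ℝ) →L[ℝ] E' [⋀^Fin q]→L[ℝ] ℝ :=
  LinearMap.toContinuousLinearMap
    { toFun := fun f => f.compContinuousLinearMap L
      map_add' := fun _ _ => rfl
      map_smul' := fun _ _ => rfl }

lemma precompL_apply {E' : Type*} [NormedAddCommGroup E'] [NormedSpace ℝ E'] {q : ℕ}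
    (L : E' →L[ℝ] E) (f : E [⋀^Fin q]→L[ℝ] ℝ) : precompL q L f = f.compContinuousLinearMap L := rfl

lemma extChartAt_prod_real (x : X) (t : ℝ) : extChartAt (I.prod 𝓘(ℝ, ℝ)) (x, t) =
    (extChartAt I x).prod (PartialEquiv.refl ℝ) := by
  rw [extChartAt_prod, extChartAt_model_space_eq_id]

lemma formInChart_prod_real {q : ℕ} (β : MForm (E × ℝ) (X × ℝ) q) (x : X) (t : ℝ) :
    formInChart (I.prod 𝓘(ℝ, ℝ)) β (x, t) = formInChart (I.prod 𝓘(ℝ, ℝ)) β (x, 0) := by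
  simp only [formInChart, extChartAt_prod_real]
  rfl

lemma mder_prodMap_id {E' H' : Type*} [NormedAddCommGroup E'] [NormedSpace ℝ E']
    [TopologicalSpace H'] {J : ModelWithCorners ℝ E' H'} {Y : Type*} [TopologicalSpace Y]
    [ChartedSpace H' Y] {f : X → Y} {x : X} (hf : MDifferentiableAt I J f x) (t : ℝ) :
    mder (I.prod 𝓘(ℝ, ℝ)) (J.prod 𝓘(ℝ, ℝ)) (fun z : X × ℝ => (f z.1, z.2)) (x, t) =
      (mder I J f x).prodMap (ContinuousLinearMap.id ℝ ℝ) := by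
  have := mfderiv_prodMap (p := (x, t)) hf (mdifferentiableAt_id (I := 𝓘(ℝ, ℝ)) (x := t))
  rw [mfderiv_id] at this
  exact this

/-- Charts of `X × ℝ` are charts of `X` times the identity, so they respect `∂_t` and the splitting
of tangent vectors. -/
lemma contractT_formInChart {q : ℕ} (β : MForm (E × ℝ) (X × ℝ) (q + 1)) (x : X) {y : E}
    (hy : y ∈ (extChartAt I x).target) (t : ℝ) :
    contractT E q (formInChart (I.prod 𝓘(ℝ, ℝ)) β (x, 0) (y, t)) =
      (contractT E q (β ((extChartAt I x).symm y, t))).compContinuousLinearMap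
        (mder 𝓘(ℝ, E) I (extChartAt I x).symm y) := by
  rw [← contractT_comp, ← mder_prodMap_id (mdifferentiableAt_extChartAt_symm hy), formInChart,
    extChartAt_prod_real, modelWithCornersSelf_prod, ← chartedSpaceSelf_prod]
  rfl

lemma mder_chart_comp_symm (x : X) {y : E} (hy : y ∈ (extChartAt I x).target) :
    (mder 𝓘(ℝ, E) I (extChartAt I x).symm y).comp
      (mder I 𝓘(ℝ, E) (extChartAt I x) ((extChartAt I x).symm y)) =
      ContinuousLinearMap.id ℝ E := by
  have hs := (extChartAt I x).map_target hy
  rw [← mder_comp ((extChartAt I x).right_inv hy) (mdifferentiableAt_extChartAt_symm hy)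
    (mdifferentiableAt_extChartAt (by rwa [extChartAt_source] at hs)),
    mder_congr (f' := fun z => z), mder_id]
  filter_upwards [(isOpen_extChartAt_source (I := I) x).mem_nhds hs] with z hz
  exact (extChartAt I x).left_inv hz

lemma IsSmoothForm.contDiffOn_prod_real {q : ℕ} {β : MForm (E × ℝ) (X × ℝ) q}
    (hβ : IsSmoothForm (I.prod 𝓘(ℝ, ℝ)) β) (x : X) :
    ContDiffOn ℝ ∞ (formInChart (I.prod 𝓘(ℝ, ℝ)) β (x, 0)) ((extChartAt I x).target ×ˢ univ) := by
  have := hβ (x, 0)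
  rw [extChartAt_prod_real] at this
  exact this

lemma continuous_contractT {q : ℕ} {β : MForm (E × ℝ) (X × ℝ) (q + 1)}
    (hβ : IsSmoothForm (I.prod 𝓘(ℝ, ℝ)) β) (x : X) :
    Continuous fun t => contractT E q (β (x, t)) := by
  have hx := mem_extChartAt_target (I := I) x
  have h1 : Continuous fun t => precompL q (mder I 𝓘(ℝ, E) (extChartAt I x) x)
      (contractT E q (formInChart (I.prod 𝓘(ℝ, ℝ)) β (x, 0) (extChartAt I x x, t))) :=
    (precompL q _).continuous.comp ((contractT E q).continuous.comp
      (continuous_slice (hβ.contDiffOn_prod_real x).continuousOn hx))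
  convert h1 using 2 with t
  have h2 := mder_chart_comp_symm (I := I) x hx
  rw [extChartAt_to_inv] at h2
  rw [contractT_formInChart β x hx, precompL_apply, compContinuousLinearMap_comp, h2,
    compContinuousLinearMap_id, extChartAt_to_inv]

/-- Reduces smoothness and the homotopy formula on `X × ℝ` to open subsets of a vector space. -/
lemma formInChart_integralT {q : ℕ} {β : MForm (E × ℝ) (X × ℝ) (q + 1)}
    (hβ : IsSmoothForm (I.prod 𝓘(ℝ, ℝ)) β) (a b : ℝ) (x : X) {y : E}
    (hy : y ∈ (extChartAt I x).target) :
    formInChart I (integralT a b β) x y =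
      ∫ t in a..b, contractT E q (formInChart (I.prod 𝓘(ℝ, ℝ)) β (x, 0) (y, t)) := by
  simp only [contractT_formInChart β x hy, ← precompL_apply]
  rw [ContinuousLinearMap.intervalIntegral_comp_comm _
    ((continuous_contractT hβ _).intervalIntegrable _ _)]
  rfl

lemma IsSmoothForm.integralT {q : ℕ} {β : MForm (E × ℝ) (X × ℝ) (q + 1)}
    (hβ : IsSmoothForm (I.prod 𝓘(ℝ, ℝ)) β) (a b : ℝ) : IsSmoothForm I (integralT a b β) := by
  intro x
  refine (contDiffOn_integral_slice (F := fun z => contractT E q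
    (formInChart (I.prod 𝓘(ℝ, ℝ)) β (x, 0) z)) (isOpen_extChartAt_target x)
    ((contractT E q).contDiff.comp_contDiffOn (hβ.contDiffOn_prod_real x)) a b).congr ?_
  exact fun y hy => formInChart_integralT hβ a b x hy

/-- The homotopy formula. -/
lemma integralT_formD {q : ℕ} {β : MForm (E × ℝ) (X × ℝ) (q + 1)}
    (hβ : IsSmoothForm (I.prod 𝓘(ℝ, ℝ)) β) (a b : ℝ) :
    integralT a b (formD (I.prod 𝓘(ℝ, ℝ)) β) =
      formPullback (I.prod 𝓘(ℝ, ℝ)) I (fun x : X => (x, b)) β -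
        formPullback (I.prod 𝓘(ℝ, ℝ)) I (fun x : X => (x, a)) β - formD I (integralT a b β) := by
  funext x
  set c := extChartAt I x with hc
  set β' := formInChart (I.prod 𝓘(ℝ, ℝ)) β (x, 0) with hβ'
  set L := mder I 𝓘(ℝ, E) c x with hL
  have hx := mem_extChartAt_target (I := I) x
  have hso := (isOpen_extChartAt_target (I := I) x)
  have hβs := hβ.contDiffOn_prod_real x
  have hLs : (mder 𝓘(ℝ, E) I c.symm (c x)).comp L = ContinuousLinearMap.id ℝ E := by
    have := mder_chart_comp_symm (I := I) x hx
    rwa [extChartAt_to_inv] at this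
  have hD (t : ℝ) : formD (I.prod 𝓘(ℝ, ℝ)) β (x, t) =
      (extDeriv β' (c x, t)).compContinuousLinearMap
        (L.prodMap (ContinuousLinearMap.id ℝ ℝ)) := by
    rw [formD, formInChart_prod_real, extChartAt_prod_real, hL,
      ← mder_prodMap_id (mdifferentiableAt_extChartAt (mem_chart_source _ x)),
      modelWithCornersSelf_prod, ← chartedSpaceSelf_prod]
    rfl
  have hB (t : ℝ) : ((β' (c x, t)).compContinuousLinearMap
      (ContinuousLinearMap.inl ℝ E ℝ)).compContinuousLinearMap L =
        formPullback (I.prod 𝓘(ℝ, ℝ)) I (fun x : X => (x, t)) β x := by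
    have h1 : β' (c x, t) = (β (x, t)).compContinuousLinearMap
        ((mder 𝓘(ℝ, E) I c.symm (c x)).prodMap (ContinuousLinearMap.id ℝ ℝ)) := by
      have h3 : (((extChartAt I x).prod (PartialEquiv.refl ℝ)).symm (c x, t)) = (x, t) :=
        Prod.ext (extChartAt_to_inv x) rfl
      rw [← h3, hβ', formInChart, extChartAt_prod_real,
        ← mder_prodMap_id (mdifferentiableAt_extChartAt_symm hx), modelWithCornersSelf_prod,
        ← chartedSpaceSelf_prod]
      rfl
    have h2 : mder I (I.prod 𝓘(ℝ, ℝ)) (fun x : X => (x, t)) x = ContinuousLinearMap.inl ℝ E ℝ := by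
      rw [mder_prodMk (f := fun z : X => z) (g := fun _ => t) mdifferentiableAt_id
        mdifferentiableAt_const, mder_const, mder_id]
      rfl
    rw [formPullback_eq_mder, h1, h2, compContinuousLinearMap_comp, compContinuousLinearMap_comp]
    congr 1
    ext v
    · exact congrArg (fun l : E →L[ℝ] E => l v) hLs
    · simp
  have hcont : Continuous fun t => contractT E (q + 1) (extDeriv β' (c x, t)) := by
    have h1 : Continuous fun t => fderiv ℝ β' (c x, t) :=
      continuous_slice (hβs.continuousOn_fderiv_of_isOpen (hso.prod isOpen_univ) (by simp)) hx
    exact (contractT E (q + 1)).continuous.comp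
      ((ContinuousAlternatingMap.alternatizeUncurryFinCLM ℝ (E × ℝ) ℝ).continuous.comp h1)
  have hK : extDeriv (formInChart I (Caloron.integralT a b β) x) (c x) =
      extDeriv (fun y => ∫ t in a..b, contractT E q (β' (y, t))) (c x) := by
    refine Filter.EventuallyEq.extDeriv_eq ?_
    filter_upwards [hso.mem_nhds hx] with y hy
    exact formInChart_integralT hβ a b x hy
  have hfinal : Caloron.integralT a b (formD (I.prod 𝓘(ℝ, ℝ)) β) x =
      precompL (q + 1) L (∫ t in a..b, contractT E (q + 1) (extDeriv β' (c x, t))) := by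
    rw [← ContinuousLinearMap.intervalIntegral_comp_comm _ (hcont.intervalIntegrable _ _)]
    simp only [Caloron.integralT, hD, contractT_comp, precompL_apply]
  rw [hfinal, integral_contractT_extDeriv hso hβs a b hx, map_sub, map_sub, precompL_apply,
    precompL_apply, precompL_apply, hB, hB, ← hK]
  rfl

end FiberIntegral

/-! ### Integration over the circle -/

section CircleIntegral

lemma curryLeft_comp_eq_contractT {E F : Type*} [NormedAddCommGroup E] [NormedSpace ℝ E]
    [FiniteDimensional ℝ E] [NormedAddCommGroup F] [NormedSpace ℝ F] {q : ℕ}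
    (f : F [⋀^Fin (q + 1)]→L[ℝ] ℝ) {D : E × ℝ →L[ℝ] F} {w : F} {L : E →L[ℝ] F} (hw : w = D (0, 1))
    (hL : ∀ v, L v = D (v, 0)) : (f.curryLeft w).compContinuousLinearMap L =
      contractT E q (f.compContinuousLinearMap D) := by
  ext v
  rw [contractT_apply, ContinuousAlternatingMap.compContinuousLinearMap_apply,
    ContinuousAlternatingMap.compContinuousLinearMap_apply,
    ContinuousAlternatingMap.curryLeft_apply_apply]
  refine congrArg f (funext fun i => ?_)
  refine Fin.cases ?_ (fun i => ?_) i
  · exact hw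
  · exact hL (v i)

lemma integralT_pullback {m l : ℕ} {M : Type*} [TopologicalSpace M] [ChartedSpace (𝔼 m) M]
    [IsManifold (𝓡 m) ∞ M] {N : Type*} [TopologicalSpace N] [ChartedSpace (𝔼 l) N]
    [IsManifold (𝓡 l) ∞ N] {q : ℕ} {β : MForm (𝔼 m × ℝ) (M × ℝ) (q + 1)}
    (hβ : IsSmoothForm ((𝓡 m).prod 𝓘(ℝ, ℝ)) β) (a b : ℝ) {ψ : N → M}
    (hψ : ContMDiff (𝓡 l) (𝓡 m) ∞ ψ) :
    formPullback (𝓡 m) (𝓡 l) ψ (integralT a b β) =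
      integralT a b (formPullback ((𝓡 m).prod 𝓘(ℝ, ℝ)) ((𝓡 l).prod 𝓘(ℝ, ℝ))
        (fun z : N × ℝ => (ψ z.1, z.2)) β) := by
  funext x
  have h1 (t : ℝ) : contractT (𝔼 l) q (formPullback ((𝓡 m).prod 𝓘(ℝ, ℝ)) ((𝓡 l).prod 𝓘(ℝ, ℝ))
      (fun z : N × ℝ => (ψ z.1, z.2)) β (x, t)) =
      precompL q (mder (𝓡 l) (𝓡 m) ψ x) (contractT (𝔼 m) q (β (ψ x, t))) := by
    rw [formPullback_eq_mder, mder_prodMap_id (hψ.mdifferentiableAt (by simp)), contractT_comp]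
    rfl
  simp only [integralT, h1]
  rw [ContinuousLinearMap.intervalIntegral_comp_comm _
    ((continuous_contractT hβ _).intervalIntegrable _ _)]
  rfl

variable {m : ℕ} {M : Type*} [TopologicalSpace M] [ChartedSpace (𝔼 m) M] [IsManifold (𝓡 m) ∞ M]

variable (M) in
/-- The covering map `M × ℝ → M × S¹`. -/
def circleCover (z : M × ℝ) : M × Circle := (z.1, Circle.exp z.2)

lemma contMDiff_circleCover : ContMDiff ((𝓡 m).prod 𝓘(ℝ, ℝ)) ((𝓡 m).prod (𝓡 1)) ∞
    (circleCover M) :=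
  contMDiff_fst.prodMk (contMDiff_circleExp.comp contMDiff_snd)

/-- The pullback of a form on `M × S¹` to `M × ℝ`. -/
def coverPullback {q : ℕ} (β : MForm (𝔼 m × 𝔼 1) (M × Circle) q) : MForm (𝔼 m × ℝ) (M × ℝ) q :=
  formPullback ((𝓡 m).prod (𝓡 1)) ((𝓡 m).prod 𝓘(ℝ, ℝ)) (circleCover M) β

lemma IsSmoothForm.coverPullback {q : ℕ} {β : MForm (𝔼 m × 𝔼 1) (M × Circle) q}
    (hβ : IsSmoothForm ((𝓡 m).prod (𝓡 1)) β) :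
    IsSmoothForm ((𝓡 m).prod 𝓘(ℝ, ℝ)) (coverPullback β) :=
  hβ.pullback contMDiff_circleCover

lemma contractT_coverPullback {q : ℕ} (β : MForm (𝔼 m × 𝔼 1) (M × Circle) (q + 1)) (x : M)
    (t : ℝ) : fiberContraction β x t =
      (-1 : ℝ) ^ q • contractT (𝔼 m) q (coverPullback β (x, t)) := by
  have hd := (contMDiff_circleCover (m := m) (M := M)).mdifferentiableAt (x := (x, t)) (by simp)
  have h1 : mder 𝓘(ℝ, ℝ) ((𝓡 m).prod (𝓡 1)) (fun s : ℝ => (x, Circle.exp s)) t 1 =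
      mder ((𝓡 m).prod 𝓘(ℝ, ℝ)) ((𝓡 m).prod (𝓡 1)) (circleCover M) (x, t) (0, 1) := by
    have := mder_comp (g := circleCover M) (f := fun s : ℝ => (x, s)) (x := t) rfl hd
      (mdifferentiableAt_const.prodMk mdifferentiableAt_id)
    rw [mder_prodMk (f := fun _ : ℝ => x) (g := fun s : ℝ => s) mdifferentiableAt_const
      mdifferentiableAt_id, mder_const, mder_id] at this
    exact congrArg (fun l : ℝ →L[ℝ] 𝔼 m × 𝔼 1 => l 1) this
  have h2 (v : 𝔼 m) : mder (𝓡 m) ((𝓡 m).prod (𝓡 1)) (fun y : M => (y, Circle.exp t)) x v =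
      mder ((𝓡 m).prod 𝓘(ℝ, ℝ)) ((𝓡 m).prod (𝓡 1)) (circleCover M) (x, t) (v, 0) := by
    have := mder_comp (g := circleCover M) (f := fun y : M => (y, t)) (x := x) rfl hd
      (mdifferentiableAt_id.prodMk mdifferentiableAt_const)
    rw [mder_prodMk (f := fun y : M => y) (g := fun _ => t) mdifferentiableAt_id
      mdifferentiableAt_const, mder_const, mder_id] at this
    exact congrArg (fun l : 𝔼 m →L[ℝ] 𝔼 m × 𝔼 1 => l v) this
  exact congrArg ((-1 : ℝ) ^ q • ·) (curryLeft_comp_eq_contractT _ h1 h2)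

/-- Fibre integration becomes integration over one period of the pullback to `M × ℝ`; the sign moves
`∂_θ` from the last slot to the first. -/
lemma fiberIntegral_eq {q : ℕ} (β : MForm (𝔼 m × 𝔼 1) (M × Circle) (q + 1)) :
    fiberIntegral β = (-1 : ℝ) ^ q • integralT 0 (2 * Real.pi) (coverPullback β) := by
  funext x
  change ∫ t in (0 : ℝ)..(2 * Real.pi), fiberContraction β x t = (-1 : ℝ) ^ q • ∫ t in _.._, _
  simp only [contractT_coverPullback, intervalIntegral.integral_smul]

lemma IsSmoothForm.fiberIntegral {q : ℕ} {β : MForm (𝔼 m × 𝔼 1) (M × Circle) (q + 1)}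
    (hβ : IsSmoothForm ((𝓡 m).prod (𝓡 1)) β) : IsSmoothForm (𝓡 m) (fiberIntegral β) := by
  rw [fiberIntegral_eq]
  exact (hβ.coverPullback.integralT _ _).smul _

lemma fiberIntegral_sub {q : ℕ} {β β' : MForm (𝔼 m × 𝔼 1) (M × Circle) (q + 1)}
    (hβ : IsSmoothForm ((𝓡 m).prod (𝓡 1)) β) (hβ' : IsSmoothForm ((𝓡 m).prod (𝓡 1)) β') :
    fiberIntegral (β - β') = fiberIntegral β - fiberIntegral β' := by
  simp only [fiberIntegral_eq, ← smul_sub]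
  congr 1
  funext x
  refine Eq.trans ?_ (intervalIntegral.integral_sub
    ((continuous_contractT hβ.coverPullback x).intervalIntegrable _ _)
    ((continuous_contractT hβ'.coverPullback x).intervalIntegrable _ _))
  refine intervalIntegral.integral_congr fun t _ => ?_
  have h : coverPullback (β - β') (x, t) = coverPullback β (x, t) - coverPullback β' (x, t) := rfl
  exact (congrArg (contractT (𝔼 m) q) h).trans
    ((contractT (𝔼 m) q).map_sub (coverPullback β (x, t)) (coverPullback β' (x, t)))

/-- The homotopy formula over one period: a closed fibre contributes no boundary term. -/
lemma fiberIntegral_formD {q : ℕ} {β : MForm (𝔼 m × 𝔼 1) (M × Circle) (q + 1)}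
    (hβ : IsSmoothForm ((𝓡 m).prod (𝓡 1)) β) :
    fiberIntegral (formD ((𝓡 m).prod (𝓡 1)) β) = formD (𝓡 m) (fiberIntegral β) := by
  have h0 (t : ℝ) : formPullback ((𝓡 m).prod 𝓘(ℝ, ℝ)) (𝓡 m) (fun x : M => (x, t))
      (coverPullback β) =
        formPullback ((𝓡 m).prod (𝓡 1)) (𝓡 m) (fun x : M => (x, Circle.exp t)) β := by
    funext x
    have hc : ContMDiff (𝓡 m) ((𝓡 m).prod 𝓘(ℝ, ℝ)) ∞ fun x : M => (x, t) :=
      contMDiff_id.prodMk contMDiff_const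
    exact (formPullback_comp (ψ := circleCover M) (χ := fun x : M => (x, t)) β
      (contMDiff_circleCover.mdifferentiableAt (by simp)) (hc.mdifferentiableAt (by simp))).symm
  have h2 : Caloron.coverPullback (formD ((𝓡 m).prod (𝓡 1)) β) =
      formD ((𝓡 m).prod 𝓘(ℝ, ℝ)) (Caloron.coverPullback β) :=
    (formD_pullback hβ contMDiff_circleCover).symm
  rw [fiberIntegral_eq, fiberIntegral_eq, formD_smul, h2]
  have h1 := integralT_formD hβ.coverPullback 0 (2 * Real.pi)
  -- The restrictions to `t = 0` and `t = 2π` come from the same slice of `M × S¹`.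
  rw [h0, h0, Circle.exp_two_pi, Circle.exp_zero, sub_self, zero_sub] at h1
  refine (congrArg ((-1 : ℝ) ^ (q + 1) • ·) h1).trans ?_
  -- The minus sign of the homotopy formula is absorbed by the change of normalization from `(-1)^q`
  -- to `(-1)^(q+1)`.
  rw [pow_succ, mul_neg_one, neg_smul, smul_neg, neg_neg]

lemma fiberIntegral_mem_closedForms {q : ℕ} {β : MForm (𝔼 m × 𝔼 1) (M × Circle) (q + 1)}
    (hβ : IsSmoothForm ((𝓡 m).prod (𝓡 1)) β) (hd : formD ((𝓡 m).prod (𝓡 1)) β = 0) :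
    fiberIntegral β ∈ closedForms (𝓡 m) M q := by
  refine ⟨hβ.fiberIntegral, ?_⟩
  rw [← fiberIntegral_formD hβ, hd, fiberIntegral_eq]
  funext x
  refine (congrArg ((-1 : ℝ) ^ (q + 1) • ·) ?_).trans (smul_zero _)
  refine (intervalIntegral.integral_congr (g := fun _ => 0) fun t _ => ?_).trans
    intervalIntegral.integral_zero
  exact map_zero (contractT (𝔼 m) (q + 1))

/-- The map `ψ × id` is compatible with the covering by `ℝ` and does not move the angle. -/
lemma fiberIntegral_pullback {l : ℕ} {N : Type*} [TopologicalSpace N] [ChartedSpace (𝔼 l) N]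
    [IsManifold (𝓡 l) ∞ N] {q : ℕ} {β : MForm (𝔼 m × 𝔼 1) (M × Circle) (q + 1)}
    (hβ : IsSmoothForm ((𝓡 m).prod (𝓡 1)) β) {ψ : N → M} (hψ : ContMDiff (𝓡 l) (𝓡 m) ∞ ψ) :
    formPullback (𝓡 m) (𝓡 l) ψ (fiberIntegral β) =
      fiberIntegral (formPullback ((𝓡 m).prod (𝓡 1)) ((𝓡 l).prod (𝓡 1))
        (fun z : N × Circle => (ψ z.1, z.2)) β) := by
  rw [fiberIntegral_eq, fiberIntegral_eq]
  change (-1 : ℝ) ^ q • formPullback (𝓡 m) (𝓡 l) ψ (integralT _ _ _) = _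
  rw [integralT_pullback hβ.coverPullback _ _ hψ]
  congr 2
  funext z
  have h1 : ContMDiff ((𝓡 l).prod (𝓡 1)) ((𝓡 m).prod (𝓡 1)) ∞
      (fun z : N × Circle => (ψ z.1, z.2)) := (hψ.comp contMDiff_fst).prodMk contMDiff_snd
  have h2 : ContMDiff ((𝓡 l).prod 𝓘(ℝ, ℝ)) ((𝓡 m).prod 𝓘(ℝ, ℝ)) ∞
      (fun z : N × ℝ => (ψ z.1, z.2)) := (hψ.comp contMDiff_fst).prodMk contMDiff_snd
  exact (formPullback_comp (ψ := circleCover M) (χ := fun z : N × ℝ => (ψ z.1, z.2)) β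
    (contMDiff_circleCover.mdifferentiableAt (by simp))
    (h2.mdifferentiableAt (by simp))).symm.trans
    (formPullback_comp (ψ := fun z : N × Circle => (ψ z.1, z.2)) (χ := circleCover N) β
      (h1.mdifferentiableAt (by simp)) (contMDiff_circleCover.mdifferentiableAt (by simp)))

end CircleIntegral

/-! ### Local angular coordinates -/

section CircleLift

attribute [local instance] finrank_real_complex_fact'

lemma contMDiff_coe_circle : ContMDiff (𝓡 1) 𝓘(ℝ, ℂ) ∞ fun z : Circle => (z : ℂ) :=
  contMDiff_coe_sphere

instance : LieGroup (𝓡 1) ∞ Circle := LieGroup.of_le (n := ω) le_top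

variable {n : ℕ} {θ : 𝔼 n → Circle}

lemma contDiff_coe_circle (hθ : ContMDiff (𝓡 n) (𝓡 1) ∞ θ) :
    ContDiff ℝ ∞ fun w => (θ w : ℂ) := by
  rw [← contMDiff_iff_contDiff]
  exact contMDiff_coe_circle.comp hθ

lemma conj_mul_self_circle (z : Circle) : (starRingEnd ℂ) (z : ℂ) * (z : ℂ) = 1 := by
  rw [← Circle.coe_inv_eq_conj, ← Circle.coe_mul, inv_mul_cancel, Circle.coe_one]

/-- Rotating `z` to `1` keeps the principal logarithm away from its branch cut. -/
lemma contDiffAt_log_conj_mul (z : Circle) :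
    ContDiffAt ℝ ∞ (fun y : ℂ => (Complex.log ((starRingEnd ℂ) (z : ℂ) * y)).im) z := by
  have h : ContDiffAt ℝ ∞ Complex.log ((starRingEnd ℂ) (z : ℂ) * z) := by
    rw [conj_mul_self_circle]
    exact (Complex.contDiffAt_log Complex.one_mem_slitPlane).restrict_scalars ℝ
  exact Complex.imCLM.contDiff.contDiffAt.comp _
    (h.comp _ (contDiff_const.mul contDiff_id).contDiffAt)

lemma mul_exp_log_conj_mul (z w : Circle) :
    z * Circle.exp (Complex.log ((starRingEnd ℂ) (z : ℂ) * (w : ℂ))).im = w := by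
  have : (starRingEnd ℂ) (z : ℂ) * (w : ℂ) = ((z⁻¹ * w : Circle) : ℂ) := by
    rw [Circle.coe_mul, Circle.coe_inv_eq_conj]
  rw [this, Complex.log_im, Circle.exp_arg, mul_inv_cancel_left]

/-- The local angular coordinate of `θ` near `u`, with value `0` at `u`. -/
def circleLift (θ : 𝔼 n → Circle) (u w : 𝔼 n) : ℝ :=
  (Complex.log ((starRingEnd ℂ) (θ u : ℂ) * (θ w : ℂ))).im

lemma exp_circleLift (θ : 𝔼 n → Circle) (u w : 𝔼 n) :
    θ u * Circle.exp (circleLift θ u w) = θ w := mul_exp_log_conj_mul _ _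

lemma circleLift_self (θ : 𝔼 n → Circle) (u : 𝔼 n) : circleLift θ u u = 0 := by
  rw [circleLift, conj_mul_self_circle, Complex.log_one, Complex.zero_im]

lemma contDiffAt_circleLift (hθ : ContMDiff (𝓡 n) (𝓡 1) ∞ θ) (u : 𝔼 n) :
    ContDiffAt ℝ ∞ (circleLift θ u) u :=
  ContDiffAt.comp (f := fun w => (θ w : ℂ)) u (contDiffAt_log_conj_mul (θ u))
    (contDiff_coe_circle hθ).contDiffAt

/-- The angular form as a continuous linear form. -/
def angularFormL (θ : 𝔼 n → Circle) (u : 𝔼 n) : 𝔼 n →L[ℝ] ℝ :=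
  Complex.imCLM.comp (((starRingEnd ℂ) (θ u : ℂ)) • fderiv ℝ (fun w => (θ w : ℂ)) u)

/-- Justifies the name angular form: the logarithm has derivative `1` at `1`. -/
lemma fderiv_circleLift (hθ : ContMDiff (𝓡 n) (𝓡 1) ∞ θ) (u : 𝔼 n) :
    fderiv ℝ (circleLift θ u) u = angularFormL θ u := by
  have h0 : HasFDerivAt (fun w => (starRingEnd ℂ) (θ u : ℂ) * (θ w : ℂ))
      (((starRingEnd ℂ) (θ u : ℂ)) • fderiv ℝ (fun w => (θ w : ℂ)) u) u :=
    (((contDiff_coe_circle hθ).differentiable (by simp)) u).hasFDerivAt.const_mul _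
  have h1 := ((Complex.hasDerivAt_log Complex.one_mem_slitPlane).hasFDerivAt).restrictScalars ℝ
  rw [← conj_mul_self_circle (θ u)] at h1
  refine (Complex.imCLM.hasFDerivAt.comp u (h1.comp u h0)).fderiv.trans ?_
  ext1 v
  simp [angularFormL, conj_mul_self_circle]

lemma contDiff_angularFormL (hθ : ContMDiff (𝓡 n) (𝓡 1) ∞ θ) : ContDiff ℝ ∞ (angularFormL θ) := by
  have h := contDiff_coe_circle hθ
  exact contDiff_const.clm_comp ((Complex.conjCLE.contDiff.comp h).smul
    (h.fderiv_right (by simp)))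

lemma angularFormL_comp {k : ℕ} (hθ : ContMDiff (𝓡 n) (𝓡 1) ∞ θ) {f : 𝔼 k → 𝔼 n} {u : 𝔼 k}
    (hf : DifferentiableAt ℝ f u) :
    angularFormL (fun w => θ (f w)) u = (angularFormL θ (f u)).comp (fderiv ℝ f u) := by
  have h : fderiv ℝ (fun w => (θ (f w) : ℂ)) u =
      (fderiv ℝ (fun w => (θ w : ℂ)) (f u)).comp (fderiv ℝ f u) :=
    fderiv_comp u (g := fun w => (θ w : ℂ)) (((contDiff_coe_circle hθ).differentiable (by simp)) _)
      hf
  rw [angularFormL, h]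
  rfl

lemma angularFormL_congr {θ' : 𝔼 n → Circle} {u : 𝔼 n} (h : θ =ᶠ[𝓝 u] θ') :
    angularFormL θ u = angularFormL θ' u := by
  have h1 : (fun w => (θ w : ℂ)) =ᶠ[𝓝 u] fun w => (θ' w : ℂ) := h.fun_comp ((↑) : Circle → ℂ)
  rw [angularFormL, angularFormL, h1.fderiv_eq, h.self_of_nhds]

lemma angularFormL_const (z : Circle) (u : 𝔼 n) : angularFormL (fun _ => z) u = 0 := by
  ext1 v
  simp [angularFormL]

end CircleLift

/-! ### Differentiating the evaluation of loops -/

section LoopEval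

variable {d : ℕ} {G : Type*} [TopologicalSpace G] [ChartedSpace (𝔼 d) G] [Group G]
  [LieGroup (𝓡 d) ∞ G]

lemma logDeriv_eq_mc (γ : LoopGroup d G) (θ : Circle) :
    logDeriv γ θ = mc d (fun t : ℝ => γ.eval (θ * Circle.exp t)) 0 1 := by
  simp only [mc, Circle.exp_zero, mul_one]
  rfl

lemma contMDiff_mul_exp {n : ℕ} (z : Circle) :
    ContMDiff 𝓘(ℝ, 𝔼 n × ℝ) ((𝓡 n).prod (𝓡 1)) ∞
      fun x : 𝔼 n × ℝ => (x.1, z * Circle.exp x.2) := by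
  rw [modelWithCornersSelf_prod, ← chartedSpaceSelf_prod]
  exact contMDiff_fst.prodMk (contMDiff_const.mul (contMDiff_circleExp.comp contMDiff_snd))

/-- With `θ` replaced by its angular lift, the map factors through `𝔼 n × ℝ`, and the derivative
splits into its two partial derivatives. -/
lemma mc_slice {n : ℕ} {g : 𝔼 n × Circle → G} (hg : ContMDiff ((𝓡 n).prod (𝓡 1)) (𝓡 d) ∞ g)
    {θ : 𝔼 n → Circle} (hθ : ContMDiff (𝓡 n) (𝓡 1) ∞ θ) (u v : 𝔼 n) :
    mc d (fun w => g (w, θ w)) u v = mc d (fun w => g (w, θ u)) u v +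
      angularFormL θ u v • mc d (fun t : ℝ => g (u, θ u * Circle.exp t)) 0 1 := by
  set Γ : 𝔼 n × ℝ → G := fun x => g (x.1, θ u * Circle.exp x.2) with hΓ
  have hΓs : ContMDiff 𝓘(ℝ, 𝔼 n × ℝ) (𝓡 d) ∞ Γ := hg.comp (contMDiff_mul_exp (θ u))
  have hΓd (x : 𝔼 n × ℝ) : MDifferentiableAt 𝓘(ℝ, 𝔼 n × ℝ) (𝓡 d) Γ x :=
    (hΓs x).mdifferentiableAt (by simp)
  have hl := ((contDiffAt_circleLift hθ u).differentiableAt (by simp)).hasFDerivAt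
  rw [fderiv_circleLift hθ] at hl
  have h1 : HasFDerivAt (fun w => (w, circleLift θ u w))
      ((ContinuousLinearMap.id ℝ (𝔼 n)).prod (angularFormL θ u)) u := (hasFDerivAt_id u).prodMk hl
  have h2 : HasFDerivAt (fun w : 𝔼 n => (w, (0 : ℝ)))
      ((ContinuousLinearMap.id ℝ (𝔼 n)).prod 0) u := (hasFDerivAt_id u).prodMk (hasFDerivAt_const _ _)
  have h3 : HasFDerivAt (fun t : ℝ => (u, t))
      ((0 : ℝ →L[ℝ] 𝔼 n).prod (ContinuousLinearMap.id ℝ ℝ)) 0 :=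
    (hasFDerivAt_const _ _).prodMk (hasFDerivAt_id _)
  have e1 := mc_comp (hΓd _) h1.differentiableAt
  have e2 := mc_comp (hΓd _) h2.differentiableAt
  have e3 := mc_comp (hΓd _) h3.differentiableAt
  rw [h1.fderiv, circleLift_self] at e1
  rw [h2.fderiv] at e2
  rw [h3.fderiv] at e3
  simp only [hΓ, exp_circleLift, Circle.exp_zero, mul_one] at e1 e2 e3
  rw [e1, e2, e3]
  simp only [ContinuousLinearMap.comp_apply, ← map_smul, ← map_add]
  congr 1
  simp

/-- The variation of the angle produces exactly the inhomogeneous term in the transformation law of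
a Higgs field. -/
lemma mc_eval {n : ℕ} {γ : 𝔼 n → LoopGroup d G} (hγ : γ ∈ (loopDiffeology d G).plots n)
    {θ : 𝔼 n → Circle} (hθ : ContMDiff (𝓡 n) (𝓡 1) ∞ θ) (u v : 𝔼 n) :
    mc d (fun w => (γ w).eval (θ w)) u v = mc d (fun w => (γ w).eval (θ u)) u v +
      angularFormL θ u v • logDeriv (γ u) (θ u) := by
  rw [logDeriv_eq_mc]
  exact mc_slice (g := fun x => (γ x.1).eval x.2) hγ hθ u v

end LoopEval

/-! ### Loop connections at a fixed angle -/

section LoopConnectionAt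

variable {d : ℕ} {G : Type*} [TopologicalSpace G] [ChartedSpace (𝔼 d) G] [Group G]
  [LieGroup (𝓡 d) ∞ G]
  {m : ℕ} {M : Type*} [TopologicalSpace M] [ChartedSpace (𝔼 m) M]
  {P : LoopBundle d G m M} (A : LoopConnection P)

/-- A connection on a loop bundle, evaluated at a point of the circle. -/
def LoopConnection.atL {n : ℕ} (p : 𝔼 n → P.Total) (u : 𝔼 n) (θ : Circle) : 𝔼 n →L[ℝ] LieAlg d :=
  LinearMap.toContinuousLinearMap
    { toFun := fun v => (A.toFun p u v).1 θ
      map_add' := fun v w => by rw [map_add]; rfl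
      map_smul' := fun c v => by rw [map_smul]; rfl }

lemma LoopConnection.atL_apply {n : ℕ} (p : 𝔼 n → P.Total) (u v : 𝔼 n) (θ : Circle) :
    A.atL p u θ v = (A.toFun p u v).1 θ := rfl

lemma LoopConnection.contDiff_atL {n : ℕ} {p : 𝔼 n → P.Total} (hp : p ∈ P.diffeology.plots n)
    {θ : 𝔼 n → Circle} (hθ : ContMDiff (𝓡 n) (𝓡 1) ∞ θ) :
    ContDiff ℝ ∞ fun u => A.atL p u (θ u) := by
  rw [contDiff_clm_apply_iff]
  intro v
  rw [← contMDiff_iff_contDiff]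
  exact (A.smooth hp v).comp (contMDiff_id.prodMk hθ)

lemma LoopConnection.atL_comp {n k : ℕ} {p : 𝔼 n → P.Total} (hp : p ∈ P.diffeology.plots n)
    {f : 𝔼 k → 𝔼 n} (hf : ContDiff ℝ ∞ f) (u : 𝔼 k) (θ : Circle) :
    A.atL (p ∘ f) u θ = (A.atL p (f u) θ).comp (fderiv ℝ f u) := by
  ext1 v
  rw [ContinuousLinearMap.comp_apply, atL_apply, A.natural hp hf]
  rfl

/-- The one-form on the total space given by the value of a connection at a point of the circle. -/
def LoopConnection.at (θ : Circle) : OneForm P.Total P.diffeology (LieAlg d) where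
  toFun p u := A.atL p u θ
  smooth hp := A.contDiff_atL hp contMDiff_const
  natural hp hf u := A.atL_comp hp hf u θ

/-- At a fixed angle a loop connection transforms as an ordinary potential under `γ(θ)`. -/
lemma LoopConnection.atL_act {n : ℕ} {p : 𝔼 n → P.Total} (hp : p ∈ P.diffeology.plots n)
    {γ : 𝔼 n → LoopGroup d G} (hγ : γ ∈ (loopDiffeology d G).plots n) (u : 𝔼 n) (θ : Circle) :
    A.atL (fun w => P.act (p w) (γ w)) u θ =
      (Ad d ((γ u).eval θ)⁻¹).comp (A.atL p u θ) + mc d (fun w => (γ w).eval θ) u := by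
  have h1 := (A.at θ).toFun_act hp hγ u
  refine h1.trans (congrArg₂ (· + ·) ?_ ?_)
  · ext1 v
    exact A.equivariant hp (γ u) u v θ
  · have hc : (fun w => (γ u)⁻¹ * γ w) ∈ (loopDiffeology d G).plots n :=
      (((γ u)⁻¹).1.contMDiff.comp contMDiff_snd).mul hγ
    ext1 v
    have h2 := A.vertical (P.act (p u) (γ u)) hc u (inv_mul_cancel _) v θ
    have e : (fun w => P.act (P.act (p u) (γ u)) ((γ u)⁻¹ * γ w)) = fun w => P.act (p u) (γ w) := by
      funext w
      rw [← P.act_mul, mul_inv_cancel_left]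
    rw [e] at h2
    exact h2

end LoopConnectionAt

/-! ### The caloron connection -/

section CaloronForm

variable {d : ℕ} {G : Type*} [TopologicalSpace G] [ChartedSpace (𝔼 d) G] [Group G]
  [LieGroup (𝓡 d) ∞ G]
  {m : ℕ} {M : Type*} [TopologicalSpace M] [ChartedSpace (𝔼 m) M]
  {P : LoopBundle d G m M} (A : LoopConnection P) (Φ : HiggsField P)

/-- The form `ad(g⁻¹)A(θ) + Θ + ad(g⁻¹)Φ dθ` on `P × G × S¹`. -/
def calForm {n : ℕ} (a : 𝔼 n → P.Total) (g : 𝔼 n → G) (θ : 𝔼 n → Circle) (u : 𝔼 n) :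
    𝔼 n →L[ℝ] LieAlg d :=
  (Ad d (g u)⁻¹).comp (A.atL a u (θ u)) + mc d g u +
    (angularFormL θ u).smulRight (Ad d (g u)⁻¹ (Φ.toFun (a u) (θ u)))

variable (P) in
/-- Smooth maps into `P × G × S¹`. -/
structure IsLift {n : ℕ} (a : 𝔼 n → P.Total) (g : 𝔼 n → G) (θ : 𝔼 n → Circle) : Prop where
  plot : a ∈ P.diffeology.plots n
  smooth : ContMDiff (𝓡 n) (𝓡 d) ∞ g
  smooth_angle : ContMDiff (𝓡 n) (𝓡 1) ∞ θ

lemma IsLift.comp {n k : ℕ} {a : 𝔼 n → P.Total} {g : 𝔼 n → G} {θ : 𝔼 n → Circle}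
    (h : IsLift P a g θ) {f : 𝔼 k → 𝔼 n} (hf : ContDiff ℝ ∞ f) :
    IsLift P (a ∘ f) (g ∘ f) (θ ∘ f) :=
  ⟨P.diffeology.plot_reparam h.plot hf, h.smooth.comp hf.contMDiff,
    h.smooth_angle.comp hf.contMDiff⟩

lemma contDiff_calForm {n : ℕ} {a : 𝔼 n → P.Total} {g : 𝔼 n → G} {θ : 𝔼 n → Circle}
    (h : IsLift P a g θ) : ContDiff ℝ ∞ (calForm A Φ a g θ) := by
  have h1 : ContDiff ℝ ∞ fun u => Ad d (g u)⁻¹ := contDiff_Ad h.smooth.inv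
  have h2 : ContDiff ℝ ∞ fun u => Φ.toFun (a u) (θ u) := by
    rw [← contMDiff_iff_contDiff]
    exact (Φ.smooth h.plot).comp (contMDiff_id.prodMk h.smooth_angle)
  exact ((h1.clm_comp (A.contDiff_atL h.plot h.smooth_angle)).add (contDiff_mc h.smooth)).add
    ((contDiff_angularFormL h.smooth_angle).smulRight (h1.clm_apply h2))

lemma calForm_comp {n k : ℕ} {a : 𝔼 n → P.Total} {g : 𝔼 n → G} {θ : 𝔼 n → Circle}
    (h : IsLift P a g θ) {f : 𝔼 k → 𝔼 n} (hf : ContDiff ℝ ∞ f) (u : 𝔼 k) :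
    calForm A Φ (a ∘ f) (g ∘ f) (θ ∘ f) u = (calForm A Φ a g θ (f u)).comp (fderiv ℝ f u) := by
  have hfd := (hf.differentiable (by simp)) u
  have h1 : mc d (g ∘ f) u = (mc d g (f u)).comp (fderiv ℝ f u) :=
    mc_comp ((h.smooth _).mdifferentiableAt (by simp)) hfd
  have h2 : angularFormL (θ ∘ f) u = (angularFormL θ (f u)).comp (fderiv ℝ f u) :=
    angularFormL_comp h.smooth_angle hfd
  simp only [calForm, h1, h2, A.atL_comp h.plot hf]
  rfl

lemma calForm_congr {n : ℕ} {a a' : 𝔼 n → P.Total} {g g' : 𝔼 n → G} {θ θ' : 𝔼 n → Circle}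
    (h : IsLift P a g θ) (h' : IsLift P a' g' θ') {u : 𝔼 n} (ha : a =ᶠ[𝓝 u] a')
    (hg : g =ᶠ[𝓝 u] g') (hθ : θ =ᶠ[𝓝 u] θ') : calForm A Φ a g θ u = calForm A Φ a' g' θ' u := by
  have h1 : A.atL a u (θ u) = A.atL a' u (θ u) := (A.at (θ u)).toFun_congr h.plot h'.plot ha
  rw [calForm, h1, mc_congr hg, angularFormL_congr hθ, ha.self_of_nhds, hg.self_of_nhds,
    hθ.self_of_nhds]
  rfl

/-- By `mc_inv` and `mc_eval`, the factor `γ(θ)⁻¹` contributes minus the fixed-angle differential of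
`γ` and minus `γ⁻¹∂γ dθ`, suitably conjugated. The first cancels the change of `A`, the second that
of `Φ`. -/
lemma calForm_gauge {n : ℕ} {a : 𝔼 n → P.Total} {g : 𝔼 n → G} {θ : 𝔼 n → Circle}
    (h : IsLift P a g θ) {γ : 𝔼 n → LoopGroup d G} (hγ : γ ∈ (loopDiffeology d G).plots n)
    (u : 𝔼 n) :
    calForm A Φ (fun w => P.act (a w) (γ w)) (fun w => ((γ w).eval (θ w))⁻¹ * g w) θ u =
      calForm A Φ a g θ u := by
  have hγs := contMDiff_eval hγ h.smooth_angle
  have h1 := mc_inv ((hγs u).mdifferentiableAt (by simp))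
  have h2 := mc_mul ((hγs.inv u).mdifferentiableAt (by simp))
    ((h.smooth u).mdifferentiableAt (by simp))
  simp only [calForm]
  rw [h2, h1, A.atL_act h.plot hγ, Φ.equivariant]
  ext1 v
  have h3 := mc_eval hγ h.smooth_angle u v
  have hAd : Ad d (((γ u).eval (θ u))⁻¹ * g u)⁻¹ =
      (Ad d (g u)⁻¹).comp (Ad d ((γ u).eval (θ u))) := by
    rw [← Ad_mul, mul_inv_rev, inv_inv]
  rw [hAd]
  simp only [add_apply, ContinuousLinearMap.comp_apply, ContinuousLinearMap.smulRight_apply,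
    neg_apply, map_add, Ad_Ad_inv, map_neg, h3, map_smul, smul_add]
  abel

lemma mk_eq_mk_iff {p p' : P.Total} {g g' : G} {θ θ' : Circle} :
    CaloronTotal.mk P p g θ = CaloronTotal.mk P p' g' θ' ↔
      ∃ γ : LoopGroup d G, p' = P.act p γ ∧ g' = (γ.eval θ)⁻¹ * g ∧ θ' = θ := by
  refine ⟨fun h => ?_, ?_⟩
  · obtain ⟨γ, hγ⟩ := Quotient.exact h
    simp only [Prod.mk.injEq] at hγ
    exact ⟨γ, hγ⟩
  · rintro ⟨γ, rfl, rfl, rfl⟩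
    rw [CaloronTotal.mk_act, mul_inv_cancel_left]

/-- Two maps to a principal bundle with the same projection differ by a smooth map to the group. -/
lemma PrincipalBundle.exists_transition {H : Type*} [Group H] {dH : DiffeologicalSpace H}
    {X : Type*} [TopologicalSpace X] {dX : DiffeologicalSpace X} (Q : PrincipalBundle H dH X dX)
    (hinv : ∀ {n : ℕ} {a b : 𝔼 n → H}, a ∈ dH.plots n → b ∈ dH.plots n →
      (fun u => (a u)⁻¹ * b u) ∈ dH.plots n) {n : ℕ} {a a' : 𝔼 n → Q.Total}
    (ha : a ∈ Q.diffeology.plots n) (ha' : a' ∈ Q.diffeology.plots n) {u : 𝔼 n}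
    (hc : ContinuousAt (fun w => Q.proj (a w)) u)
    {S : Set (𝔼 n)} (hS : S ∈ 𝓝 u) (h : ∀ w ∈ S, Q.proj (a w) = Q.proj (a' w)) :
    ∃ r : 𝔼 n → 𝔼 n, ContDiff ℝ ∞ r ∧ (∀ᶠ w in 𝓝 u, r w = w) ∧ (∀ w, r w ∈ S) ∧
      ∃ γ : 𝔼 n → H, γ ∈ dH.plots n ∧ ∀ w, a' (r w) = Q.act (a (r w)) (γ w) := by
  obtain ⟨U, s, τ, hU, hx, -, h2, -, -, h5⟩ := Q.locally_trivial (Q.proj (a u))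
  obtain ⟨O, hO, hOo, huO⟩ := mem_nhds_iff.1
    (inter_mem hS (hc.preimage_mem_nhds (hU.mem_nhds hx)))
  obtain ⟨r, hr, hrO, hru⟩ := exists_smooth_retract hOo huO
  have hrS (w) : r w ∈ S := (hO (hrO w)).1
  have h3 (w) : Q.proj (a (r w)) ∈ U := (hO (hrO w)).2
  have h3' (w) : Q.proj (a' (r w)) ∈ U := by rw [← h _ (hrS w)]; exact h3 w
  -- In a common trivialization the transition is the quotient of the two group coordinates.
  refine ⟨r, hr, hru, hrS, fun w => (τ (a (r w)))⁻¹ * τ (a' (r w)), hinv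
    (h5 (Q.diffeology.plot_reparam ha hr) h3) (h5 (Q.diffeology.plot_reparam ha' hr) h3'),
    fun w => ?_⟩
  have e1 := h2 _ (h3 w)
  have e2 := h2 _ (h3' w)
  rw [← h _ (hrS w)] at e2
  conv_rhs => rw [← e1]
  rw [← Q.act_mul, mul_inv_cancel_left, e2]

lemma loopDiffeology_inv_mul {n : ℕ} {a b : 𝔼 n → LoopGroup d G}
    (ha : a ∈ (loopDiffeology d G).plots n) (hb : b ∈ (loopDiffeology d G).plots n) :
    (fun u => (a u)⁻¹ * b u) ∈ (loopDiffeology d G).plots n :=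
  (ContMDiff.inv ha).mul hb

/-- Freeness of the action, read in a local trivialization. -/
lemma PrincipalBundle.act_right_injective {H : Type*} [Group H] {dH : DiffeologicalSpace H}
    {X : Type*} [TopologicalSpace X] {dX : DiffeologicalSpace X} (Q : PrincipalBundle H dH X dX)
    (q : Q.Total) : Function.Injective (Q.act q) := by
  intro a b hab
  obtain ⟨U, s, τ, -, hx, -, h2, h3, -, -⟩ := Q.locally_trivial (Q.proj q)
  have := congrArg τ hab
  rwa [Q.tau_act h2 h3 hx, Q.tau_act h2 h3 hx, mul_right_inj] at this

/-- The form `ad(g⁻¹)A(θ) + Θ + ad(g⁻¹)Φ dθ` descends to the caloron transform. -/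
lemma calForm_eq_of_mk_eq {n : ℕ} {a a' : 𝔼 n → P.Total} {g g' : 𝔼 n → G} {θ θ' : 𝔼 n → Circle}
    (h : IsLift P a g θ) (h' : IsLift P a' g' θ') {u : 𝔼 n}
    (e : ∀ᶠ w in 𝓝 u, CaloronTotal.mk P (a w) (g w) (θ w) =
      CaloronTotal.mk P (a' w) (g' w) (θ' w)) :
    calForm A Φ a g θ u = calForm A Φ a' g' θ' u := by
  have hc : ContMDiff (𝓡 n) (𝓡 m) ∞ fun w => P.proj (a w) := P.proj_smooth h.plot
  obtain ⟨r, hr, hru, hrS, γ, hγ, hγa⟩ := P.exists_transition loopDiffeology_inv_mul h.plot h'.plot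
    hc.continuous.continuousAt e fun w hw => by
      obtain ⟨δ, hδ, -⟩ := mk_eq_mk_iff.1 hw
      rw [hδ, P.proj_act]
  have key (w) : a' (r w) = P.act (a (r w)) (γ w) ∧
      g' (r w) = ((γ w).eval (θ (r w)))⁻¹ * g (r w) ∧ θ' (r w) = θ (r w) := by
    obtain ⟨δ, hδ1, hδ2, hδ3⟩ := mk_eq_mk_iff.1 (hrS w)
    -- By freeness, the loop witnessing equality in the quotient, which is only chosen pointwise, is
    -- the value of the smooth family.
    have : δ = γ w := P.act_right_injective _ (hδ1.symm.trans (hγa w))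
    exact this ▸ ⟨hδ1, hδ2, hδ3⟩
  have hr1 : id =ᶠ[𝓝 u] r := hru.mono fun _ h => h.symm
  rw [calForm_congr A Φ h (h.comp hr) (hr1.fun_comp a) (hr1.fun_comp g) (hr1.fun_comp θ),
    calForm_congr A Φ h' (h'.comp hr) (hr1.fun_comp a') (hr1.fun_comp g') (hr1.fun_comp θ'),
    ← calForm_gauge A Φ (h.comp hr) hγ u,
    show a' ∘ r = fun w => P.act ((a ∘ r) w) (γ w) from funext fun w => (key w).1,
    show g' ∘ r = fun w => ((γ w).eval ((θ ∘ r) w))⁻¹ * (g ∘ r) w from funext fun w => (key w).2.1,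
    show θ' ∘ r = θ ∘ r from funext fun w => (key w).2.2]

lemma exists_lift {n : ℕ} {p : 𝔼 n → (caloronBundle P).Total}
    (hp : p ∈ (caloronBundle P).diffeology.plots n) (u : 𝔼 n) :
    ∃ a g θ, IsLift P a g θ ∧ ∀ᶠ w in 𝓝 u, p w = CaloronTotal.mk P (a w) (g w) (θ w) := by
  obtain ⟨a, ha, g, θ, hg, hθ, h⟩ := hp u
  exact ⟨a, g, θ, ⟨ha, hg, hθ⟩, h⟩

lemma mk_plot {n : ℕ} {a : 𝔼 n → P.Total} {g : 𝔼 n → G} {θ : 𝔼 n → Circle} (h : IsLift P a g θ) :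
    (fun w => CaloronTotal.mk P (a w) (g w) (θ w)) ∈ (caloronBundle P).diffeology.plots n :=
  fun _ => ⟨a, h.plot, g, θ, h.smooth, h.smooth_angle, Eventually.of_forall fun _ => rfl⟩

/-- All local lifts near `u` give the same value; `0` is a default where no lift exists, which does
not happen for plots. -/
lemma exists_local_calForm {n : ℕ} (p : 𝔼 n → (caloronBundle P).Total) (u : 𝔼 n) :
    ∃ L : 𝔼 n →L[ℝ] LieAlg d, ∀ a g θ, IsLift P a g θ →
      (∀ᶠ w in 𝓝 u, p w = CaloronTotal.mk P (a w) (g w) (θ w)) → calForm A Φ a g θ u = L := by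
  by_cases h : ∃ a g θ, IsLift P a g θ ∧ ∀ᶠ w in 𝓝 u, p w = CaloronTotal.mk P (a w) (g w) (θ w)
  · obtain ⟨a, g, θ, h1, h2⟩ := h
    refine ⟨calForm A Φ a g θ u, fun a' g' θ' h1' h2' => ?_⟩
    refine calForm_eq_of_mk_eq A Φ h1' h1 ?_
    filter_upwards [h2, h2'] with w hw hw'
    rw [← hw, ← hw']
  · exact ⟨0, fun a g θ h1 h2 => (h ⟨a, g, θ, h1, h2⟩).elim⟩

lemma exists_isCaloronForm : ∃ B, IsCaloronForm A Φ B := by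
  choose L hL using fun (n : ℕ) (p : 𝔼 n → (caloronBundle P).Total) (u : 𝔼 n) =>
    exists_local_calForm A Φ p u
  refine ⟨{ toFun := fun {n} p u => L n p u, smooth := ?_, natural := ?_ }, ?_⟩
  · intro n p hp
    rw [contDiff_iff_contDiffAt]
    intro u
    obtain ⟨a, g, θ, h, hl⟩ := exists_lift hp u
    refine (contDiff_calForm A Φ h).contDiffAt.congr_of_eventuallyEq ?_
    filter_upwards [hl.eventually_nhds] with w hw
    exact (hL n p w a g θ h hw).symm
  · intro n k p f hp hf u
    obtain ⟨a, g, θ, h, hl⟩ := exists_lift hp (f u)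
    rw [← hL n p (f u) a g θ h hl, ← calForm_comp A Φ h hf]
    exact (hL k (p ∘ f) u _ _ _ (h.comp hf) (hf.continuous.continuousAt.eventually hl)).symm
  · intro n a g θ ha hg hθ u v
    have h := hL n _ u a g θ ⟨ha, hg, hθ⟩ (Eventually.of_forall fun _ => rfl)
    exact (congrArg (fun l : 𝔼 n →L[ℝ] LieAlg d => l v) h).symm

lemma isCaloronForm_caloronForm : IsCaloronForm A Φ (caloronForm A Φ) := by
  rw [caloronForm, dif_pos (exists_isCaloronForm A Φ)]
  exact (exists_isCaloronForm A Φ).choose_spec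

variable {A Φ}

lemma IsCaloronForm.toFun_eq
    {B : OneForm (caloronBundle P).Total (caloronBundle P).diffeology (LieAlg d)}
    (hB : IsCaloronForm A Φ B) {n : ℕ} {p : 𝔼 n → (caloronBundle P).Total}
    (hp : p ∈ (caloronBundle P).diffeology.plots n) {a : 𝔼 n → P.Total} {g : 𝔼 n → G}
    {θ : 𝔼 n → Circle} (h : IsLift P a g θ) {u : 𝔼 n}
    (hl : ∀ᶠ w in 𝓝 u, p w = CaloronTotal.mk P (a w) (g w) (θ w)) :
    B.toFun p u = calForm A Φ a g θ u := by
  rw [B.toFun_congr hp (mk_plot h) hl]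
  ext1 v
  exact hB h.plot h.smooth h.smooth_angle u v

/-- In a lift, the action of `G` changes only the coordinate `g`. For constant `h` every term is
conjugated by `Ad(h⁻¹)`; along a fibre of the projection only the Maurer–Cartan term survives. -/
lemma IsCaloronForm.isConnection
    {B : OneForm (caloronBundle P).Total (caloronBundle P).diffeology (LieAlg d)}
    (hB : IsCaloronForm A Φ B) : IsConnection (caloronBundle P) B where
  equivariant {n p} hp h u v := by
    obtain ⟨a, g, θ, hl, e⟩ := exists_lift hp u
    have hl' : IsLift P a (fun w => g w * h) θ :=
      ⟨hl.plot, hl.smooth.mul contMDiff_const, hl.smooth_angle⟩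
    have e' : ∀ᶠ w in 𝓝 u, (caloronBundle P).act (p w) h =
        CaloronTotal.mk P (a w) (g w * h) (θ w) := by
      filter_upwards [e] with w hw
      rw [hw]
      rfl
    rw [hB.toFun_eq hp hl e, hB.toFun_eq ((caloronBundle P).act_const_smooth hp h) hl' e']
    simp only [calForm]
    rw [mc_mul ((hl.smooth u).mdifferentiableAt (by simp)) mdifferentiableAt_const, mc_const,
      mul_inv_rev, Ad_mul]
    simp only [add_apply, ContinuousLinearMap.comp_apply, ContinuousLinearMap.smulRight_apply,
      map_add, map_smul, add_zero]
  vertical q n c hc u hu v := by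
    obtain ⟨⟨p, g, θ⟩, rfl⟩ := Quotient.exists_rep q
    have hl : IsLift P (fun _ : 𝔼 n => p) (fun w => g * c w) (fun _ => θ) :=
      ⟨P.diffeology.constant_plots p, contMDiff_const.mul hc, contMDiff_const⟩
    have h1 : A.atL (fun _ : 𝔼 n => p) u θ = 0 := (A.at θ).toFun_const p u
    have h2 := hB.toFun_eq (mk_plot hl) hl (u := u) (Eventually.of_forall fun _ => rfl)
    rw [calForm, h1, mc_mul_left, angularFormL_const, ContinuousLinearMap.comp_zero, zero_add,
      ContinuousLinearMap.zero_smulRight, add_zero, mc, hu] at h2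
    simp only [inv_one, one_mul] at h2
    exact congrArg (fun l : 𝔼 n →L[ℝ] LieAlg d => l v) h2

end CaloronForm

/-! ### Independence of the Chern–Weil class from the connection -/

section Interpolation

universe w

lemma map_convexCombination {V W : Type*} [NormedAddCommGroup V] [NormedSpace ℝ V]
    [NormedAddCommGroup W] [NormedSpace ℝ W] (L : V →L[ℝ] W) (t : ℝ) (x y : V) :
    (1 - t) • L x + t • L y = L ((1 - t) • x + t • y) := by
  rw [map_add, map_smul, map_smul]

lemma convexCombination_self {V : Type*} [NormedAddCommGroup V] [NormedSpace ℝ V] (t : ℝ) (x : V) :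
    (1 - t) • x + t • x = x := by
  rw [← add_smul, sub_add_cancel, one_smul]

lemma integralT_zero {E X : Type*} [NormedAddCommGroup E] [NormedSpace ℝ E]
    [FiniteDimensional ℝ E] (a b : ℝ) {q : ℕ} :
    integralT a b (0 : MForm (E × ℝ) (X × ℝ) (q + 1)) = 0 := by
  funext x
  refine (intervalIntegral.integral_congr (g := fun _ => 0) fun t _ => ?_).trans
    intervalIntegral.integral_zero
  exact map_zero (contractT E q)

variable {d : ℕ} {G : Type*} [TopologicalSpace G] [ChartedSpace (𝔼 d) G] [Group G]
  [LieGroup (𝓡 d) ∞ G]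
  {E : Type w} [NormedAddCommGroup E] [NormedSpace ℝ E] [FiniteDimensional ℝ E]
  {H : Type*} [TopologicalSpace H] {I : ModelWithCorners ℝ E H} [I.Boundaryless]
  {X : Type*} [TopologicalSpace X] [ChartedSpace H X] [IsManifold I ∞ X]
  (Q : GBundle d G I X)

/-- The pullback of a bundle over `X` to `X × ℝ`. -/
def PrincipalBundle.prodReal : GBundle d G (I.prod 𝓘(ℝ, ℝ)) (X × ℝ) :=
  PrincipalBundle.pullback Q Prod.fst continuous_fst fun hp => contMDiff_fst.comp hp

variable {Q} (B₀ B₁ : OneForm Q.Total Q.diffeology (LieAlg d))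

/-- The form `(1 - t)B₀ + tB₁` on the pullback of a bundle over `X` to `X × ℝ`. -/
def interpolation : OneForm Q.prodReal.Total Q.prodReal.diffeology (LieAlg d) where
  toFun p u := (1 - (p u).1.1.2) • B₀.toFun (fun w => (p w).1.2) u +
    (p u).1.1.2 • B₁.toFun (fun w => (p w).1.2) u
  smooth {n p} hp := by
    have ht : ContDiff ℝ ∞ fun u => (p u).1.1.2 := by
      rw [← contMDiff_iff_contDiff]
      exact contMDiff_snd.comp (show ContMDiff (𝓡 n) (I.prod 𝓘(ℝ, ℝ)) ∞ fun u => (p u).1.1 from hp.1)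
    exact ((contDiff_const.sub ht).smul (B₀.smooth hp.2)).add (ht.smul (B₁.smooth hp.2))
  natural {n k p f} hp hf u := by
    have h0 := B₀.natural hp.2 hf u
    have h1 := B₁.natural hp.2 hf u
    refine (congrArg₂ (fun x y : 𝔼 k →L[ℝ] LieAlg d => (1 - (p (f u)).1.1.2) • x +
      (p (f u)).1.1.2 • y) h0 h1).trans ?_
    rw [ContinuousLinearMap.add_comp, ContinuousLinearMap.smul_comp, ContinuousLinearMap.smul_comp]

variable {B₀ B₁}

/-- The axioms are affine, the weights sum to one, and the action does not move the parameter `t`.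
-/
lemma IsConnection.interpolation (h₀ : IsConnection Q B₀) (h₁ : IsConnection Q B₁) :
    IsConnection Q.prodReal (interpolation B₀ B₁) where
  equivariant {n p} hp h u v := by
    have e₀ := h₀.equivariant hp.2 h u v
    have e₁ := h₁.equivariant hp.2 h u v
    refine (congrArg₂ (fun x y : LieAlg d => (1 - (p u).1.1.2) • x +
      (p u).1.1.2 • y) e₀ e₁).trans ?_
    exact map_convexCombination (Ad d h⁻¹) _ _ _
  vertical q n c hc u hu v := by
    have e₀ := h₀.vertical q.1.2 hc u hu v
    have e₁ := h₁.vertical q.1.2 hc u hu v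
    refine (congrArg₂ (fun x y : LieAlg d => (1 - q.1.1.2) • x + q.1.1.2 • y) e₀ e₁).trans ?_
    exact convexCombination_self _ _

/-- A plot of `Q` becomes a plot of the bundle over `X × ℝ` at constant parameter `t`, with the same
curvature. -/
lemma isChernWeilForm_slice {k : ℕ} {f : InvariantPolynomial d G k}
    {C : OneForm Q.prodReal.Total Q.prodReal.diffeology (LieAlg d)}
    {Ω : MForm (E × ℝ) (X × ℝ) (2 * k)} (hΩ : IsChernWeilForm f Q.prodReal C Ω)
    (B : OneForm Q.Total Q.diffeology (LieAlg d)) (t : ℝ)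
    (hB : ∀ {n : ℕ} {p : 𝔼 n → Q.Total}, p ∈ Q.diffeology.plots n →
      C.toFun (fun w => ⟨((Q.proj (p w), t), p w), rfl⟩) = B.toFun p) :
    IsChernWeilForm f Q B (formPullback (I.prod 𝓘(ℝ, ℝ)) I (fun x : X => (x, t)) Ω) := by
  have hc : ContMDiff I (I.prod 𝓘(ℝ, ℝ)) ∞ fun x : X => (x, t) :=
    contMDiff_id.prodMk contMDiff_const
  refine ⟨hΩ.1.pullback hc, fun {n p} hp u => ?_⟩
  have hproj : ContMDiff (𝓡 n) I ∞ fun w => Q.proj (p w) := Q.proj_smooth hp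
  have h1 : (fun w => ⟨((Q.proj (p w), t), p w), rfl⟩ : 𝔼 n → Q.prodReal.Total) ∈
      Q.prodReal.diffeology.plots n := ⟨hc.comp hproj, hp⟩
  have h2 := hΩ.2 h1 u
  rw [← formPullback_comp (ψ := fun x : X => (x, t)) (χ := fun w => Q.proj (p w)) Ω
    (hc.mdifferentiableAt (by simp)) (hproj.mdifferentiableAt (by simp))]
  refine h2.trans ?_
  simp only [curvature, hB hp]

/-- The class of the Chern-Weil form does not depend on the connection. -/
lemma exists_formD_eq_sub {k : ℕ} {f : InvariantPolynomial d G (k + 1)}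
    (h₀ : IsConnection Q B₀) (h₁ : IsConnection Q B₁)
    {β₀ β₁ : MForm E X (2 * k + 1 + 1)} (hβ₀ : IsChernWeilForm f Q B₀ β₀)
    (hβ₁ : IsChernWeilForm f Q B₁ β₁) :
    ∃ η : MForm E X (2 * k + 1), IsSmoothForm I η ∧ formD I η = β₁ - β₀ := by
  have hC := h₀.interpolation h₁
  obtain ⟨Ω, hΩ⟩ := hC.exists_isChernWeilForm f
  have hd := hΩ.formD_eq_zero hC
  -- At the ends `t = 0` and `t = 1` the interpolated connection is `B₀`, respectively `B₁`.
  have e₀ := isChernWeilForm_unique (isChernWeilForm_slice hΩ B₀ 0 fun {n p} hp => by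
    funext u
    simp [interpolation]) hβ₀
  have e₁ := isChernWeilForm_unique (isChernWeilForm_slice hΩ B₁ 1 fun {n p} hp => by
    funext u
    simp [interpolation]) hβ₁
  have h := integralT_formD (q := 2 * k + 1) (β := Ω) hΩ.1 0 1
  refine ⟨integralT 0 1 (q := 2 * k + 1) Ω, IsSmoothForm.integralT (q := 2 * k + 1) hΩ.1 0 1, ?_⟩
  -- The interpolated form is closed, so only the boundary terms and `d` of its integral remain.
  have h' : integralT 0 1 (formD (I.prod 𝓘(ℝ, ℝ)) (q := 2 * k + 1 + 1) Ω) = 0 :=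
    (congrArg (integralT 0 1) hd).trans (integralT_zero 0 1)
  rw [← e₀, ← e₁]
  exact (sub_eq_zero.1 (h.symm.trans h')).symm

end Interpolation

/-! ### String forms, string classes and naturality -/

section StringForm

variable {d : ℕ} {G : Type*} [TopologicalSpace G] [ChartedSpace (𝔼 d) G] [Group G]
  [LieGroup (𝓡 d) ∞ G]
  {m : ℕ} {M : Type*} [TopologicalSpace M] [ChartedSpace (𝔼 m) M] [IsManifold (𝓡 m) ∞ M]
  {P : LoopBundle d G m M}

lemma IsConnection.isChernWeilForm_chernWeilForm {E : Type*} [NormedAddCommGroup E]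
    [NormedSpace ℝ E] [FiniteDimensional ℝ E] {H : Type*} [TopologicalSpace H]
    {I : ModelWithCorners ℝ E H} [I.Boundaryless] {X : Type*} [TopologicalSpace X]
    [ChartedSpace H X] [IsManifold I ∞ X] {k : ℕ} (f : InvariantPolynomial d G k)
    {Q : GBundle d G I X} {B : OneForm Q.Total Q.diffeology (LieAlg d)} (hB : IsConnection Q B) :
    IsChernWeilForm f Q B (chernWeilForm f Q B) := by
  have h := hB.exists_isChernWeilForm f
  rw [chernWeilForm, dif_pos h]
  exact h.choose_spec

lemma isConnection_caloronForm (A : LoopConnection P) (Φ : HiggsField P) :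
    IsConnection (caloronBundle P) (caloronForm A Φ) :=
  IsCaloronForm.isConnection (isCaloronForm_caloronForm A Φ)

lemma isChernWeilForm_caloronForm {k : ℕ} (f : InvariantPolynomial d G k) (A : LoopConnection P)
    (Φ : HiggsField P) : IsChernWeilForm f (caloronBundle P) (caloronForm A Φ)
      (chernWeilForm f (caloronBundle P) (caloronForm A Φ)) :=
  (isConnection_caloronForm A Φ).isChernWeilForm_chernWeilForm f

lemma stringForm_mem_closedForms {k : ℕ} (f : InvariantPolynomial d G (k + 1))
    (A : LoopConnection P) (Φ : HiggsField P) :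
    stringForm f A Φ ∈ closedForms (𝓡 m) M (2 * k + 1) := by
  have h := isChernWeilForm_caloronForm f A Φ
  exact fiberIntegral_mem_closedForms (q := 2 * k + 1) h.1
    (h.formD_eq_zero (isConnection_caloronForm A Φ))

/-- The circle integral of a primitive of the difference of the Chern–Weil forms is a primitive of
the difference of the string forms. -/
lemma stringForm_sub_mem_exactForms {k : ℕ} (f : InvariantPolynomial d G (k + 1))
    (A A' : LoopConnection P) (Φ Φ' : HiggsField P) :
    stringForm f A Φ - stringForm f A' Φ' ∈ exactForms (𝓡 m) M (2 * k + 1) := by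
  have h := isChernWeilForm_caloronForm f A Φ
  have h' := isChernWeilForm_caloronForm f A' Φ'
  obtain ⟨η, hη, e⟩ := exists_formD_eq_sub (isConnection_caloronForm A' Φ')
    (isConnection_caloronForm A Φ) h' h
  refine ⟨fiberIntegral η, hη.fiberIntegral, ?_⟩
  rw [← fiberIntegral_formD hη, e]
  exact fiberIntegral_sub (q := 2 * k + 1) h.1 h'.1

lemma deRhamClass_eq {E : Type*} [NormedAddCommGroup E] [NormedSpace ℝ E] {H : Type*}
    [TopologicalSpace H] {I : ModelWithCorners ℝ E H} [I.Boundaryless] {X : Type*}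
    [TopologicalSpace X] [ChartedSpace H X] {q : ℕ} {α α' : MForm E X q}
    (h : α ∈ closedForms I X q) (h' : α' ∈ closedForms I X q) (e : α - α' ∈ exactForms I X q) :
    deRhamClass I α = deRhamClass I α' := by
  rw [deRhamClass, deRhamClass, dif_pos h, dif_pos h']
  exact (Submodule.Quotient.eq _).2 e

lemma stringClass_eq {k : ℕ} (f : InvariantPolynomial d G (k + 1))
    (A : LoopConnection P) (Φ : HiggsField P) :
    stringClass f P = deRhamClass (𝓡 m) (stringForm f A Φ) := by
  have h : Nonempty (LoopConnection P × HiggsField P) := ⟨(A, Φ)⟩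
  rw [stringClass, dif_pos h]
  exact deRhamClass_eq (stringForm_mem_closedForms f _ _) (stringForm_mem_closedForms f _ _)
    (stringForm_sub_mem_exactForms f _ _ _ _)

variable {l : ℕ} {N : Type*} [TopologicalSpace N] [ChartedSpace (𝔼 l) N] [IsManifold (𝓡 l) ∞ N]
  {Q : LoopBundle d G l N} {ψ : N → M}

/-- The map `[q, g, θ] ↦ [F(q), g, θ]` covers `ψ × id` and preserves the caloron forms, hence
curvatures. Instead of constructing it on the quotient, the proof works with local lifts of plots.
-/
lemma isChernWeilForm_pullback {k : ℕ} {f : InvariantPolynomial d G k}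
    (hψ : ContMDiff (𝓡 l) (𝓡 m) ∞ ψ) (A : LoopConnection P) (Φ : HiggsField P)
    (F : BundleMap Q P ψ) {β : MForm (𝔼 m × 𝔼 1) (M × Circle) (2 * k)}
    (hβ : IsChernWeilForm f (caloronBundle P) (caloronForm A Φ) β) :
    IsChernWeilForm f (caloronBundle Q) (caloronForm (A.pullback F) (Φ.pullback F))
      (formPullback ((𝓡 m).prod (𝓡 1)) ((𝓡 l).prod (𝓡 1))
        (fun z : N × Circle => (ψ z.1, z.2)) β) := by
  have hψ' : ContMDiff ((𝓡 l).prod (𝓡 1)) ((𝓡 m).prod (𝓡 1)) ∞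
      (fun z : N × Circle => (ψ z.1, z.2)) := (hψ.comp contMDiff_fst).prodMk contMDiff_snd
  refine ⟨hβ.1.pullback hψ', fun {n p} hp u => ?_⟩
  obtain ⟨a, g, θ, h, e⟩ := exists_lift hp u
  have h' : IsLift P (fun w => F.toFun (a w)) g θ := ⟨F.smooth h.plot, h.smooth, h.smooth_angle⟩
  have hproj : ContMDiff (𝓡 n) ((𝓡 l).prod (𝓡 1)) ∞ fun w =>
      (caloronBundle Q).proj (CaloronTotal.mk Q (a w) (g w) (θ w)) :=
    (caloronBundle Q).proj_smooth (mk_plot h)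
  -- Both sides evaluate to the same expression on `P × G × S¹`, since the pulled back data are by
  -- definition the data along `F`.
  have eB : (caloronForm A Φ).toFun (fun w => CaloronTotal.mk P (F.toFun (a w)) (g w) (θ w)) =
      (caloronForm (A.pullback F) (Φ.pullback F)).toFun
        (fun w => CaloronTotal.mk Q (a w) (g w) (θ w)) := by
    funext w
    exact (IsCaloronForm.toFun_eq (isCaloronForm_caloronForm A Φ) (mk_plot h') h'
      (Eventually.of_forall fun _ => rfl)).trans
      (IsCaloronForm.toFun_eq (isCaloronForm_caloronForm (A.pullback F) (Φ.pullback F))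
        (mk_plot h) h (Eventually.of_forall fun _ => rfl)).symm
  have ep : (fun w => (caloronBundle Q).proj (p w)) =ᶠ[𝓝 u] fun w =>
      (caloronBundle Q).proj (CaloronTotal.mk Q (a w) (g w) (θ w)) := by
    filter_upwards [e] with w hw
    rw [hw]
  rw [formPullback_congr _ ep, curvature_congr hp (mk_plot h) e,
    ← formPullback_comp (ψ := fun z : N × Circle => (ψ z.1, z.2)) β
      (hψ'.mdifferentiableAt (by simp)) (hproj.mdifferentiableAt (by simp))]
  have h1 := hβ.2 (mk_plot h') u
  simp only [curvature, eB] at h1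
  refine Eq.trans ?_ h1
  congr 1
  funext w
  exact Prod.ext (F.covers (a w)).symm rfl

lemma stringForm_pullback {k : ℕ} (f : InvariantPolynomial d G (k + 1))
    (hψ : ContMDiff (𝓡 l) (𝓡 m) ∞ ψ) (A : LoopConnection P) (Φ : HiggsField P)
    (F : BundleMap Q P ψ) : formPullback (𝓡 m) (𝓡 l) ψ (stringForm f A Φ) =
      stringForm f (A.pullback F) (Φ.pullback F) := by
  have h := isChernWeilForm_caloronForm f A Φ
  refine (fiberIntegral_pullback (q := 2 * k + 1) h.1 hψ).trans ?_
  exact congrArg (fiberIntegral (q := 2 * k + 1)) (isChernWeilForm_unique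
    (isChernWeilForm_pullback hψ A Φ F h) (isChernWeilForm_caloronForm f _ _))

lemma deRhamPullback_deRhamClass (hψ : ContMDiff (𝓡 l) (𝓡 m) ∞ ψ) {q : ℕ} {α : MForm (𝔼 m) M q}
    (hα : α ∈ closedForms (𝓡 m) M q) :
    deRhamPullback (𝓡 m) (𝓡 l) ψ hψ q (deRhamClass (𝓡 m) α) =
      deRhamClass (𝓡 l) (formPullback (𝓡 m) (𝓡 l) ψ α) := by
  have h : formPullback (𝓡 m) (𝓡 l) ψ α ∈ closedForms (𝓡 l) N q :=
    (closedPullback (𝓡 m) (𝓡 l) ψ hψ q ⟨α, hα⟩).2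
  rw [deRhamClass, deRhamClass, dif_pos hα, dif_pos h]
  rfl

/-- The class may be computed from any data, so on `Q` the pulled back ones are used. -/
lemma stringClass_pullback {k : ℕ} (f : InvariantPolynomial d G (k + 1))
    (hψ : ContMDiff (𝓡 l) (𝓡 m) ∞ ψ) (F : BundleMap Q P ψ)
    (h : Nonempty (LoopConnection P × HiggsField P)) :
    deRhamPullback (𝓡 m) (𝓡 l) ψ hψ (2 * k + 1) (stringClass f P) = stringClass f Q := by
  obtain ⟨A, Φ⟩ := h
  rw [stringClass_eq f A Φ, stringClass_eq f (A.pullback F) (Φ.pullback F),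
    deRhamPullback_deRhamClass hψ (stringForm_mem_closedForms f A Φ), stringForm_pullback f hψ]

end StringForm

/-! ### Joint smoothness in the parameter and the angle -/

section JointSmoothness

variable {n : ℕ}

/-- Smoothness on the circle is tested in the angular coordinate centred at each `z`. -/
lemma contMDiff_of_comp_exp {V : Type*} [NormedAddCommGroup V] [NormedSpace ℝ V]
    {f : 𝔼 n × Circle → V}
    (hf : ∀ z : Circle, ContDiff ℝ ∞ fun x : 𝔼 n × ℝ => f (x.1, z * Circle.exp x.2)) :
    ContMDiff ((𝓡 n).prod (𝓡 1)) 𝓘(ℝ, V) ∞ f := by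
  rintro ⟨u, z⟩
  have h3 : ContMDiffAt ((𝓡 n).prod (𝓡 1)) 𝓘(ℝ, ℝ) ∞
      (fun x : 𝔼 n × Circle => (Complex.log ((starRingEnd ℂ) (z : ℂ) * (x.2 : ℂ))).im) (u, z) :=
    ContMDiffAt.comp (g := fun y : ℂ => (Complex.log ((starRingEnd ℂ) (z : ℂ) * y)).im)
      (f := fun x : 𝔼 n × Circle => (x.2 : ℂ)) (u, z) (contDiffAt_log_conj_mul z).contMDiffAt
      ((contMDiff_coe_circle z).comp (u, z) contMDiffAt_snd)
  have h4 : ContMDiffAt ((𝓡 n).prod (𝓡 1)) 𝓘(ℝ, 𝔼 n × ℝ) ∞ (fun x : 𝔼 n × Circle =>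
      (x.1, (Complex.log ((starRingEnd ℂ) (z : ℂ) * (x.2 : ℂ))).im)) (u, z) :=
    contMDiffAt_fst.prodMk_space h3
  refine (((hf z).contMDiff _).comp (u, z) h4).congr_of_eventuallyEq
    (Eventually.of_forall fun x => ?_)
  simp only [Function.comp_apply, mul_exp_log_conj_mul]

variable {d : ℕ} {G : Type*} [TopologicalSpace G] [ChartedSpace (𝔼 d) G] [Group G]
  [LieGroup (𝓡 d) ∞ G]

/-- A partial Maurer–Cartan form is the full one on `𝔼 n × ℝ` restricted to the first factor. -/
lemma contMDiff_mc_eval {γ : 𝔼 n → LoopGroup d G} (hγ : γ ∈ (loopDiffeology d G).plots n) :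
    ContMDiff ((𝓡 n).prod (𝓡 1)) 𝓘(ℝ, 𝔼 n →L[ℝ] LieAlg d) ∞
      fun x : 𝔼 n × Circle => mc d (fun w => (γ w).eval x.2) x.1 := by
  refine contMDiff_of_comp_exp fun z => ?_
  have hΓ : ContMDiff 𝓘(ℝ, 𝔼 n × ℝ) (𝓡 d) ∞ fun x : 𝔼 n × ℝ =>
      (γ x.1).eval (z * Circle.exp x.2) := ContMDiff.comp (f := fun x : 𝔼 n × ℝ =>
        (x.1, z * Circle.exp x.2)) hγ (contMDiff_mul_exp z)
  have h1 := (contDiff_mc hΓ).clm_comp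
    (contDiff_const (c := (ContinuousLinearMap.id ℝ (𝔼 n)).prod (0 : 𝔼 n →L[ℝ] ℝ)))
  convert h1 using 2 with x
  have h2 : HasFDerivAt (fun w : 𝔼 n => (w, x.2))
      ((ContinuousLinearMap.id ℝ (𝔼 n)).prod 0) x.1 :=
    (hasFDerivAt_id x.1).prodMk (hasFDerivAt_const _ _)
  have h3 := mc_comp (f := fun w : 𝔼 n => (w, x.2)) (u := x.1)
    ((hΓ _).mdifferentiableAt (by simp)) h2.differentiableAt
  rwa [h2.fderiv] at h3

lemma contMDiff_logDeriv {γ : 𝔼 n → LoopGroup d G} (hγ : γ ∈ (loopDiffeology d G).plots n) :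
    ContMDiff ((𝓡 n).prod (𝓡 1)) (𝓡 d) ∞
      fun x : 𝔼 n × Circle => logDeriv (γ x.1) x.2 := by
  refine contMDiff_of_comp_exp fun z => ?_
  have hΓ : ContMDiff 𝓘(ℝ, 𝔼 n × ℝ) (𝓡 d) ∞ fun x : 𝔼 n × ℝ =>
      (γ x.1).eval (z * Circle.exp x.2) := ContMDiff.comp (f := fun x : 𝔼 n × ℝ =>
        (x.1, z * Circle.exp x.2)) hγ (contMDiff_mul_exp z)
  have h1 := (contDiff_mc hΓ).clm_apply (contDiff_const (c := ((0 : 𝔼 n), (1 : ℝ))))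
  convert h1 using 2 with x
  have h2 : HasFDerivAt (fun t : ℝ => (x.1, x.2 + t))
      ((0 : ℝ →L[ℝ] 𝔼 n).prod (ContinuousLinearMap.id ℝ ℝ)) 0 :=
    (hasFDerivAt_const _ _).prodMk ((hasFDerivAt_id _).const_add _)
  have h3 := mc_comp (f := fun t : ℝ => (x.1, x.2 + t)) (u := 0)
    ((hΓ _).mdifferentiableAt (by simp)) h2.differentiableAt
  rw [h2.fderiv] at h3
  simp only [add_zero, Circle.exp_add, ← mul_assoc] at h3
  rw [logDeriv_eq_mc, h3]
  rfl

/-- The cocycle rule behind the law of a Higgs field: in a trivialization `τ`, the loop `τ⁻¹∂τ` is a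
local Higgs field. -/
lemma logDeriv_mul (γ δ : LoopGroup d G) (θ : Circle) :
    logDeriv (γ * δ) θ = Ad d (δ.eval θ)⁻¹ (logDeriv γ θ) + logDeriv δ θ := by
  have h (γ : LoopGroup d G) : MDifferentiableAt 𝓘(ℝ, ℝ) (𝓡 d)
      (fun t : ℝ => γ.eval (θ * Circle.exp t)) 0 := by
    have h1 : ContMDiff 𝓘(ℝ, ℝ) (𝓡 1) ∞ fun t : ℝ => θ * Circle.exp t :=
      contMDiff_const.mul contMDiff_circleExp
    exact ((γ.1.contMDiff.comp h1) 0).mdifferentiableAt (by simp)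
  have h2 := mc_mul (h γ) (h δ)
  simp only [Circle.exp_zero, mul_one] at h2
  rw [logDeriv_eq_mc, logDeriv_eq_mc, logDeriv_eq_mc]
  exact congrArg (fun l : ℝ →L[ℝ] LieAlg d => l 1) h2

end JointSmoothness

/-! ### Existence of connections and Higgs fields -/

section Existence

variable {d : ℕ} {G : Type*} [TopologicalSpace G] [ChartedSpace (𝔼 d) G] [Group G]
  [LieGroup (𝓡 d) ∞ G]
  {m : ℕ} {M : Type*} [TopologicalSpace M] [ChartedSpace (𝔼 m) M] [IsManifold (𝓡 m) ∞ M]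

/-- A smooth partition of unity subordinate to a cover over which a loop bundle is trivialized. -/
structure TrivializingPartition (P : LoopBundle d G m M) where
  U : M → Set M
  isOpen : ∀ x, IsOpen (U x)
  ρ : SmoothPartitionOfUnity M (𝓡 m) M
  subordinate : ρ.IsSubordinate U
  τ : M → P.Total → LoopGroup d G
  tau_act : ∀ x q γ, P.proj q ∈ U x → τ x (P.act q γ) = τ x q * γ
  tau_smooth : ∀ x {n : ℕ} {p : 𝔼 n → P.Total}, p ∈ P.diffeology.plots n →
    (∀ u, P.proj (p u) ∈ U x) → (fun u => τ x (p u)) ∈ (loopDiffeology d G).plots n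

lemma exists_trivializingPartition [T2Space M] [SigmaCompactSpace M] (P : LoopBundle d G m M) :
    Nonempty (TrivializingPartition P) := by
  choose U s τ hU hx h1 h2 h3 h4 h5 using P.locally_trivial
  obtain ⟨ρ, hρ⟩ := SmoothPartitionOfUnity.exists_isSubordinate (𝓡 m) isClosed_univ U hU
    fun x _ => mem_iUnion.2 ⟨x, hx x⟩
  exact ⟨⟨U, hU, ρ, hρ, τ, fun x q γ hq => P.tau_act (h2 x) (h3 x) hq γ, fun x => h5 x⟩⟩

namespace TrivializingPartition

variable {P : LoopBundle d G m M} (T : TrivializingPartition P)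

/-- Averages with respect to the partition of unity. -/
def avg {V : Type*} [AddCommGroup V] [Module ℝ V] (y : M) (c : M → V) : V :=
  ∑ x ∈ T.ρ.finsupport y, T.ρ x y • c x

variable {V : Type*} [AddCommGroup V] [Module ℝ V]

lemma avg_congr {y : M} {c c' : M → V} (h : ∀ x, T.ρ x y ≠ 0 → c x = c' x) :
    T.avg y c = T.avg y c' := by
  refine Finset.sum_congr rfl fun x hx => ?_
  rw [h x ((T.ρ.mem_finsupport y).1 hx)]

lemma avg_const (y : M) (c : V) : T.avg y (fun _ => c) = c := by
  rw [avg, ← Finset.sum_smul, T.ρ.sum_finsupport y (mem_univ y), one_smul]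

lemma avg_add (y : M) (c c' : M → V) : T.avg y (fun x => c x + c' x) = T.avg y c + T.avg y c' := by
  simp only [avg, smul_add, Finset.sum_add_distrib]

lemma map_avg {W : Type*} [AddCommGroup W] [Module ℝ W] (L : V →ₗ[ℝ] W) (y : M) (c : M → V) :
    L (T.avg y c) = T.avg y fun x => L (c x) := by
  simp only [avg, map_sum, map_smul]

lemma avg_eventuallyEq (y₀ : M) : ∀ᶠ y in 𝓝 y₀, ∀ c : M → V,
    T.avg y c = ∑ x ∈ T.ρ.fintsupport y₀, T.ρ x y • c x := by
  filter_upwards [T.ρ.eventually_finsupport_subset y₀] with y hy c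
  refine Finset.sum_subset hy fun x _ hx => ?_
  have : T.ρ x y = 0 := by
    by_contra h
    exact hx ((T.ρ.mem_finsupport y).2 h)
  rw [this, zero_smul]

/-- If `u` lies over the support of `ρ x`, a retraction into the trivializing set extends the local
loop coordinate. Otherwise `ρ x` vanishes near `u`, the condition is void, and the constant loop
will do. -/
lemma exists_local_plot {n : ℕ} {p : 𝔼 n → P.Total} (hp : p ∈ P.diffeology.plots n) (u : 𝔼 n)
    (x : M) : ∃ γ : 𝔼 n → LoopGroup d G, γ ∈ (loopDiffeology d G).plots n ∧
      ∀ᶠ w in 𝓝 u, T.ρ x (P.proj (p w)) ≠ 0 → (fun w' => T.τ x (p w')) =ᶠ[𝓝 w] γ := by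
  have hc : Continuous fun w => P.proj (p w) :=
    (show ContMDiff (𝓡 n) (𝓡 m) ∞ fun w => P.proj (p w) from P.proj_smooth hp).continuous
  by_cases hu : P.proj (p u) ∈ tsupport (T.ρ x)
  · obtain ⟨r, hr, hrU, hru⟩ := exists_smooth_retract ((T.isOpen x).preimage hc)
      (show u ∈ _ from T.subordinate x hu)
    refine ⟨fun w => T.τ x (p (r w)), T.tau_smooth x (P.diffeology.plot_reparam hp hr) hrU, ?_⟩
    filter_upwards [hru.eventually_nhds] with w hw _
    filter_upwards [hw] with w' hw'
    rw [hw']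
  · refine ⟨fun _ => 1, (loopDiffeology d G).constant_plots 1, ?_⟩
    filter_upwards [hc.continuousAt.preimage_mem_nhds
      ((isClosed_tsupport (T.ρ x)).isOpen_compl.mem_nhds hu)] with w hw h
    exact (hw (subset_tsupport _ h)).elim

/-- The average of the flat connections given by the local trivializations. -/
def form {n : ℕ} (p : 𝔼 n → P.Total) (u : 𝔼 n) (θ : Circle) : 𝔼 n →L[ℝ] LieAlg d :=
  T.avg (P.proj (p u)) fun x => mc d (fun w => (T.τ x (p w)).eval θ) u

/-- Loops are based, so their value at `1` is constant and the average takes values in `Ω𝔤`. -/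
lemma form_one {n : ℕ} (p : 𝔼 n → P.Total) (u : 𝔼 n) : T.form p u 1 = 0 := by
  have h (x : M) : mc d (fun w => (T.τ x (p w)).eval 1) u = 0 := by
    have h1 (w : 𝔼 n) : (T.τ x (p w)).eval 1 = 1 := (T.τ x (p w)).2
    simp only [h1, mc_const]
  rw [form, T.avg_congr fun x _ => h x, T.avg_const]

lemma mdifferentiableAt_tau {n : ℕ} {p : 𝔼 n → P.Total} (hp : p ∈ P.diffeology.plots n) {u : 𝔼 n}
    {x : M} (hx : T.ρ x (P.proj (p u)) ≠ 0) (θ : Circle) :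
    MDifferentiableAt (𝓡 n) (𝓡 d) (fun w => (T.τ x (p w)).eval θ) u := by
  obtain ⟨γ, hγ, h⟩ := T.exists_local_plot hp u x
  have h1 : (fun w => (T.τ x (p w)).eval θ) =ᶠ[𝓝 u] fun w => (γ w).eval θ :=
    (h.self_of_nhds hx).fun_comp fun γ : LoopGroup d G => γ.eval θ
  exact (((contMDiff_eval hγ (contMDiff_const (c := θ))) u).mdifferentiableAt
    (by simp)).congr_of_eventuallyEq h1

/-- Locally the average is a finite sum over a fixed index set, and `c` need only agree with a
smooth family where the weight is nonzero. -/
lemma contMDiffAt_avg {V : Type*} [NormedAddCommGroup V] [NormedSpace ℝ V] {n : ℕ}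
    {p : 𝔼 n → P.Total} (hp : p ∈ P.diffeology.plots n) {u : 𝔼 n} {θ : Circle}
    {c : 𝔼 n → Circle → M → V} {c' : M → 𝔼 n × Circle → V}
    (hc' : ∀ x, ContMDiff ((𝓡 n).prod (𝓡 1)) 𝓘(ℝ, V) ∞ (c' x))
    (h : ∀ x, ∀ᶠ w in 𝓝 u, T.ρ x (P.proj (p w)) ≠ 0 → ∀ z, c w z x = c' x (w, z)) :
    ContMDiffAt ((𝓡 n).prod (𝓡 1)) 𝓘(ℝ, V) ∞
      (fun y : 𝔼 n × Circle => T.avg (P.proj (p y.1)) (c y.1 y.2)) (u, θ) := by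
  have hp' : ContMDiff (𝓡 n) (𝓡 m) ∞ fun w => P.proj (p w) := P.proj_smooth hp
  have h1 : ContMDiff ((𝓡 n).prod (𝓡 1)) 𝓘(ℝ, V) ∞ fun y : 𝔼 n × Circle =>
      ∑ x ∈ T.ρ.fintsupport (P.proj (p u)), T.ρ x (P.proj (p y.1)) • c' x y := by
    refine contMDiff_finsetSum fun x _ => ?_
    exact ((T.ρ x).contMDiff.comp (hp'.comp contMDiff_fst)).smul (hc' x)
  refine (h1 (u, θ)).congr_of_eventuallyEq ?_
  have h2 : ∀ᶠ w in 𝓝 u, ∀ z, T.avg (P.proj (p w)) (c w z) =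
      ∑ x ∈ T.ρ.fintsupport (P.proj (p u)), T.ρ x (P.proj (p w)) • c' x (w, z) := by
    filter_upwards [hp'.continuous.continuousAt.eventually (T.avg_eventuallyEq (V := V) _),
      (Filter.eventually_all_finset _).2 fun x (_ : x ∈ T.ρ.fintsupport (P.proj (p u))) => h x]
      with w hw hw' z
    rw [hw]
    refine Finset.sum_congr rfl fun x hx => ?_
    by_cases h0 : T.ρ x (P.proj (p w)) = 0
    · rw [h0, zero_smul, zero_smul]
    · rw [hw' x hx h0]
  filter_upwards [(continuous_fst.tendsto (u, θ)).eventually h2] with y hy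
  exact hy y.2

lemma contMDiff_form {n : ℕ} {p : 𝔼 n → P.Total} (hp : p ∈ P.diffeology.plots n) :
    ContMDiff ((𝓡 n).prod (𝓡 1)) 𝓘(ℝ, 𝔼 n →L[ℝ] LieAlg d) ∞
      fun y : 𝔼 n × Circle => T.form p y.1 y.2 := by
  rintro ⟨u, θ⟩
  choose γ hγ h using T.exists_local_plot hp u
  refine T.contMDiffAt_avg hp (c := fun u θ x => mc d (fun w => (T.τ x (p w)).eval θ) u)
    (fun x => contMDiff_mc_eval (hγ x)) fun x => ?_
  filter_upwards [h x] with w hw hρ z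
  exact mc_congr ((hw hρ).fun_comp fun γ : LoopGroup d G => γ.eval z)

lemma contMDiff_form_apply {n : ℕ} {p : 𝔼 n → P.Total} (hp : p ∈ P.diffeology.plots n) (v : 𝔼 n) :
    ContMDiff ((𝓡 n).prod (𝓡 1)) (𝓡 d) ∞ fun y : 𝔼 n × Circle => T.form p y.1 y.2 v :=
  (T.contMDiff_form hp).clm_apply contMDiff_const

/-- The value of the averaged connection on a tangent vector. -/
def loopForm {n : ℕ} {p : 𝔼 n → P.Total} (hp : p ∈ P.diffeology.plots n) (u v : 𝔼 n) : LoopAlg d :=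
  ⟨⟨fun θ => T.form p u θ v, ContMDiff.comp (f := fun θ : Circle => (u, θ))
    (T.contMDiff_form_apply hp v) (contMDiff_const.prodMk contMDiff_id)⟩, by
      change T.form p u 1 v = 0
      rw [T.form_one]
      rfl⟩

open Classical in
/-- The averaged connection, with value `0` on maps which are not smooth. -/
def connectionFun {n : ℕ} (p : 𝔼 n → P.Total) (u : 𝔼 n) : 𝔼 n →ₗ[ℝ] LoopAlg d :=
  if hp : p ∈ P.diffeology.plots n then
    { toFun := T.loopForm hp u
      map_add' := fun v w => by
        refine Subtype.ext (ContMDiffMap.ext fun θ => ?_)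
        exact map_add (T.form p u θ) v w
      map_smul' := fun c v => by
        refine Subtype.ext (ContMDiffMap.ext fun θ => ?_)
        exact map_smul (T.form p u θ) c v }
  else 0

lemma connectionFun_apply {n : ℕ} {p : 𝔼 n → P.Total} (hp : p ∈ P.diffeology.plots n) (u v : 𝔼 n)
    (θ : Circle) : (T.connectionFun p u v).1 θ = T.form p u θ v := by
  rw [connectionFun, dif_pos hp]
  rfl

lemma form_comp {n k : ℕ} {p : 𝔼 n → P.Total} (hp : p ∈ P.diffeology.plots n) {f : 𝔼 k → 𝔼 n}
    (hf : ContDiff ℝ ∞ f) (u : 𝔼 k) (θ : Circle) :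
    T.form (p ∘ f) u θ = (T.form p (f u) θ).comp (fderiv ℝ f u) := by
  have h := T.map_avg ((ContinuousLinearMap.compL ℝ (𝔼 k) (𝔼 n) (LieAlg d)).flip
    (fderiv ℝ f u)).toLinearMap (P.proj (p (f u)))
    fun x => mc d (fun w => (T.τ x (p w)).eval θ) (f u)
  refine Eq.trans (T.avg_congr fun x hx => ?_) h.symm
  exact mc_comp (T.mdifferentiableAt_tau hp hx θ) ((hf.differentiable (by simp)) u)

/-- Each local flat form obeys the affine law, and the inhomogeneous term, independent of the
trivialization, survives averaging since the weights sum to one. -/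
lemma form_act {n : ℕ} {p : 𝔼 n → P.Total} (hp : p ∈ P.diffeology.plots n)
    {γ : 𝔼 n → LoopGroup d G} (hγ : γ ∈ (loopDiffeology d G).plots n) (u : 𝔼 n) (θ : Circle) :
    T.form (fun w => P.act (p w) (γ w)) u θ =
      (Ad d ((γ u).eval θ)⁻¹).comp (T.form p u θ) + mc d (fun w => (γ w).eval θ) u := by
  have hc : Continuous fun w => P.proj (p w) :=
    (show ContMDiff (𝓡 n) (𝓡 m) ∞ fun w => P.proj (p w) from P.proj_smooth hp).continuous
  have h1 (x : M) (hx : T.ρ x (P.proj (p u)) ≠ 0) :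
      mc d (fun w => (T.τ x (P.act (p w) (γ w))).eval θ) u =
        (Ad d ((γ u).eval θ)⁻¹).comp (mc d (fun w => (T.τ x (p w)).eval θ) u) +
          mc d (fun w => (γ w).eval θ) u := by
    have hU : P.proj (p u) ∈ T.U x := T.subordinate x (subset_tsupport _ hx)
    have h2 : (fun w => (T.τ x (P.act (p w) (γ w))).eval θ) =ᶠ[𝓝 u]
        fun w => (T.τ x (p w)).eval θ * (γ w).eval θ := by
      filter_upwards [hc.continuousAt.preimage_mem_nhds ((T.isOpen x).mem_nhds hU)] with w hw
      rw [T.tau_act x _ _ hw]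
      rfl
    rw [mc_congr h2, mc_mul (T.mdifferentiableAt_tau hp hx θ)
      (((contMDiff_eval hγ (contMDiff_const (c := θ))) u).mdifferentiableAt (by simp))]
  rw [form, P.proj_act, T.avg_congr h1, T.avg_add, T.avg_const]
  congr 1
  exact (T.map_avg (ContinuousLinearMap.compL ℝ (𝔼 n) _ _
    (Ad d ((γ u).eval θ)⁻¹)).toLinearMap _ _).symm

/-- The connection given by a partition of unity. -/
def connection : LoopConnection P where
  toFun p u := T.connectionFun p u
  smooth hp v := by
    simp only [T.connectionFun_apply hp]
    exact T.contMDiff_form_apply hp v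
  natural {n k p f} hp hf u v := by
    refine Subtype.ext (ContMDiffMap.ext fun θ => ?_)
    rw [T.connectionFun_apply hp, T.connectionFun_apply (P.diffeology.plot_reparam hp hf),
      T.form_comp hp hf]
    rfl
  equivariant {n p} hp γ u v θ := by
    rw [T.connectionFun_apply hp, T.connectionFun_apply (P.act_const_smooth hp γ),
      T.form_act hp ((loopDiffeology d G).constant_plots γ), mc_const, add_zero]
    rfl
  vertical q n c hc u hu v θ := by
    have hq := P.diffeology.constant_plots (n := n) q
    rw [T.connectionFun_apply (P.act_smooth hq hc), T.form_act hq hc]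
    have h1 : T.form (fun _ : 𝔼 n => q) u θ = 0 := by
      rw [form]
      simp only [mc_const]
      exact T.avg_const _ _
    rw [h1, ContinuousLinearMap.comp_zero, zero_add, mc, hu]
    have h2 (w : 𝔼 n) : ((1 : LoopGroup d G).eval θ)⁻¹ * (c w).eval θ = (c w).eval θ := by
      rw [show (1 : LoopGroup d G).eval θ = 1 from rfl, inv_one, one_mul]
    simp only [h2]
    rfl

/-- The Higgs field given by a partition of unity. -/
def higgsFun (q : P.Total) (θ : Circle) : LieAlg d :=
  T.avg (P.proj q) fun x => logDeriv (T.τ x q) θ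

lemma contMDiff_higgsFun {n : ℕ} {p : 𝔼 n → P.Total} (hp : p ∈ P.diffeology.plots n) :
    ContMDiff ((𝓡 n).prod (𝓡 1)) (𝓡 d) ∞
      fun y : 𝔼 n × Circle => T.higgsFun (p y.1) y.2 := by
  rintro ⟨u, θ⟩
  choose γ hγ h using T.exists_local_plot hp u
  refine T.contMDiffAt_avg hp (c := fun u θ x => logDeriv (T.τ x (p u)) θ)
    (fun x => contMDiff_logDeriv (hγ x)) fun x => ?_
  filter_upwards [h x] with w hw hρ z
  exact congrArg (fun γ => logDeriv γ z) (hw hρ).self_of_nhds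

/-- The Higgs field given by a partition of unity. -/
def higgsField : HiggsField P where
  -- A single point of `P` is treated as a plot on the zero-dimensional space.
  toFun q := ⟨T.higgsFun q, ContMDiff.comp (f := fun θ : Circle => ((0 : 𝔼 0), θ))
    (T.contMDiff_higgsFun (P.diffeology.constant_plots (n := 0) q))
    (contMDiff_const.prodMk contMDiff_id)⟩
  smooth hp := T.contMDiff_higgsFun hp
  equivariant q γ θ := by
    change T.avg _ _ = Ad d (γ.eval θ)⁻¹ (T.avg _ _) + _
    have h1 (x : M) (hx : T.ρ x (P.proj q) ≠ 0) : logDeriv (T.τ x (P.act q γ)) θ =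
        Ad d (γ.eval θ)⁻¹ (logDeriv (T.τ x q) θ) + logDeriv γ θ := by
      rw [T.tau_act x q γ (T.subordinate x (subset_tsupport _ hx)), logDeriv_mul]
    rw [P.proj_act, T.avg_congr h1, T.avg_add, T.avg_const]
    congr 1
    exact (T.map_avg (Ad d (γ.eval θ)⁻¹).toLinearMap _ _).symm

end TrivializingPartition

lemma nonempty_loopConnection_higgsField [T2Space M] [SigmaCompactSpace M]
    (P : LoopBundle d G m M) : Nonempty (LoopConnection P × HiggsField P) := by
  obtain ⟨T⟩ := exists_trivializingPartition P
  exact ⟨(T.connection, T.higgsField)⟩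

end Existence

end Caloron

end

/-! ### The main theorem -/

theorem mainTheorem8 {d : ℕ} {G : Type*} [TopologicalSpace G] [ChartedSpace (𝔼 d) G] [Group G]
    [LieGroup (𝓡 d) ∞ G] [T2Space G] [CompactSpace G] [ConnectedSpace G]
    {m : ℕ} {M : Type*} [TopologicalSpace M] [ChartedSpace (𝔼 m) M] [IsManifold (𝓡 m) ∞ M]
    [T2Space M] [SigmaCompactSpace M]
    {n : ℕ} {N : Type*} [TopologicalSpace N] [ChartedSpace (𝔼 n) N] [IsManifold (𝓡 n) ∞ N]
    [T2Space N] [SigmaCompactSpace N]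
    {k : ℕ} (f : InvariantPolynomial d G (k + 1)) (P : LoopBundle d G m M) :
    -- the string form is a well-defined closed form
    (∀ (A : LoopConnection P) (Φ : HiggsField P),
      IsCaloronForm A Φ (caloronForm A Φ) ∧
      IsConnection (caloronBundle P) (caloronForm A Φ) ∧
      IsChernWeilForm f (caloronBundle P) (caloronForm A Φ)
        (chernWeilForm f (caloronBundle P) (caloronForm A Φ)) ∧
      stringForm f A Φ ∈ closedForms (𝓡 m) M (2 * k + 1)) ∧
    -- the string class is well-defined
    Nonempty (LoopConnection P × HiggsField P) ∧
    (∀ (A : LoopConnection P) (Φ : HiggsField P),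
      stringClass f P = deRhamClass (𝓡 m) (stringForm f A Φ)) ∧
    -- the string form is natural under pullback
    (∀ (ψ : C^∞⟮𝓡 n, N; 𝓡 m, M⟯) (A : LoopConnection P) (Φ : HiggsField P),
      formPullback (𝓡 m) (𝓡 n) ψ (stringForm f A Φ) =
        stringForm f (A.pullback (LoopBundle.pullbackMap P ψ))
          (Φ.pullback (LoopBundle.pullbackMap P ψ))) ∧
    -- the string class is natural under pullback
    (∀ ψ : C^∞⟮𝓡 n, N; 𝓡 m, M⟯,
      deRhamPullback (𝓡 m) (𝓡 n) ψ ψ.contMDiff (2 * k + 1) (stringClass f P) =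
        stringClass f (LoopBundle.pullback P ψ)) ∧
    -- and, more generally, under all bundle maps (in particular it is an isomorphism invariant)
    (∀ (ψ : C^∞⟮𝓡 n, N; 𝓡 m, M⟯) (Q : LoopBundle d G n N) (_ : BundleMap Q P ψ),
      deRhamPullback (𝓡 m) (𝓡 n) ψ ψ.contMDiff (2 * k + 1) (stringClass f P) =
        stringClass f Q) := by
  have h := nonempty_loopConnection_higgsField P
  exact ⟨fun A Φ => ⟨isCaloronForm_caloronForm A Φ, isConnection_caloronForm A Φ,
    isChernWeilForm_caloronForm f A Φ, stringForm_mem_closedForms f A Φ⟩, h, stringClass_eq f,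
    fun ψ A Φ => stringForm_pullback f ψ.contMDiff A Φ _,
    fun ψ => stringClass_pullback f ψ.contMDiff (LoopBundle.pullbackMap P ψ) h,
    fun ψ _ F => stringClass_pullback f ψ.contMDiff F h⟩
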